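/- Let $p\ge 5$ be a prime, let $\mathcal O$ be the ring of integers of a finite extension of $\mathbb Q_p$, with uniformizer $\varpi$ and residue field $\mathbb F$, and let $v_p$ be the $p$-adic valuation with $v_p(p)=1$. Put $\Delta=\mathbb F_p^\times$ and let $\omega:\Delta\to\mathcal O^\times$ be the Teichmüller character. For $m\in\mathbb Z$ let $\{m\}\in\{0,\dots,p-2\}$ be its residue modulo $p-1$. Let $\mathrm K_p=\mathrm{GL}_2(\mathbb Z_p)$, and let $\mathrm{Iw}_p\subset \mathrm K_p$ be the subgroup of matrices that are upper triangular modulo $p$. Fix $1\le a\le p-4$. Let $\widetilde{\mathrm H}$ be a finitely generated projective right $\mathcal O[\![\mathrm K_p]\!]$-module such that $\widetilde{\mathrm H}/(\varpi,\mathrm I_{1+p\mathrm M_2(\mathbb Z_p)})$, where $\mathrm I_{1+p\mathrm M_2(\mathbb Z_p)}$ is the augmentation ideal of $\mathcal O[\![1+p\mathrm M_2(\mathbb Z_p)]\!]$, is a projective envelope of $\mathrm{Sym}^a\mathbb F^{\oplus2}$ as a right $\mathbb F[\mathrm{GL}_2(\mathbb F_p)]$-module (for instance, a primitive $\mathcal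 O[\![\mathrm K_p]\!]$-projective augmented module whose type is a reducible, nonsplit, generic representation $\begin{pmatrix}\omega_1^{a+1}&*\neq0\\0&1\end{pmatrix}$ of the inertia group at $p$, with $\omega_1$ the first fundamental character). For an integer $k\ge2$, matrices $\begin{pmatrix}\alpha&\beta\\\gamma&\delta\end{pmatrix}\in\mathrm K_p$ act from the right on $\mathcal O[z]^{\le k-2}$ by $f\mapsto(\gamma z+\delta)^{k-2}f\big(\tfrac{\alpha z+\beta}{\gamma z+\delta}\big)$. For characters $\eta:\Delta\to\mathcal O^\times$ and $\psi:\Delta^2\to\mathcal O^\times$ let $d_k^{\mathrm{ur}}(\eta)$ and $d_k^{\mathrm{Iw}}(\psi)$ be the $\mathcal O$-ranks of the modules of continuous homomorphisms $$\mathrm{Hom}_{\mathcal O[\mathrm K_p]}\big(\widetilde{\mathrm H},\mathcal O[z]^{\le k-2}\otimes\eta\circ\det\big)\quad\text{and}\quad \mathrm{Hom}_{\mathcal O[\mathrm{Iw}_p]}\big(\widetilde{\mathrm H},\mathcal O[z]^{\le k-2}\otimes\psi\big),$$ where a matrix $\begin{pmatrix}\alpha&\beta\\\gamma&\delta\end{pmatrix}\in\mathrm{Iw}_p$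 of determinant $d$ acts on $\psi$ by $\psi(\bar d/\bar\delta,\bar\delta)$. Let $\varepsilon=\varepsilon_1\times\varepsilon_2$ be a relevant character of $\Delta^2$, i.e. $\varepsilon(x,x)=\omega(x)^a$ for all $x\in\Delta$; write $\varepsilon=\omega^{-s_\varepsilon}\times\omega^{a+s_\varepsilon}$ with $s_\varepsilon\in\{0,\dots,p-2\}$, and put $\tilde\varepsilon_1=\varepsilon_1\times\varepsilon_1$, $k_\varepsilon=2+\{a+2s_\varepsilon\}$ and $\delta_\varepsilon=\big\lfloor\frac{s_\varepsilon+\{a+s_\varepsilon\}}{p-1}\big\rfloor$. If $a+s_\varepsilon<p-1$, put $t_1=s_\varepsilon+\delta_\varepsilon$ and $t_2=a+s_\varepsilon+\delta_\varepsilon+2$; otherwise put $t_1=\{a+s_\varepsilon\}+\delta_\varepsilon+1$ and $t_2=s_\varepsilon+\delta_\varepsilon+1$. For $n\in\mathbb Z$ put $\beta_{[n]}=t_1$ if $n$ is even and $\beta_{[n]}=t_2-\frac{p+1}2$ if $n$ is odd. The ghost series is $G^{(\varepsilon)}(w,t)=\sum_{n\ge0}g_n^{(\varepsilon)}(w)t^n$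 with $$g_n^{(\varepsilon)}(w)=\prod_{k\ge2,\ k\equiv k_\varepsilon\bmod (p-1)}(w-w_k)^{m_n^{(\varepsilon)}(k)},\qquad w_k=\exp(p(k-2))-1,$$ where $m_n^{(\varepsilon)}(k)=\min\{n-d_k^{\mathrm{ur}}(\varepsilon_1),\,d_k^{\mathrm{Iw}}(\tilde\varepsilon_1)-d_k^{\mathrm{ur}}(\varepsilon_1)-n\}$ if $d_k^{\mathrm{ur}}(\varepsilon_1)<n<d_k^{\mathrm{Iw}}(\tilde\varepsilon_1)-d_k^{\mathrm{ur}}(\varepsilon_1)$, and $m_n^{(\varepsilon)}(k)=0$ otherwise. For a power series $F=\sum_n c_nt^n$ over $\mathbb Q_p$ with $c_0=1$, let $\mathrm{NP}(F)$ be its Newton polygon, i.e. the lower boundary of the convex hull of the points $(n,v_p(c_n))$ with $c_n\ne0$; its slopes are listed in increasing order with multiplicity, the $i$-th one being the slope over $[i-1,i]$. Let $k_0\ge2$ be an integer with $k_0\equiv k_\varepsilon\bmod(p-1)$ and put $d=d_{k_0}^{\mathrm{ur}}(\varepsilon_1)$. Then the first $d$ slopes of $\mathrm{NP}(G^{(\varepsilon)}(w_{k_0},-))$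 are all at most $$\Big\lfloor\frac{k_0-1-\min\{a+1,\,p-2-a\}}{p+1}\Big\rfloor.$$ More precisely, they are all at most $$\frac{p-1}2(d-1)-\delta_\varepsilon+\beta_{[d-1]},$$ and this number is itself at most the preceding one. -/

import Mathlib

open Polynomial MulOpposite
open scoped Topology

noncomputable section

namespace Ghost

universe u v

/-! ## The weight `n` polynomial action of `2 × 2` matrices -/

/-- For `g = (α β; γ δ)` and a polynomial `f` of degree at most `n`, the polynomial
`f|_g (z) = (γ z + δ)^n f((α z + β)/(γ z + δ))`, i.e. `z^i ↦ (α z + β)^i (γ z + δ)^(n - i)`. This is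
a right action of the matrices on polynomials of degree at most `n`. -/
def polyAction {R : Type*} [CommRing R] (n : ℕ) (g : Matrix (Fin 2) (Fin 2) R) (f : R[X]) : R[X] :=
  ∑ i ∈ Finset.range (n + 1),
    C (f.coeff i) * (C (g 0 0) * X + C (g 0 1)) ^ i * (C (g 1 0) * X + C (g 1 1)) ^ (n - i)

lemma polyAction_add {R : Type*} [CommRing R] (n : ℕ) (g : Matrix (Fin 2) (Fin 2) R)
    (f₁ f₂ : R[X]) : polyAction n g (f₁ + f₂) = polyAction n g f₁ + polyAction n g f₂ := by
  simp [polyAction, add_mul, Finset.sum_add_distrib]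

lemma polyAction_smul {R : Type*} [CommRing R] (n : ℕ) (g : Matrix (Fin 2) (Fin 2) R) (c : R)
    (f : R[X]) : polyAction n g (c • f) = c • polyAction n g f := by
  simp [polyAction, Finset.smul_sum, smul_eq_C_mul, mul_assoc]

lemma polyAction_zero {R : Type*} [CommRing R] (n : ℕ) (g : Matrix (Fin 2) (Fin 2) R) :
    polyAction n g 0 = 0 := by
  simp [polyAction]

/-! ## The Iwasawa algebra of `K_p = GL₂(ℤ_p)` -/

/-- The group `K_p = GL₂(ℤ_p)`. -/
abbrev Kp (p : ℕ) [Fact p.Prime] : Type := GL (Fin 2) ℤ_[p]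

/-- The finite quotient `GL₂(ℤ/p^m)` of `K_p`. -/
abbrev KQuot (p m : ℕ) : Type := GL (Fin 2) (ZMod (p ^ m))

/-- Reduction `K_p → GL₂(ℤ/p^m)`. -/
def redPow (p : ℕ) [Fact p.Prime] (m : ℕ) : Kp p →* KQuot p m :=
  Matrix.GeneralLinearGroup.map (PadicInt.toZModPow m)

/-- The transition map `GL₂(ℤ/p^(m+1)) → GL₂(ℤ/p^m)`. -/
def transition (p m : ℕ) : KQuot p (m + 1) →* KQuot p m :=
  Matrix.GeneralLinearGroup.map (ZMod.castHom (pow_dvd_pow p m.le_succ) (ZMod (p ^ m)))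

/-- The map `GL₂(ℤ/p^1) → GL₂(𝔽_p)`. -/
def levelOne (p : ℕ) : KQuot p 1 →* GL (Fin 2) (ZMod p) :=
  Matrix.GeneralLinearGroup.map (ZMod.castHom (dvd_of_eq (pow_one p).symm) (ZMod p))

/-- The Iwasawa algebra `𝒪⟦K_p⟧ = lim_m 𝒪[GL₂(ℤ/p^m)]`. -/
def iwasawaAlgebra (p : ℕ) (O : Type v) [CommRing O] :
    Subalgebra O (∀ m : ℕ, MonoidAlgebra O (KQuot p m)) :=
  ⨅ m : ℕ, AlgHom.equalizer
    ((MonoidAlgebra.mapDomainAlgHom O O (transition p m)).comp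
      (Pi.evalAlgHom O (fun m : ℕ => MonoidAlgebra O (KQuot p m)) (m + 1)))
    (Pi.evalAlgHom O (fun m : ℕ => MonoidAlgebra O (KQuot p m)) m)

lemma transition_redPow (p : ℕ) [Fact p.Prime] (m : ℕ) (g : Kp p) :
    transition p m (redPow p (m + 1) g) = redPow p m g := by
  have h := PadicInt.zmod_cast_comp_toZModPow (p := p) m (m + 1) m.le_succ
  ext i j
  exact congrArg (fun f : ℤ_[p] →+* ZMod (p ^ m) => f (g.1 i j)) h

/-- The group element `[g] ∈ 𝒪⟦K_p⟧` of `g ∈ K_p`. -/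
def groupElt (p : ℕ) [Fact p.Prime] (O : Type v) [CommRing O] (g : Kp p) : iwasawaAlgebra p O :=
  ⟨fun m => MonoidAlgebra.single (redPow p m g) 1, by
    simp only [iwasawaAlgebra, Algebra.mem_iInf, AlgHom.mem_equalizer]
    intro m
    simp [transition_redPow]⟩

/-- The surjection `𝒪⟦K_p⟧ → 𝔽[GL₂(𝔽_p)]`, where `𝔽` is the residue field of `𝒪`. Its kernel is the
two-sided ideal generated by a uniformizer and the augmentation ideal of `1 + p M₂(ℤ_p)`. -/
def reduction (p : ℕ) (O : Type v) [CommRing O] [IsLocalRing O] :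
    iwasawaAlgebra p O →+*
      MonoidAlgebra (IsLocalRing.ResidueField O) (GL (Fin 2) (ZMod p)) :=
  ((MonoidAlgebra.mapRingHom (GL (Fin 2) (ZMod p)) (IsLocalRing.residue O)).comp
    (MonoidAlgebra.mapDomainRingHom O (levelOne p))).comp
    ((Pi.evalRingHom (fun m : ℕ => MonoidAlgebra O (KQuot p m)) 1).comp
      (iwasawaAlgebra p O).subtype)

/-- The `p`-adic topology on `𝒪`. -/
@[reducible] def padicTopology (p : ℕ) (O : Type v) [CommRing O] : TopologicalSpace O :=
  (Ideal.span {(p : O)}).adicTopology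

/-- The inverse limit topology on `𝒪⟦K_p⟧` (transported to the opposite ring), where each
`𝒪[GL₂(ℤ/p^m)]`, a finite free `𝒪`-module, carries its `p`-adic topology. -/
@[reducible] def iwasawaTopology (p : ℕ) (O : Type v) [CommRing O] :
    TopologicalSpace (iwasawaAlgebra p O)ᵐᵒᵖ :=
  letI := padicTopology p O
  TopologicalSpace.induced
    (fun (x : (iwasawaAlgebra p O)ᵐᵒᵖ) (m : ℕ) (g : KQuot p m) => (x.unop.1 m).coeff g)
    inferInstance

/-- The canonical topology on a (finitely generated) right `𝒪⟦K_p⟧`-module. -/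
@[reducible] def canonicalTopology (p : ℕ) (O : Type v) [CommRing O] (H : Type u) [AddCommGroup H]
    [Module (iwasawaAlgebra p O)ᵐᵒᵖ H] : TopologicalSpace H :=
  letI := iwasawaTopology p O
  moduleTopology (iwasawaAlgebra p O)ᵐᵒᵖ H

/-! ## Projective envelopes of Serre weights, and primitive modules -/

/-- The right `𝔽[GL₂(𝔽_p)]`-module `P` is a projective envelope of the Serre weight
`Sym^a 𝔽² = 𝔽[z]^{≤ a}` (with its weight `a` polynomial right action): `P` is projective, and there is
an equivariant surjection `f` from `P` onto `𝔽[z]^{≤ a}` with superfluous kernel. -/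
def IsSerreEnvelope (p a : ℕ) (F : Type v) [Field F] (P : Type u) [AddCommGroup P]
    [Module (MonoidAlgebra F (GL (Fin 2) (ZMod p)))ᵐᵒᵖ P] : Prop :=
  Module.Projective (MonoidAlgebra F (GL (Fin 2) (ZMod p)))ᵐᵒᵖ P ∧
  ∃ f : P →+ degreeLT F (a + 1),
    (∀ (c : F) (g : GL (Fin 2) (ZMod p)) (x : P),
      (f (op (MonoidAlgebra.single g c) • x) : F[X]) =
        c • polyAction a (g.1.map (fun y : ZMod p => (y.cast : F))) (f x : F[X])) ∧
    Function.Surjective f ∧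
    ∀ N : Submodule (MonoidAlgebra F (GL (Fin 2) (ZMod p)))ᵐᵒᵖ P,
      N.toAddSubgroup ⊔ f.ker = ⊤ → N = ⊤

/-- `H` is a finitely generated projective right `𝒪⟦K_p⟧`-module whose reduction
`H / (ϖ, I_{1 + p M₂(ℤ_p)}) H` is, as a right `𝔽[GL₂(𝔽_p)]`-module, a projective envelope of the
Serre weight `Sym^a 𝔽²`. The reduction is presented as the target `P` of a surjection `q` from `H`,
linear along `𝒪⟦K_p⟧ → 𝔽[GL₂(𝔽_p)]`, with kernel `H · ker (𝒪⟦K_p⟧ → 𝔽[GL₂(𝔽_p)])`. -/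
structure IsPrimitive (p : ℕ) (O : Type v) [CommRing O] [IsLocalRing O] (a : ℕ)
    (H : Type u) [AddCommGroup H] [Module (iwasawaAlgebra p O)ᵐᵒᵖ H] : Prop where
  finite : Module.Finite (iwasawaAlgebra p O)ᵐᵒᵖ H
  projective : Module.Projective (iwasawaAlgebra p O)ᵐᵒᵖ H
  envelope : ∃ (P : Type u) (_ : AddCommGroup P)
    (_ : Module (MonoidAlgebra (IsLocalRing.ResidueField O) (GL (Fin 2) (ZMod p)))ᵐᵒᵖ P)
    (q : H →ₛₗ[(reduction p O).op] P),
    Function.Surjective q ∧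
    LinearMap.ker q = Submodule.span (iwasawaAlgebra p O)ᵐᵒᵖ
      {y : H | ∃ (x : iwasawaAlgebra p O) (h : H), reduction p O x = 0 ∧ y = op x • h} ∧
    IsSerreEnvelope p a (IsLocalRing.ResidueField O) P

/-! ## Abstract classical forms and their ranks -/

section Forms

variable (p : ℕ) [Fact p.Prime] (O : Type v) [CommRing O] [Algebra ℤ_[p] O]
  (H : Type u) [AddCommGroup H] [Module O H] [Module (iwasawaAlgebra p O)ᵐᵒᵖ H]

/-- An `𝒪`-linear map from `H` to the finite free `𝒪`-module `𝒪[z]^{< n}` is continuous (for the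
canonical topology on `H` and the `p`-adic topology on the target). -/
def IsContinuousForm {n : ℕ} (φ : H →ₗ[O] degreeLT O n) : Prop :=
  ∀ i : ℕ, Continuous[canonicalTopology p O H, padicTopology p O]
    (fun h => (φ h : O[X]).coeff i)

/-- The reduction `ℤ_p^× → 𝔽_p^×`. -/
def unitRed : ℤ_[p]ˣ →* (ZMod p)ˣ := Units.map (PadicInt.toZMod (p := p)).toMonoidHom

variable {p O H} in
lemma IsContinuousForm.add {n : ℕ} {φ ψ : H →ₗ[O] degreeLT O n}
    (h₁ : IsContinuousForm p O H φ) (h₂ : IsContinuousForm p O H ψ) :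
    IsContinuousForm p O H (φ + ψ) := by
  intro i
  let _ := padicTopology p O
  let _ := canonicalTopology p O H
  have : NonarchimedeanRing O := Ideal.nonarchimedean (Ideal.span {(p : O)})
  have := (h₁ i).add (h₂ i)
  refine this.congr fun h => ?_
  simp

variable {p O H} in
lemma IsContinuousForm.smul {n : ℕ} (c : O) {φ : H →ₗ[O] degreeLT O n}
    (h : IsContinuousForm p O H φ) : IsContinuousForm p O H (c • φ) := by
  intro i
  let _ := padicTopology p O
  let _ := canonicalTopology p O H
  have : NonarchimedeanRing O := Ideal.nonarchimedean (Ideal.span {(p : O)})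
  have := (continuous_const (y := c)).mul (h i)
  refine this.congr fun h => ?_
  simp

variable {p O H} in
lemma IsContinuousForm.zero {n : ℕ} : IsContinuousForm p O H (0 : H →ₗ[O] degreeLT O n) := by
  intro i
  let _ := padicTopology p O
  let _ := canonicalTopology p O H
  simpa using continuous_const

/-- `S_k^ur(η) = Hom_{𝒪[K_p]}(H, 𝒪[z]^{≤ k-2} ⊗ η ∘ det)`: abstract classical forms of weight `k`
with full level structure (for `k ≥ 2`). -/
def urForms (k : ℕ) (η : (ZMod p)ˣ →* Oˣ) : Submodule O (H →ₗ[O] degreeLT O (k - 1)) where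
  carrier := {φ | IsContinuousForm p O H φ ∧ ∀ (g : Kp p) (h : H),
    (φ (op (groupElt p O g) • h) : O[X]) =
      (η (unitRed p (Matrix.GeneralLinearGroup.det g)) : O) •
        polyAction (k - 2) (g.1.map (algebraMap ℤ_[p] O)) (φ h : O[X])}
  add_mem' := by
    rintro φ ψ ⟨h₁, h₁'⟩ ⟨h₂, h₂'⟩
    refine ⟨h₁.add h₂, fun g h => ?_⟩
    simp only [LinearMap.add_apply, Submodule.coe_add, h₁', h₂', polyAction_add, smul_add]
  zero_mem' := ⟨.zero, fun g h => by simp [polyAction_zero]⟩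
  smul_mem' := by
    rintro c φ ⟨h₁, h₁'⟩
    refine ⟨h₁.smul c, fun g h => ?_⟩
    simp only [LinearMap.smul_apply, Submodule.coe_smul, h₁', polyAction_smul]
    rw [smul_comm]

/-- `S_k^Iw(ψ) = Hom_{𝒪[Iw_p]}(H, 𝒪[z]^{≤ k-2} ⊗ ψ)`: abstract classical forms of weight `k`
(for `k ≥ 2`), Iwahori level and character `ψ`, where `(α β; γ δ) ∈ Iw_p` of determinant `d` acts on
`ψ` by `ψ(d̄/δ̄, δ̄)`. Here `Iw_p` consists of the `g ∈ K_p` with lower left entry divisible by `p`. -/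
def iwForms (k : ℕ) (ψ : (ZMod p)ˣ × (ZMod p)ˣ →* Oˣ) :
    Submodule O (H →ₗ[O] degreeLT O (k - 1)) where
  carrier := {φ | IsContinuousForm p O H φ ∧ ∀ (g : Kp p), (p : ℤ_[p]) ∣ g.1 1 0 →
    ∀ (δ : (ZMod p)ˣ), (δ : ZMod p) = PadicInt.toZMod (g.1 1 1) → ∀ (h : H),
    (φ (op (groupElt p O g) • h) : O[X]) =
      (ψ (unitRed p (Matrix.GeneralLinearGroup.det g) / δ, δ) : O) •
        polyAction (k - 2) (g.1.map (algebraMap ℤ_[p] O)) (φ h : O[X])}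
  add_mem' := by
    rintro φ ψ ⟨h₁, h₁'⟩ ⟨h₂, h₂'⟩
    refine ⟨h₁.add h₂, fun g hg δ hδ h => ?_⟩
    simp only [LinearMap.add_apply, Submodule.coe_add, h₁' g hg δ hδ, h₂' g hg δ hδ,
      polyAction_add, smul_add]
  zero_mem' := ⟨.zero, fun g hg δ hδ h => by simp [polyAction_zero]⟩
  smul_mem' := by
    rintro c φ ⟨h₁, h₁'⟩
    refine ⟨h₁.smul c, fun g hg δ hδ h => ?_⟩
    simp only [LinearMap.smul_apply, Submodule.coe_smul, h₁' g hg δ hδ, polyAction_smul]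
    rw [smul_comm]

/-- `d_k^ur(η)`, the rank of `S_k^ur(η)`. -/
def dUr (k : ℕ) (η : (ZMod p)ˣ →* Oˣ) : ℕ := Module.finrank O (urForms p O H k η)

/-- `d_k^Iw(ψ)`, the rank of `S_k^Iw(ψ)`. -/
def dIw (k : ℕ) (ψ : (ZMod p)ˣ × (ZMod p)ˣ →* Oˣ) : ℕ := Module.finrank O (iwForms p O H k ψ)

end Forms

/-! ## Characters -/

/-- The Teichmüller character `ω : 𝔽_p^× → ℤ_p^× → 𝒪^×`. -/
def teich (p : ℕ) [Fact p.Prime] (O : Type v) [CommRing O] [Algebra ℤ_[p] O] :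
    (ZMod p)ˣ →* Oˣ :=
  (Units.map (algebraMap ℤ_[p] O).toMonoidHom).comp
    (Units.map ((WittVector.equiv p).toMonoidHom.comp (WittVector.teichmuller p)))

/-- A character `ε` of `(𝔽_p^×)²` is relevant (for the parameter `a`) if `ε(x, x) = x^a`. -/
def IsRelevant (p : ℕ) [Fact p.Prime] (O : Type v) [CommRing O] [Algebra ℤ_[p] O] (a : ℕ)
    (ε : (ZMod p)ˣ × (ZMod p)ˣ →* Oˣ) : Prop :=
  ∀ x : (ZMod p)ˣ, ε (x, x) = teich p O x ^ a

/-- The first component `ε₁` of `ε = ε₁ × ε₂`. -/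
def fstChar {p : ℕ} {O : Type v} [CommRing O] (ε : (ZMod p)ˣ × (ZMod p)ˣ →* Oˣ) :
    (ZMod p)ˣ →* Oˣ :=
  ε.comp (MonoidHom.inl (ZMod p)ˣ (ZMod p)ˣ)

/-- The character `η̃ = η × η` of `(𝔽_p^×)²`. -/
def doubled {p : ℕ} {O : Type v} [CommRing O] (η : (ZMod p)ˣ →* Oˣ) :
    (ZMod p)ˣ × (ZMod p)ˣ →* Oˣ :=
  η.coprod η

/-! ## Numerical invariants. Here `s = s_ε`, and `{m}` is `m % (p - 1)`. -/

/-- `k_ε = 2 + {a + 2 s_ε}`. -/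
def kEps (p a s : ℕ) : ℕ := 2 + (a + 2 * s) % (p - 1)

/-- `δ_ε = ⌊(s_ε + {a + s_ε}) / (p - 1)⌋`. -/
def deltaEps (p a s : ℕ) : ℕ := (s + (a + s) % (p - 1)) / (p - 1)

/-- `t₁`. -/
def tOne (p a s : ℕ) : ℕ :=
  if a + s < p - 1 then s + deltaEps p a s else (a + s) % (p - 1) + deltaEps p a s + 1

/-- `t₂`. -/
def tTwo (p a s : ℕ) : ℕ :=
  if a + s < p - 1 then a + s + deltaEps p a s + 2 else s + deltaEps p a s + 1

/-- `β_{[n]}`. -/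
def betaEps (p a s : ℕ) (n : ℤ) : ℝ :=
  if Even n then (tOne p a s : ℝ) else (tTwo p a s : ℝ) - ((p : ℝ) + 1) / 2

/-! ## The ghost series -/

/-- The weight point `w_k = exp(p (k - 2)) - 1`. -/
def weightPt (p : ℕ) [Fact p.Prime] (k : ℕ) : ℚ_[p] :=
  NormedSpace.exp ((p : ℚ_[p]) * ((k : ℚ_[p]) - 2)) - 1

section GhostSeries

variable (p : ℕ) [Fact p.Prime] (O : Type v) [CommRing O] [Algebra ℤ_[p] O]
  (H : Type u) [AddCommGroup H] [Module O H] [Module (iwasawaAlgebra p O)ᵐᵒᵖ H]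

/-- The ghost multiplicity `m_n(k)`. -/
def ghostMult (η : (ZMod p)ˣ →* Oˣ) (n k : ℕ) : ℕ :=
  if dUr p O H k η < n ∧ n < dIw p O H k (doubled η) - dUr p O H k η then
    min (n - dUr p O H k η) (dIw p O H k (doubled η) - dUr p O H k η - n)
  else 0

/-- The coefficient `g_n(w) = ∏_{k ≥ 2, k ≡ κ mod p - 1} (w - w_k)^{m_n(k)}` of the ghost series.
For the modules considered here the product is finite: `m_n(k) = 0` for all but finitely many `k`. -/
def ghostCoeff (κ : ℕ) (η : (ZMod p)ˣ →* Oˣ) (n : ℕ) : ℚ_[p][X] :=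
  ∏ᶠ k ∈ {k : ℕ | 2 ≤ k ∧ k ≡ κ [MOD p - 1]}, (X - C (weightPt p k)) ^ ghostMult p O H η n k

/-- The ghost series `G^{(ε)}(w, t) = ∑ g_n(w) t^n`, for a relevant character `ε` whose first
component is `ω^{-s}`. -/
def ghostSeries (a s : ℕ) (ε : (ZMod p)ˣ × (ZMod p)ˣ →* Oˣ) : PowerSeries ℚ_[p][X] :=
  PowerSeries.mk (ghostCoeff p O H (kEps p a s) (fstChar ε))

end GhostSeries

/-- The specialization `G(w₀, t)` of a series `G(w, t)` in `t` with polynomial coefficients in `w`. -/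
def specialize {p : ℕ} [Fact p.Prime] (G : PowerSeries ℚ_[p][X]) (w₀ : ℚ_[p]) :
    PowerSeries ℚ_[p] :=
  PowerSeries.map (evalRingHom w₀) G

/-! ## Newton polygons -/

/-- The convex hull of the points `(n, v_p(c_n))` (with `c_n ≠ 0`) of a power series `∑ c_n t^n`. -/
def newtonHull {p : ℕ} [Fact p.Prime] (F : PowerSeries ℚ_[p]) : Set (ℝ × ℝ) :=
  convexHull ℝ {P | ∃ n : ℕ, PowerSeries.coeff n F ≠ 0 ∧
    P = ((n : ℝ), ((PowerSeries.coeff n F).valuation : ℝ))}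

/-- The Newton polygon, as the function whose graph is the lower boundary of the convex hull. -/
def newtonPolygon {p : ℕ} [Fact p.Prime] (F : PowerSeries ℚ_[p]) (x : ℝ) : ℝ :=
  sInf {y | (x, y) ∈ newtonHull F}

/-- The `i`-th slope (`i ≥ 1`, counted with multiplicity) of the Newton polygon, i.e. its slope
over the interval `[i - 1, i]`. -/
def newtonSlope {p : ℕ} [Fact p.Prime] (F : PowerSeries ℚ_[p]) (i : ℕ) : ℝ :=
  newtonPolygon F i - newtonPolygon F ((i : ℝ) - 1)

end Ghost

end

/-!
The proof has three parts.

*Dimension formulas.* As `H` is projective over `𝒪⟦K_p⟧`, the ranks of the modules of forms are the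
dimensions of spaces of equivariant maps from the reduction of `H`, a projective envelope of `Sym^a`,
to the reductions of the polynomial lattices (`IsReduction.finrank_levelForms`,
`IsPrimitive.exists_envelope`). These dimensions are additive in short exact sequences
(`finrank_eqHom_add`), so they are multiplicities of constituents. Evaluating binary forms on the
plane `𝔽_p²` gives, for `b > p`, an exact sequence
`0 → Sym^(b - p - 1) ⊗ det → Sym^b → Ind χ → 0`, whose first map is the multiplication by the
invariant form `x^p y - x y^p`, and the induced representations have the constituents `Sym^r` and
`Sym^(p - 1 - r) ⊗ det^r`, up to twists. The outcome is `IsPrimitive.rank_formulas`: in weight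
`k_ε + (p - 1) c` the unramified dimension is the number of `n` with `K_n ≤ c`, where the sequence
`K = jump` runs through two interlacing progressions of difference `p + 1`, and the Iwahori dimension
is `2 c + 2 - 2 δ`.

*Increments.* Since `v(w_k - w_l) = 1 + v(k - l)`, the valuation `V n` of the `n`-th ghost
coefficient at the weight of index `c` is an explicit sum for `n ≤ d` (`IsJumpSeq.ghostVal`). With
`E x = x + v(x!)` its increment at `n < d` is `2 E y - E u - E z`, where `y = c - n - δ`,
`u = c - K_n` and `z` is the last index at which the multiplicity drops. By Legendre's formula this is
`K_n - n - δ` plus contributions of the powers `p, p², …` (`IsJumpSeq.ghostVal_succ_sub`). Summed over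
the steps from `n` to `d`, every power contributes at most `d - n - 1`, and only the first `d - n`
powers contribute positively (`IsJumpSeq.sum_incr_le`, `IsJumpSeq.sum_incr_nonpos`). The total
`(d - n) (d - n - 1)` is compensated by the growth of `K_i - i` by at least `2` in each step, so
that `V d - V n ≤ M (d - n)` with `M = K_(d - 1) - (d - 1) - δ` (`IsJumpSeq.ghostVal_sub_le`).

*Newton polygon.* This `M` is the sharper bound of the theorem (`bound_eq`). The points of index at
most `d` thus lie on or above the line of slope `M` through the `d`-th one, and all the valuations are
nonnegative. This already forces the first `d` slopes to be at most `M`, without any information on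
the points beyond `d` (`newtonSlope_le`). Finally `bound_le` compares `M` with the coarser bound.
-/

open Polynomial MulOpposite
open scoped Topology

noncomputable section

namespace Ghost

/-! ### Homogeneous evaluation and the weight `n` action -/

/-- The value at `(x, y)` of the binary form `∑ fᵢ xⁱ y^(n - i)` attached to `f`, the coefficients
of `f` beyond degree `n` being ignored. -/
def homEval {R A : Type*} [CommRing R] [CommRing A] [Algebra R A] (n : ℕ) (f : R[X]) (x y : A) :
    A :=
  MvPolynomial.aeval ![x, y] (f.homogenize n)

section HomEval

variable {R A B : Type*} [CommRing R] [CommRing A] [Algebra R A] [CommRing B] [Algebra R B]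

lemma homEval_eq_sum (n : ℕ) (f : R[X]) (x y : A) :
    homEval n f x y =
      ∑ i ∈ Finset.range (n + 1), algebraMap R A (f.coeff i) * x ^ i * y ^ (n - i) := by
  simp only [homEval, homogenize, map_sum, MvPolynomial.aeval_monomial,
    Finset.Nat.sum_antidiagonal_eq_sum_range_succ_mk]
  refine Finset.sum_congr rfl fun i _ => ?_
  rw [Finsupp.prod_fintype _ _ (by simp)]
  simp [mul_assoc]

lemma homEval_add (n : ℕ) (f₁ f₂ : R[X]) (x y : A) :
    homEval n (f₁ + f₂) x y = homEval n f₁ x y + homEval n f₂ x y := by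
  simp [homEval]

lemma homEval_smul (n : ℕ) (c : R) (f : R[X]) (x y : A) :
    homEval n (c • f) x y = c • homEval n f x y := by
  simp [homEval]

lemma homEval_sum {ι : Type*} (s : Finset ι) (n : ℕ) (f : ι → R[X]) (x y : A) :
    homEval n (∑ i ∈ s, f i) x y = ∑ i ∈ s, homEval n (f i) x y := by
  simp [homEval]

lemma homEval_mul {m n : ℕ} {f₁ f₂ : R[X]} (h₁ : f₁.natDegree ≤ m) (h₂ : f₂.natDegree ≤ n)
    (x y : A) : homEval (m + n) (f₁ * f₂) x y = homEval m f₁ x y * homEval n f₂ x y := by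
  simp [homEval, homogenize_mul _ _ h₁ h₂]

lemma homEval_pow {m : ℕ} {f : R[X]} (h : f.natDegree ≤ m) (x y : A) (k : ℕ) :
    homEval (m * k) (f ^ k) x y = homEval m f x y ^ k := by
  induction k with
  | zero => simp [homEval]
  | succ k ih =>
    rw [pow_succ, pow_succ, mul_add, mul_one, homEval_mul _ h, ih]
    exact (natDegree_pow_le).trans (by rw [mul_comm m k]; exact Nat.mul_le_mul_left _ h)

lemma homEval_linear (a b : R) (x y : A) :
    homEval 1 (C a * X + C b) x y = a • x + b • y := by
  simp [homEval_eq_sum, Finset.sum_range_succ, coeff_C, Algebra.smul_def]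
  ring

lemma natDegree_linear_pow_le (a b : R) (k : ℕ) : ((C a * X + C b) ^ k).natDegree ≤ k :=
  natDegree_pow_le.trans ((Nat.mul_le_mul_left k natDegree_linear_le).trans_eq (mul_one k))

lemma polyAction_eq_homEval (n : ℕ) (g : Matrix (Fin 2) (Fin 2) R) (f : R[X]) :
    polyAction n g f =
      homEval n f (C (g 0 0) * X + C (g 0 1)) (C (g 1 0) * X + C (g 1 1)) := by
  rw [homEval_eq_sum]; rfl

/-- The binary form of `f|_g` is the binary form of `f` composed with `g`. -/
lemma homEval_polyAction (n : ℕ) (g : Matrix (Fin 2) (Fin 2) R) (f : R[X]) (x y : A) :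
    homEval n (polyAction n g f) x y =
      homEval n f (g 0 0 • x + g 0 1 • y) (g 1 0 • x + g 1 1 • y) := by
  rw [polyAction, homEval_sum, homEval_eq_sum n f]
  refine Finset.sum_congr rfl fun i hi => ?_
  have hi : i + (n - i) = n := by have := Finset.mem_range.1 hi; omega
  have h1 := homEval_pow (natDegree_linear_le (a := g 0 0) (b := g 0 1)) x y i
  have h2 := homEval_pow (natDegree_linear_le (a := g 1 0) (b := g 1 1)) x y (n - i)
  rw [one_mul, homEval_linear] at h1 h2
  rw [mul_assoc, ← smul_eq_C_mul, homEval_smul]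
  nth_rewrite 1 [← hi]
  rw [homEval_mul (natDegree_linear_pow_le _ _ _) (natDegree_linear_pow_le _ _ _), h1, h2,
    Algebra.smul_def, mul_assoc]

lemma polyAction_mul (n : ℕ) (g h : Matrix (Fin 2) (Fin 2) R) (f : R[X]) :
    polyAction n (g * h) f = polyAction n h (polyAction n g f) := by
  rw [polyAction_eq_homEval n h, homEval_polyAction, polyAction_eq_homEval]
  congr 1 <;> simp only [Matrix.mul_apply, Fin.sum_univ_two, smul_eq_C_mul, C_add, C_mul] <;> ring

lemma homEval_X_one {n : ℕ} {f : R[X]} (hf : f.natDegree ≤ n) : homEval n f (X : R[X]) 1 = f :=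
  aeval_homogenize_X_one f hf

lemma homEval_one_right {n : ℕ} {f : R[X]} (hf : f.natDegree ≤ n) (x : A) :
    homEval n f x 1 = aeval x f :=
  aeval_homogenize_of_eq_one hf ![x, (1 : A)] rfl

lemma homEval_one_zero (n : ℕ) (f : R[X]) :
    homEval n f (1 : A) 0 = algebraMap R A (f.coeff n) := by
  rw [homEval_eq_sum, Finset.sum_eq_single n]
  · simp
  · intro i hi hin
    have : n - i ≠ 0 := by have := Finset.mem_range.1 hi; omega
    simp [this]
  · simp

lemma homEval_smul_smul (n : ℕ) (f : R[X]) (c x y : A) :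
    homEval n f (c * x) (c * y) = c ^ n * homEval n f x y := by
  rw [homEval_eq_sum, homEval_eq_sum, Finset.mul_sum]
  refine Finset.sum_congr rfl fun i hi => ?_
  have hi : i + (n - i) = n := by have := Finset.mem_range.1 hi; omega
  have hc : c ^ n = c ^ i * c ^ (n - i) := by rw [← pow_add, hi]
  rw [hc]; ring

lemma natDegree_le_of_mem {n : ℕ} {f : R[X]} (hf : f ∈ degreeLT R (n + 1)) : f.natDegree ≤ n := by
  rw [mem_degreeLT] at hf
  exact natDegree_le_of_degree_le (Order.le_of_lt_succ (by exact_mod_cast hf))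

lemma mem_of_natDegree_le {n : ℕ} {f : R[X]} (hf : f.natDegree ≤ n) : f ∈ degreeLT R (n + 1) := by
  rw [mem_degreeLT]
  exact lt_of_le_of_lt degree_le_natDegree (by exact_mod_cast Nat.lt_succ_of_le hf)

lemma polyAction_one {n : ℕ} {f : R[X]} (hf : f.natDegree ≤ n) : polyAction n 1 f = f := by
  rw [polyAction_eq_homEval]
  simpa using homEval_X_one hf

lemma polyAction_natDegree_le (n : ℕ) (g : Matrix (Fin 2) (Fin 2) R) (f : R[X]) :
    (polyAction n g f).natDegree ≤ n := by
  refine natDegree_sum_le_of_forall_le _ _ fun i hi => ?_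
  have hi : i + (n - i) = n := by have := Finset.mem_range.1 hi; omega
  refine natDegree_mul_le.trans ?_
  have := natDegree_C_mul_le (f.coeff i) ((C (g 0 0) * X + C (g 0 1)) ^ i)
  have := natDegree_linear_pow_le (g 0 0) (g 0 1) i
  have := natDegree_linear_pow_le (g 1 0) (g 1 1) (n - i)
  omega

lemma polyAction_mem (n : ℕ) (g : Matrix (Fin 2) (Fin 2) R) (f : R[X]) :
    polyAction n g f ∈ degreeLT R (n + 1) :=
  mem_of_natDegree_le (polyAction_natDegree_le n g f)

/-- Compatibility of the weight `n` action with a change of coefficient ring. -/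
lemma map_polyAction {S : Type*} [CommRing S] (φ : R →+* S) (n : ℕ)
    (g : Matrix (Fin 2) (Fin 2) R) (f : R[X]) :
    (polyAction n g f).map φ = polyAction n (g.map φ) (f.map φ) := by
  simp [polyAction, Polynomial.map_sum]

/-- The weight `n` action of a fixed matrix, as a linear endomorphism of the polynomials. -/
def polyActionₗ (n : ℕ) (g : Matrix (Fin 2) (Fin 2) R) : R[X] →ₗ[R] R[X] where
  toFun := polyAction n g
  map_add' := polyAction_add n g
  map_smul' := polyAction_smul n g

@[simp] lemma polyActionₗ_apply (n : ℕ) (g : Matrix (Fin 2) (Fin 2) R) (f : R[X]) :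
    polyActionₗ n g f = polyAction n g f := rfl

end HomEval

/-! ### `p`-adic completeness of finite free modules -/

lemma mem_span_pow_smul_top {R M : Type*} [CommRing R] [AddCommGroup M] [Module R M] (a : R)
    (n : ℕ) (x : M) :
    x ∈ (Ideal.span {a} ^ n • ⊤ : Submodule R M) ↔ ∃ y : M, x = a ^ n • y := by
  rw [Ideal.span_singleton_pow, Submodule.ideal_span_singleton_smul,
    Submodule.mem_smul_pointwise_iff_exists]
  simp [eq_comm]

lemma isAdicComplete_of_free {R M : Type*} [CommRing R] [AddCommGroup M] [Module R M] (a : R)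
    [IsAdicComplete (Ideal.span {a}) R] [Module.Free R M] [Module.Finite R M] :
    IsAdicComplete (Ideal.span {a}) M := by
  let b := Module.Free.chooseBasis R M
  have key : ∀ (n : ℕ) (x : M), x ∈ (Ideal.span {a} ^ n • ⊤ : Submodule R M) ↔
      ∀ i, b.repr x i ∈ (Ideal.span {a} ^ n • ⊤ : Submodule R R) := by
    intro n x
    simp only [mem_span_pow_smul_top]
    constructor
    · rintro ⟨y, rfl⟩ i
      exact ⟨b.repr y i, by simp⟩
    · intro h
      choose y hy using h
      refine ⟨∑ i, y i • b i, b.repr.injective ?_⟩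
      ext i
      rw [hy]
      simp [Finsupp.single_apply]
  refine { haus' := fun x hx => ?_, prec' := fun f hf => ?_ }
  · refine b.repr.injective (Finsupp.ext fun i => ?_)
    rw [map_zero, Finsupp.zero_apply]
    refine IsHausdorff.haus (I := Ideal.span {a}) inferInstance _ fun n => ?_
    have := hx n
    rw [SModEq.zero] at this ⊢
    exact (key n x).1 this i
  · have h : ∀ i, ∃ L : R, ∀ n, b.repr (f n) i ≡ L [SMOD (Ideal.span {a} ^ n • ⊤ :
        Submodule R R)] := fun i => by
      refine IsPrecomplete.prec' (fun n => b.repr (f n) i) fun hmn => ?_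
      have := hf hmn
      rw [SModEq.sub_mem] at this ⊢
      simpa using (key _ _).1 this i
    choose L hL using h
    refine ⟨∑ i, L i • b i, fun n => ?_⟩
    rw [SModEq.sub_mem, key]
    intro i
    have := hL i n
    rw [SModEq.sub_mem] at this
    simpa [Finsupp.single_apply] using this

section Coefficients

variable (p : ℕ) [Fact p.Prime] (O : Type*) [CommRing O] [IsDomain O] [Algebra ℤ_[p] O]
  [Module.Finite ℤ_[p] O] [FaithfulSMul ℤ_[p] O]

lemma free_padicInt : Module.Free ℤ_[p] O := by
  have : Module.IsTorsionFree ℤ_[p] O := inferInstance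
  infer_instance

lemma isAdicComplete_span_p : IsAdicComplete (Ideal.span {(p : O)}) O := by
  have : IsAdicComplete (Ideal.span {(p : ℤ_[p])}) ℤ_[p] := by
    rw [← PadicInt.maximalIdeal_eq_span_p]; infer_instance
  have := free_padicInt p O
  have := isAdicComplete_of_free (M := O) (p : ℤ_[p])
  rw [← IsAdicComplete.map_algebraMap_iff (S := O)] at this
  simpa [Ideal.map_span] using this

variable [IsDiscreteValuationRing O]

lemma p_mem_maximalIdeal : (p : O) ∈ IsLocalRing.maximalIdeal O := by
  rw [IsLocalRing.mem_maximalIdeal, mem_nonunits_iff]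
  intro hu
  have : IsAdicComplete (Ideal.span {(p : O)}) O := isAdicComplete_span_p p O
  rw [Ideal.span_singleton_eq_top.2 hu] at this
  exact one_ne_zero (α := O) ((IsAdicComplete.subsingleton O this).elim _ _)

lemma p_ne_zero : (p : O) ≠ 0 := by
  have : (p : O) = algebraMap ℤ_[p] O p := by simp
  rw [this, Ne, FaithfulSMul.algebraMap_eq_zero_iff]
  exact_mod_cast (Fact.out : p.Prime).ne_zero

lemma charP_residueField : CharP (IsLocalRing.ResidueField O) p := by
  refine (CharP.charP_iff_prime_eq_zero Fact.out).2 ?_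
  have := (IsLocalRing.residue_eq_zero_iff (p : O)).2 (p_mem_maximalIdeal p O)
  simpa using this

/-- The ring `𝒪` is separated for the topology of its maximal ideal, on finite free modules. -/
lemma eq_zero_of_forall_dvd {ϖ : O} (hϖ : Irreducible ϖ) {M : Type*} [AddCommGroup M] [Module O M]
    [Module.Free O M] [Module.Finite O M] (x : M) (h : ∀ n : ℕ, ∃ y, x = ϖ ^ n • y) : x = 0 := by
  have : IsHausdorff (IsLocalRing.maximalIdeal O) M := inferInstance
  refine this.haus x fun n => ?_
  rw [SModEq.zero, hϖ.maximalIdeal_eq, mem_span_pow_smul_top]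
  exact h n

end Coefficients

/-! ### Reduction of `GL₂(ℤ_p)` -/

section Reduction

variable (p : ℕ) [Fact p.Prime]

lemma redPow_surjective (m : ℕ) : Function.Surjective (redPow p m) := by
  intro g
  rcases Nat.eq_zero_or_pos m with rfl | hm
  · refine ⟨1, ?_⟩
    have : Subsingleton (ZMod (p ^ 0)) := by rw [pow_zero]; infer_instance
    exact Units.ext (Subsingleton.elim _ _)
  · choose f hf using ZMod.ringHom_surjective (PadicInt.toZModPow (p := p) m)
    let A : Matrix (Fin 2) (Fin 2) ℤ_[p] := g.1.map f
    have hA : A.map (PadicInt.toZModPow m) = g.1 := by ext i j; simp [A, hf]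
    have hdet : IsUnit A.det := by
      have h1 : IsUnit (PadicInt.toZModPow m A.det) := by
        rw [RingHom.map_det]
        change IsUnit (A.map (PadicInt.toZModPow m)).det
        rw [hA]
        exact (Matrix.isUnit_iff_isUnit_det _).1 g.isUnit
      by_contra hn
      rw [← mem_nonunits_iff, ← IsLocalRing.mem_maximalIdeal, PadicInt.maximalIdeal_eq_span_p,
        Ideal.mem_span_singleton] at hn
      obtain ⟨c, hc⟩ := hn
      rw [hc, map_mul, map_natCast] at h1
      have h2 := isUnit_of_mul_isUnit_left h1
      have := (ZMod.isUnit_iff_coprime p (p ^ m)).1 h2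
      rw [Nat.coprime_pow_right_iff hm] at this
      exact (Fact.out : p.Prime).one_lt.ne' (by simpa using this)
    refine ⟨Matrix.GeneralLinearGroup.mk'' A hdet, Units.ext ?_⟩
    exact hA

/-- Reduction `GL₂(ℤ_p) → GL₂(𝔽_p)`. -/
def redOne : Kp p →* GL (Fin 2) (ZMod p) :=
  Matrix.GeneralLinearGroup.map (PadicInt.toZMod (p := p))

variable {p} in
lemma ringHom_zmod_unique (f f' : ℤ_[p] →+* ZMod p) : f = f' := by
  have key : ∀ f : ℤ_[p] →+* ZMod p, ∀ x, f x = (x.zmodRepr : ZMod p) := fun f x => by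
    have h := PadicInt.sub_zmodRepr_mem x
    rw [PadicInt.maximalIdeal_eq_span_p, Ideal.mem_span_singleton] at h
    obtain ⟨c, hc⟩ := h
    have := congrArg f hc
    rw [map_sub, map_natCast, map_mul, map_natCast, ZMod.natCast_self, zero_mul] at this
    exact sub_eq_zero.1 this
  ext x
  rw [key f, key f']

lemma levelOne_redPow (g : Kp p) : levelOne p (redPow p 1 g) = redOne p g := by
  ext i j
  have h : (ZMod.castHom (dvd_of_eq (pow_one p).symm) (ZMod p)).comp (PadicInt.toZModPow 1) =
      PadicInt.toZMod (p := p) := ringHom_zmod_unique _ _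
  exact congrArg (fun f : ℤ_[p] →+* ZMod p => f (g.1 i j)) h

end Reduction

/-! ### The action of the Iwasawa algebra on a lattice -/

section Action

variable {p : ℕ} [Fact p.Prime] {O : Type*} [CommRing O] {W : Type*} [AddCommGroup W] [Module O W]

/-- The right action `ρ` of `K_p` on the `𝒪`-module `W` is `p`-adically Lipschitz: matrices that
agree modulo `p^m` act in the same way modulo `p^m`. -/
def IsLipschitz (ρ : Kp p →* (Module.End O W)ᵐᵒᵖ) : Prop :=
  ∀ (m : ℕ) (g g' : Kp p), redPow p m g = redPow p m g' →
    ∀ w : W, ∃ y : W, (ρ g).unop w - (ρ g').unop w = (p : O) ^ m • y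

variable (p O W) in
/-- The quotient `W / p^m W`. -/
abbrev LevelQuot (m : ℕ) : Type _ := W ⧸ (Ideal.span {(p : O)} ^ m • ⊤ : Submodule O W)

variable (p) in
/-- The endomorphism of `W / p^m W` induced by an endomorphism of `W`. -/
def levelEnd (m : ℕ) (u : Module.End O W) : Module.End O (LevelQuot p O W m) :=
  Submodule.mapQ _ _ u <| by
    intro x hx
    rw [Submodule.mem_comap]
    rw [mem_span_pow_smul_top] at hx ⊢
    obtain ⟨y, rfl⟩ := hx
    exact ⟨u y, map_smul _ _ _⟩

variable {ρ : Kp p →* (Module.End O W)ᵐᵒᵖ}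

lemma IsLipschitz.levelEnd_eq (hρ : IsLipschitz ρ) {m : ℕ} {g g' : Kp p}
    (h : redPow p m g = redPow p m g') :
    levelEnd p m (ρ g).unop = levelEnd p m (ρ g').unop := by
  ext w
  obtain ⟨y, hy⟩ := hρ m g g' h w
  refine (Submodule.Quotient.eq _).2 ?_
  rw [mem_span_pow_smul_top]
  exact ⟨y, hy⟩

/-- The right action of `GL₂(ℤ/p^m)` on `W / p^m W`. -/
def levelRep (hρ : IsLipschitz ρ) (m : ℕ) : KQuot p m →* (Module.End O (LevelQuot p O W m))ᵐᵒᵖ where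
  toFun g := op (levelEnd p m (ρ (Function.surjInv (redPow_surjective p m) g)).unop)
  map_one' := by
    rw [hρ.levelEnd_eq (g' := 1) (by simp only [Function.surjInv_eq, map_one])]
    refine unop_injective ?_
    ext w
    simp [levelEnd]
  map_mul' g h := by
    rw [hρ.levelEnd_eq (g' := Function.surjInv (redPow_surjective p m) g *
      Function.surjInv (redPow_surjective p m) h) (by simp [Function.surjInv_eq])]
    refine unop_injective ?_
    ext w
    simp [levelEnd]

lemma levelRep_redPow (hρ : IsLipschitz ρ) (m : ℕ) (g : Kp p) (w : W) :
    (levelRep hρ m (redPow p m g)).unop (Submodule.Quotient.mk w) =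
      Submodule.Quotient.mk ((ρ g).unop w) := by
  change levelEnd p m _ _ = _
  rw [hρ.levelEnd_eq (g' := g) (Function.surjInv_eq _ _)]
  rfl

/-- The right action of the group algebra `𝒪[GL₂(ℤ/p^m)]` on `W / p^m W`. -/
def levelAlg (hρ : IsLipschitz ρ) (m : ℕ) :
    MonoidAlgebra O (KQuot p m) →ₐ[O] (Module.End O (LevelQuot p O W m))ᵐᵒᵖ :=
  MonoidAlgebra.lift O _ _ (levelRep hρ m)

lemma levelAlg_single (hρ : IsLipschitz ρ) (m : ℕ) (g : Kp p) (r : O) (w : W) :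
    (levelAlg hρ m (MonoidAlgebra.single (redPow p m g) r)).unop (Submodule.Quotient.mk w) =
      Submodule.Quotient.mk (r • (ρ g).unop w) := by
  rw [levelAlg, MonoidAlgebra.lift_single, MulOpposite.unop_smul, LinearMap.smul_apply,
    levelRep_redPow]
  rfl

lemma monoidAlgebra_induction {m : ℕ} {P : MonoidAlgebra O (KQuot p m) → Prop}
    (hadd : ∀ x y, P x → P y → P (x + y))
    (hsingle : ∀ g r, P (MonoidAlgebra.single (redPow p m g) r)) (x) : P x := by
  have h0 : P 0 := by simpa using hsingle 1 0
  induction x using MonoidAlgebra.induction_linear with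
  | zero => exact h0
  | add x y hx hy => exact hadd x y hx hy
  | single g r =>
    obtain ⟨g, rfl⟩ := redPow_surjective p m g
    exact hsingle g r

lemma factorPowSucc_levelAlg (hρ : IsLipschitz ρ) (m : ℕ) (x : MonoidAlgebra O (KQuot p (m + 1)))
    (w : W) :
    Submodule.factorPow (Ideal.span {(p : O)}) W m.le_succ
        ((levelAlg hρ (m + 1) x).unop (Submodule.Quotient.mk w)) =
      (levelAlg hρ m (MonoidAlgebra.mapDomain (transition p m) x)).unop
        (Submodule.Quotient.mk w) := by
  induction x using monoidAlgebra_induction with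
  | hadd x y hx hy =>
    simp only [MonoidAlgebra.mapDomain_add, map_add, unop_add, LinearMap.add_apply, hx, hy]
  | hsingle g r =>
    rw [MonoidAlgebra.mapDomain_single, transition_redPow, levelAlg_single, levelAlg_single]
    exact Submodule.factor_mk _ _

lemma iwasawaAlgebra_transition (x : iwasawaAlgebra p O) (m : ℕ) :
    MonoidAlgebra.mapDomain (transition p m) (x.1 (m + 1)) = x.1 m := by
  have := x.2
  simp only [iwasawaAlgebra, Algebra.mem_iInf, AlgHom.mem_equalizer] at this
  exact this m

lemma factorPow_levelAlg (hρ : IsLipschitz ρ) {m n : ℕ} (h : m ≤ n) (x : iwasawaAlgebra p O)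
    (w : W) :
    Submodule.factorPow (Ideal.span {(p : O)}) W h
        ((levelAlg hρ n (x.1 n)).unop (Submodule.Quotient.mk w)) =
      (levelAlg hρ m (x.1 m)).unop (Submodule.Quotient.mk w) := by
  induction n, h using Nat.le_induction with
  | base =>
    obtain ⟨v, hv⟩ := Submodule.Quotient.mk_surjective _
      ((levelAlg hρ m (x.1 m)).unop (Submodule.Quotient.mk w))
    rw [← hv]
    exact Submodule.factor_mk _ v
  | succ n h ih =>
    rw [← ih, ← iwasawaAlgebra_transition x n, ← factorPowSucc_levelAlg]
    obtain ⟨v, hv⟩ := Submodule.Quotient.mk_surjective _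
      ((levelAlg hρ (n + 1) (x.1 (n + 1))).unop (Submodule.Quotient.mk w))
    rw [← hv]
    exact (Submodule.factor_mk _ v).trans (Submodule.factor_mk _ v).symm

/-- The action on `w ∈ W`, modulo `p^m`, as a linear map on the Iwasawa algebra. -/
def iwasawaActLevel (hρ : IsLipschitz ρ) (w : W) (m : ℕ) :
    iwasawaAlgebra p O →ₗ[O] LevelQuot p O W m where
  toFun x := (levelAlg hρ m (x.1 m)).unop (Submodule.Quotient.mk w)
  map_add' x y := by simp
  map_smul' c x := by simp

lemma factorPow_iwasawaActLevel (hρ : IsLipschitz ρ) (w : W) {m n : ℕ} (h : m ≤ n) :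
    Submodule.factorPow (Ideal.span {(p : O)}) W h ∘ₗ iwasawaActLevel hρ w n =
      iwasawaActLevel hρ w m :=
  LinearMap.ext fun x => factorPow_levelAlg hρ h x w

variable [IsAdicComplete (Ideal.span {(p : O)}) W]

/-- The value `w · x` of the right action of `x ∈ 𝒪⟦K_p⟧` on `w`: the limit of the actions of the
images of `x` in the group algebras of the finite quotients of `K_p`. -/
def iwasawaAct (hρ : IsLipschitz ρ) (w : W) : iwasawaAlgebra p O →ₗ[O] W :=
  IsAdicComplete.lift (Ideal.span {(p : O)}) (iwasawaActLevel hρ w)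
    (factorPow_iwasawaActLevel hρ w)

lemma mk_iwasawaAct (hρ : IsLipschitz ρ) (w : W) (x : iwasawaAlgebra p O) (m : ℕ) :
    (Submodule.Quotient.mk (iwasawaAct hρ w x) : LevelQuot p O W m) =
      (levelAlg hρ m (x.1 m)).unop (Submodule.Quotient.mk w) :=
  IsAdicComplete.mk_lift (Ideal.span {(p : O)}) (factorPow_iwasawaActLevel hρ w) m x

lemma eq_of_forall_mk_eq {w w' : W} (h : ∀ m,
    (Submodule.Quotient.mk w : LevelQuot p O W m) = Submodule.Quotient.mk w') : w = w' :=
  (IsHausdorff.eq_iff_smodEq (I := Ideal.span {(p : O)})).2 h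

lemma iwasawaAct_groupElt (hρ : IsLipschitz ρ) (w : W) (g : Kp p) :
    iwasawaAct hρ w (groupElt p O g) = (ρ g).unop w := by
  refine eq_of_forall_mk_eq (p := p) (O := O) fun m => ?_
  rw [mk_iwasawaAct, groupElt, levelAlg_single, one_smul]

/-- The right `𝒪⟦K_p⟧`-module structure on `W` extending the right action of `K_p`. -/
@[reducible] def iwasawaModule (hρ : IsLipschitz ρ) : Module (iwasawaAlgebra p O)ᵐᵒᵖ W where
  smul x w := iwasawaAct hρ w x.unop
  one_smul w := by
    refine eq_of_forall_mk_eq (p := p) (O := O) fun m => ?_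
    change Submodule.Quotient.mk (iwasawaAct hρ w 1) = _
    rw [mk_iwasawaAct]; simp
  mul_smul x y w := by
    refine eq_of_forall_mk_eq (p := p) (O := O) fun m => ?_
    change Submodule.Quotient.mk (iwasawaAct hρ w (y.unop * x.unop)) =
      Submodule.Quotient.mk (iwasawaAct hρ (iwasawaAct hρ w y.unop) x.unop)
    rw [mk_iwasawaAct, mk_iwasawaAct, mk_iwasawaAct]; simp
  smul_zero x := by
    refine eq_of_forall_mk_eq (p := p) (O := O) fun m => ?_
    change Submodule.Quotient.mk (iwasawaAct hρ 0 x.unop) = _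
    rw [mk_iwasawaAct]; simp
  smul_add x w w' := by
    refine eq_of_forall_mk_eq (p := p) (O := O) fun m => ?_
    change Submodule.Quotient.mk (iwasawaAct hρ (w + w') x.unop) =
      Submodule.Quotient.mk (iwasawaAct hρ w x.unop + iwasawaAct hρ w' x.unop)
    rw [Submodule.Quotient.mk_add, mk_iwasawaAct, mk_iwasawaAct, mk_iwasawaAct]; simp
  add_smul x y w := map_add (iwasawaAct hρ w) x.unop y.unop
  zero_smul w := map_zero (iwasawaAct hρ w)

/-- If the level `m` image of `x` has coefficients divisible by `p^m`, then `w · x ∈ p^m W`. -/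
lemma iwasawaAct_mem (hρ : IsLipschitz ρ) (w : W) (x : iwasawaAlgebra p O) (m : ℕ)
    (hx : ∀ g, (p : O) ^ m ∣ (x.1 m).coeff g) : ∃ y, iwasawaAct hρ w x = (p : O) ^ m • y := by
  rw [← mem_span_pow_smul_top, ← Submodule.Quotient.mk_eq_zero]
  rw [mk_iwasawaAct, levelAlg, MonoidAlgebra.lift_apply, Finsupp.sum, Finset.unop_sum,
    LinearMap.sum_apply]
  refine Finset.sum_eq_zero fun g _ => ?_
  obtain ⟨c, hc⟩ := hx g
  obtain ⟨v, hv⟩ := Submodule.Quotient.mk_surjective _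
    ((levelRep hρ m g).unop (Submodule.Quotient.mk w))
  rw [unop_smul, LinearMap.smul_apply, ← hv, ← Submodule.Quotient.mk_smul,
    Submodule.Quotient.mk_eq_zero, mem_span_pow_smul_top, hc]
  exact ⟨c • v, mul_smul _ _ _⟩

lemma iwasawaAct_smul (hρ : IsLipschitz ρ) (c : O) (w : W) (x : iwasawaAlgebra p O) :
    iwasawaAct hρ (c • w) x = c • iwasawaAct hρ w x := by
  refine eq_of_forall_mk_eq (p := p) (O := O) fun m => ?_
  rw [mk_iwasawaAct, Submodule.Quotient.mk_smul, Submodule.Quotient.mk_smul, mk_iwasawaAct,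
    map_smul]

end Action

/-! ### Continuity for the canonical topology -/

section Continuity

variable {p : ℕ} [Fact p.Prime] {O : Type*} [CommRing O]

/-- Continuity for the `p`-adic topology in terms of congruences. -/
lemma continuous_padic_iff {α : Type*} [TopologicalSpace α] (f : α → O) :
    Continuous[_, padicTopology p O] f ↔
      ∀ (M : ℕ) (x₀ : α), ∀ᶠ x in 𝓝 x₀, (p : O) ^ M ∣ f x - f x₀ := by
  let _ := padicTopology p O
  have key : ∀ (M : ℕ) (y z : O),
      z ∈ (fun y' => y + y') '' ((Ideal.span {(p : O)} ^ M : Ideal O) : Set O) ↔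
        (p : O) ^ M ∣ z - y := by
    intro M y z
    rw [Ideal.span_singleton_pow, Set.mem_image]
    simp only [SetLike.mem_coe, Ideal.mem_span_singleton]
    constructor
    · rintro ⟨x, hx, rfl⟩; simpa using hx
    · intro h; exact ⟨z - y, h, by ring⟩
  rw [continuous_iff_continuousAt]
  constructor
  · intro h M x₀
    have := (Ideal.hasBasis_nhds_adic (Ideal.span {(p : O)}) (f x₀)).mem_of_mem (i := M) trivial
    filter_upwards [h x₀ this] with x hx
    exact (key M _ _).1 hx
  · intro h x₀
    refine ((Ideal.hasBasis_nhds_adic (Ideal.span {(p : O)}) (f x₀)).tendsto_right_iff).2 ?_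
    intro M _
    filter_upwards [h M x₀] with x hx
    exact (key M _ _).2 hx

lemma eventually_coeff_dvd (x₀ : (iwasawaAlgebra p O)ᵐᵒᵖ) (m M : ℕ) :
    ∀ᶠ x in @nhds _ (iwasawaTopology p O) x₀,
      ∀ g, (p : O) ^ M ∣ ((x - x₀).unop.1 m).coeff g := by
  let _ := iwasawaTopology p O
  let _ := padicTopology p O
  have : Finite (KQuot p m) := inferInstance
  rw [Filter.eventually_all]
  intro g
  have h : Continuous fun x : (iwasawaAlgebra p O)ᵐᵒᵖ => (x.unop.1 m).coeff g := by
    have h1 := @continuous_induced_dom _ _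
      (fun (x : (iwasawaAlgebra p O)ᵐᵒᵖ) (m : ℕ) (g : KQuot p m) => (x.unop.1 m).coeff g)
      inferInstance
    exact (continuous_apply g).comp ((continuous_apply m).comp h1)
  filter_upwards [(continuous_padic_iff (p := p) _).1 h M x₀] with x hx
  simpa using hx

lemma iwasawaAlgebra_eq_zero_of_le (x : iwasawaAlgebra p O) {m n : ℕ} (h : m ≤ n)
    (hx : x.1 n = 0) : x.1 m = 0 := by
  induction n, h using Nat.le_induction with
  | base => exact hx
  | succ n h ih =>
    refine ih ?_
    rw [← iwasawaAlgebra_transition, hx, MonoidAlgebra.mapDomain_zero]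

/-- The kernels of the projections to the finite levels are small. -/
lemma exists_level_of_mem_nhds {U : Set (iwasawaAlgebra p O)ᵐᵒᵖ}
    (hU : U ∈ @nhds _ (iwasawaTopology p O) 0) :
    ∃ m, ∀ x : iwasawaAlgebra p O, x.1 m = 0 → op x ∈ U := by
  let _ := padicTopology p O
  rw [nhds_induced, Filter.mem_comap] at hU
  obtain ⟨t, ht, htU⟩ := hU
  rw [nhds_pi, Filter.mem_pi] at ht
  obtain ⟨S, hS, u, hu, huS⟩ := ht
  obtain ⟨m, hm⟩ := hS.bddAbove
  refine ⟨m, fun x hx => htU (huS fun i hi => ?_)⟩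
  have h0 := iwasawaAlgebra_eq_zero_of_le x (hm hi) hx
  have := mem_of_mem_nhds (hu i)
  simpa [h0] using this

variable {W : Type*} [AddCommGroup W] [Module O W] {ρ : Kp p →* (Module.End O W)ᵐᵒᵖ}
  {H : Type*} [AddCommGroup H] [Module (iwasawaAlgebra p O)ᵐᵒᵖ H]

/-- Maps to a lattice that are linear over the Iwasawa algebra are continuous. -/
lemma continuous_of_iwasawa_linear [IsAdicComplete (Ideal.span {(p : O)}) W] [Module.Free O W]
    [Module.Finite O W] (hρ : IsLipschitz ρ) (φ : H →+ W)
    (hφ : ∀ (x : iwasawaAlgebra p O) (h : H), φ (op x • h) = iwasawaAct hρ (φ h) x)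
    (l : W →ₗ[O] O) :
    Continuous[canonicalTopology p O H, padicTopology p O] fun h => l (φ h) := by
  let b := Module.Free.chooseBasis O W
  let _ := padicTopology p O
  let _ := iwasawaTopology p O
  have hO : NonarchimedeanRing O := Ideal.nonarchimedean (Ideal.span {(p : O)})
  -- the topology on `W` given by the coordinates in the basis `b`
  let τ : TopologicalSpace W := TopologicalSpace.induced (fun w i => b.repr w i) inferInstance
  have hcoord : ∀ i, Continuous fun w => b.repr w i := fun i =>
    (continuous_apply i).comp continuous_induced_dom
  have hnear : ∀ (w₀ : W) (M : ℕ), ∀ᶠ w in 𝓝 w₀, ∃ y, w - w₀ = (p : O) ^ M • y := by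
    intro w₀ M
    have h1 : ∀ᶠ w in 𝓝 w₀, ∀ i, (p : O) ^ M ∣ b.repr w i - b.repr w₀ i := by
      rw [Filter.eventually_all]
      exact fun i => (continuous_padic_iff (p := p) _).1 (hcoord i) M w₀
    filter_upwards [h1] with w hw
    choose c hc using hw
    refine ⟨∑ i, c i • b i, b.repr.injective (Finsupp.ext fun i => ?_)⟩
    simp [hc, Finsupp.single_apply]
  have hadd : ContinuousAdd W := by
    refine ⟨continuous_induced_rng.2 (continuous_pi fun i => ?_)⟩
    have := ((hcoord i).comp continuous_fst).add ((hcoord i).comp continuous_snd)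
    refine this.congr fun w => ?_
    simp
  let _ : Module (iwasawaAlgebra p O)ᵐᵒᵖ W := iwasawaModule hρ
  have hsmul : ContinuousSMul (iwasawaAlgebra p O)ᵐᵒᵖ W := by
    refine ⟨continuous_induced_rng.2 (continuous_pi fun i => ?_)⟩
    refine (continuous_padic_iff (p := p) _).2 fun M ⟨x₀, w₀⟩ => ?_
    rw [nhds_prod_eq]
    filter_upwards [(eventually_coeff_dvd x₀ M M).prod_mk (hnear w₀ M)] with ⟨x, w⟩ ⟨hx, y, hy⟩
    obtain ⟨z, hz⟩ := iwasawaAct_mem hρ w₀ _ M hx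
    have h1 : x • w - x₀ • w₀ = (p : O) ^ M • (iwasawaAct hρ y x.unop + z) := by
      rw [smul_add, ← hz, ← iwasawaAct_smul, ← hy]
      change _ = x • (w - w₀) + (x - x₀) • w₀
      rw [smul_sub, sub_smul]; abel
    simp only [Function.comp_apply]
    rw [← Finsupp.sub_apply, ← map_sub, h1, map_smul]
    exact ⟨_, rfl⟩
  let φ' : H →ₗ[(iwasawaAlgebra p O)ᵐᵒᵖ] W := { φ with map_smul' := fun x h => hφ x.unop h }
  let _ := canonicalTopology p O H
  have : IsModuleTopology (iwasawaAlgebra p O)ᵐᵒᵖ H := ⟨rfl⟩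
  have hφc : Continuous φ' := IsModuleTopology.continuous_of_linearMap φ'
  have hl : Continuous l := by
    refine (continuous_padic_iff (p := p) _).2 fun M w₀ => ?_
    filter_upwards [hnear w₀ M] with w ⟨y, hy⟩
    rw [← map_sub, hy, map_smul]
    exact ⟨_, rfl⟩
  exact hl.comp hφc

end Continuity

/-! ### Ranks of modules of equivariant forms -/

section EqHom

variable {F G : Type*} [Field F] [Group G] (P : Type*) [AddCommGroup P] [Module F P]
  [Module (MonoidAlgebra F G)ᵐᵒᵖ P] {W : Type*} [AddCommGroup W] [Module F W]

/-- The space of `F`-linear maps from the right `F[G]`-module `P` to the subspace `N` of `W` which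
are equivariant for the subgroup `J`, where `g ∈ G` acts on `W` through `σ g`. -/
def eqHom (J : Subgroup G) (σ : G → Module.End F W) (N : Submodule F W) :
    Submodule F (P →ₗ[F] W) where
  carrier := {φ | (∀ x, φ x ∈ N) ∧
    ∀ g ∈ J, ∀ x, φ (op (MonoidAlgebra.single g (1 : F)) • x) = σ g (φ x)}
  add_mem' := by
    rintro φ ψ ⟨h₁, h₁'⟩ ⟨h₂, h₂'⟩
    exact ⟨fun x => N.add_mem (h₁ x) (h₂ x), fun g hg x => by simp [h₁' g hg, h₂' g hg]⟩
  zero_mem' := ⟨fun x => N.zero_mem, fun g _ x => by simp⟩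
  smul_mem' := by
    rintro c φ ⟨h₁, h₁'⟩
    exact ⟨fun x => N.smul_mem c (h₁ x), fun g hg x => by simp [h₁' g hg]⟩

variable {P} [IsScalarTower F (MonoidAlgebra F G)ᵐᵒᵖ P]

lemma op_single_smul (g : G) (c : F) (x : P) :
    op (MonoidAlgebra.single g c) • x = c • op (MonoidAlgebra.single g (1 : F)) • x := by
  rw [← smul_assoc]
  congr 1
  rw [← op_smul, MonoidAlgebra.smul_single, smul_eq_mul, mul_one]

lemma op_single_mul_smul (g h : G) (x : P) :
    op (MonoidAlgebra.single (g * h) (1 : F)) • x =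
      op (MonoidAlgebra.single h (1 : F)) • op (MonoidAlgebra.single g (1 : F)) • x := by
  rw [← mul_smul, ← op_mul, MonoidAlgebra.single_mul_single, one_mul]

lemma op_single_one_smul (x : P) : op (MonoidAlgebra.single (1 : G) (1 : F)) • x = x := by
  rw [← MonoidAlgebra.one_def, op_one, one_smul]

lemma op_single_smul_smul (g : G) (c : F) (x : P) :
    op (MonoidAlgebra.single g (1 : F)) • c • x = c • op (MonoidAlgebra.single g (1 : F)) • x := by
  have : SMulCommClass F (MonoidAlgebra F G)ᵐᵒᵖ P := IsScalarTower.to_smulCommClass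
  exact smul_comm _ _ _

/-- A linear map that is equivariant for the group is linear over the group algebra. -/
lemma lift_equivariant (ρ : G →* (Module.End F W)ᵐᵒᵖ) (ψ : P →ₗ[F] W)
    (hψ : ∀ g x, ψ (op (MonoidAlgebra.single g (1 : F)) • x) = (ρ g).unop (ψ x))
    (r : MonoidAlgebra F G) (x : P) :
    ψ (op r • x) = (MonoidAlgebra.lift F _ _ ρ r).unop (ψ x) := by
  induction r using MonoidAlgebra.induction_linear with
  | zero => simp
  | add r s hr hs => simp [add_smul, hr, hs]
  | single g c => rw [op_single_smul, map_smul, hψ]; simp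

end EqHom

section Rank

variable {O : Type*} [CommRing O] [IsDomain O] [IsDiscreteValuationRing O]

/-- A finite torsion-free module over a discrete valuation ring has the same rank as its
reduction modulo a uniformizer. -/
lemma finrank_eq_finrank_reduction {ϖ : O} (hϖ : Irreducible ϖ) {X X' : Type*} [AddCommGroup X]
    [Module O X] [Module.Finite O X] [Module.IsTorsionFree O X] [AddCommGroup X']
    [Module (IsLocalRing.ResidueField O) X'] (T : X →ₛₗ[IsLocalRing.residue O] X')
    (hT : Function.Surjective T) (hker : ∀ x, T x = 0 → ∃ y, x = ϖ • y) :
    Module.finrank O X = Module.finrank (IsLocalRing.ResidueField O) X' := by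
  have : Module.Free O X := inferInstance
  let b := Module.Free.chooseBasis O X
  have hli : LinearIndependent (IsLocalRing.ResidueField O) (fun i => T (b i)) := by
    rw [Fintype.linearIndependent_iff]
    intro c hc i
    choose d hd using fun i => IsLocalRing.residue_surjective (c i)
    have h0 : T (∑ i, d i • b i) = 0 := by
      rw [map_sum, ← hc]
      exact Finset.sum_congr rfl fun i _ => by rw [LinearMap.map_smulₛₗ, hd]
    obtain ⟨y, hy⟩ := hker _ h0
    have h1 : d i = ϖ * b.repr y i := by
      have := congrArg (fun x => b.repr x i) hy
      simpa [Finsupp.single_apply] using this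
    rw [← hd i, IsLocalRing.residue_eq_zero_iff, hϖ.maximalIdeal_eq, Ideal.mem_span_singleton]
    exact ⟨_, h1⟩
  have hspan : ⊤ ≤ Submodule.span (IsLocalRing.ResidueField O) (Set.range fun i => T (b i)) := by
    intro x _
    obtain ⟨x, rfl⟩ := hT x
    rw [← b.sum_repr x, map_sum]
    refine Submodule.sum_mem _ fun i _ => ?_
    rw [LinearMap.map_smulₛₗ]
    exact Submodule.smul_mem _ _ (Submodule.subset_span ⟨i, rfl⟩)
  rw [Module.finrank_eq_card_basis b, Module.finrank_eq_card_basis (Module.Basis.mk hli hspan)]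

end Rank

section Forms

variable {p : ℕ} [Fact p.Prime] {O : Type*} [CommRing O]

lemma groupElt_mul (g h : Kp p) : groupElt p O (g * h) = groupElt p O g * groupElt p O h := by
  refine Subtype.ext (funext fun m => ?_)
  simp [groupElt, MonoidAlgebra.single_mul_single]

variable (O) in
/-- The sum of the values of `Ψ`, weighted by the residues of the coefficients of `x`. -/
def evalSum [IsLocalRing O] {A N : Type*} [AddCommGroup N] [Module (IsLocalRing.ResidueField O) N]
    (Ψ : A → N) (x : MonoidAlgebra O A) : N :=
  x.coeff.sum fun g r => IsLocalRing.residue O r • Ψ g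

lemma evalSum_mapDomain [IsLocalRing O] {A B N : Type*} [AddCommGroup N]
    [Module (IsLocalRing.ResidueField O) N] (f : A → B) (Ψ : B → N) (x : MonoidAlgebra O A) :
    evalSum O Ψ (MonoidAlgebra.mapDomain f x) = evalSum O (Ψ ∘ f) x := by
  change (Finsupp.mapDomain f x.coeff).sum _ = _
  rw [Finsupp.sum_mapDomain_index (by simp) (by simp [add_smul])]
  rfl

lemma evalSum_eq_zero [IsLocalRing O] {G N : Type*} [Group G] [AddCommGroup N]
    [Module (IsLocalRing.ResidueField O) N] (Ψ : G → N) (x : MonoidAlgebra O G)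
    (hx : MonoidAlgebra.mapRingHom G (IsLocalRing.residue O) x = 0) : evalSum O Ψ x = 0 := by
  refine Finset.sum_eq_zero fun g _ => ?_
  have h1 := congrArg (fun y => y.coeff g) hx
  simp only [MonoidAlgebra.coeff_zero, Finsupp.zero_apply] at h1
  have : IsLocalRing.residue O (x.coeff g) = 0 := by simpa using h1
  simp [this]

variable {V : Type*} [AddCommGroup V] [Module O V] (ρ : Kp p →* (Module.End O V)ᵐᵒᵖ)
  (H : Type*) [AddCommGroup H] [Module O H] [Module (iwasawaAlgebra p O)ᵐᵒᵖ H]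

/-- The module of continuous `𝒪`-linear maps from `H` to the lattice `V` that are equivariant for
the subgroup of `K_p` of the matrices whose reduction lies in `J`. -/
def levelForms (J : Subgroup (GL (Fin 2) (ZMod p))) : Submodule O (H →ₗ[O] V) where
  carrier := {φ | (∀ l : V →ₗ[O] O,
      Continuous[canonicalTopology p O H, padicTopology p O] fun h => l (φ h)) ∧
    ∀ g, redOne p g ∈ J → ∀ h, φ (op (groupElt p O g) • h) = (ρ g).unop (φ h)}
  add_mem' := by
    rintro φ ψ ⟨h₁, h₁'⟩ ⟨h₂, h₂'⟩
    refine ⟨fun l => ?_, fun g hg h => by simp [h₁' g hg, h₂' g hg]⟩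
    let _ := padicTopology p O
    let _ := canonicalTopology p O H
    have : NonarchimedeanRing O := Ideal.nonarchimedean (Ideal.span {(p : O)})
    exact ((h₁ l).add (h₂ l)).congr fun h => by simp
  zero_mem' := by
    refine ⟨fun l => ?_, fun g _ h => by simp⟩
    let _ := padicTopology p O
    let _ := canonicalTopology p O H
    simpa using continuous_const
  smul_mem' := by
    rintro c φ ⟨h₁, h₁'⟩
    refine ⟨fun l => ?_, fun g hg h => by simp [h₁' g hg]⟩
    let _ := padicTopology p O
    let _ := canonicalTopology p O H
    have : NonarchimedeanRing O := Ideal.nonarchimedean (Ideal.span {(p : O)})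
    exact ((continuous_const (y := c)).mul (h₁ l)).congr fun h => by simp

end Forms

/-! ### Coinduced actions and reductions of lattices -/

section Coinduced

/-- The right action of `K` on the functions `X → V`, where `K` acts on `V` on the right through `ρ`
and on `X` on the left through `π`: `(Φ|_g)(x) = Φ(g x)|_g`. For `X = G ⧸ J` this is the coinduced
action. -/
def coindRep {R K G V : Type*} [CommRing R] [Group K] [Group G] [AddCommGroup V] [Module R V]
    (π : K →* G) (X : Type*) [MulAction G X] (ρ : K →* (Module.End R V)ᵐᵒᵖ) :
    K →* (Module.End R (X → V))ᵐᵒᵖ where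
  toFun g := op
    { toFun := fun Φ x => (ρ g).unop (Φ (π g • x))
      map_add' := fun Φ Ψ => by ext; simp
      map_smul' := fun c Φ => by ext; simp }
  map_one' := by
    refine unop_injective (LinearMap.ext fun Φ => funext fun x => ?_)
    simp
  map_mul' g h := by
    refine unop_injective (LinearMap.ext fun Φ => funext fun x => ?_)
    simp [mul_smul]

@[simp] lemma coindRep_apply {R K G V : Type*} [CommRing R] [Group K] [Group G] [AddCommGroup V]
    [Module R V] (π : K →* G) (X : Type*) [MulAction G X] (ρ : K →* (Module.End R V)ᵐᵒᵖ) (g : K)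
    (Φ : X → V) (x : X) : (coindRep π X ρ g).unop Φ x = (ρ g).unop (Φ (π g • x)) := rfl

end Coinduced

section Reduction

variable {p : ℕ} [Fact p.Prime] {O : Type*} [CommRing O] [IsDomain O] [IsDiscreteValuationRing O]
  {V : Type*} [AddCommGroup V] [Module O V]
  {V' : Type*} [AddCommGroup V'] [Module (IsLocalRing.ResidueField O) V']

lemma redPow_one_eq_of_le {n : ℕ} (hn : 1 ≤ n) {g g' : Kp p} (h : redPow p n g = redPow p n g') :
    redOne p g = redOne p g' := by
  have key : redPow p 1 g = redPow p 1 g' := by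
    induction n, hn using Nat.le_induction with
    | base => exact h
    | succ n hn ih => exact ih (by rw [← transition_redPow, h, transition_redPow])
  rw [← levelOne_redPow, ← levelOne_redPow, key]

/-- The semilinear map `red` presents the right representation `ρ'` of `GL₂(𝔽_p)` over the residue
field as the reduction of the right representation `ρ` of `K_p` on a lattice. -/
structure IsReduction (ϖ : O) (ρ : Kp p →* (Module.End O V)ᵐᵒᵖ)
    (ρ' : GL (Fin 2) (ZMod p) →* (Module.End (IsLocalRing.ResidueField O) V')ᵐᵒᵖ)
    (red : V →ₛₗ[IsLocalRing.residue O] V') : Prop where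
  lipschitz : IsLipschitz ρ
  surjective : Function.Surjective red
  ker : ∀ v, red v = 0 → ∃ y, v = ϖ • y
  equivariant : ∀ g v, red ((ρ g).unop v) = (ρ' (redOne p g)).unop (red v)

variable {ϖ : O} {ρ : Kp p →* (Module.End O V)ᵐᵒᵖ}
  {ρ' : GL (Fin 2) (ZMod p) →* (Module.End (IsLocalRing.ResidueField O) V')ᵐᵒᵖ}
  {red : V →ₛₗ[IsLocalRing.residue O] V'}

/-- Coinduction commutes with reduction. -/
lemma IsReduction.coind (h : IsReduction ϖ ρ ρ' red) (X : Type*) [MulAction (GL (Fin 2) (ZMod p)) X] :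
    IsReduction ϖ (coindRep (redOne p) X ρ) (coindRep (MonoidHom.id _) X ρ')
      { toFun := fun Φ x => red (Φ x)
        map_add' := fun Φ Ψ => by ext; simp
        map_smul' := fun c Φ => by ext; simp : (X → V) →ₛₗ[IsLocalRing.residue O] (X → V') } where
  lipschitz m g g' hg Φ := by
    rcases Nat.eq_zero_or_pos m with rfl | hm
    · exact ⟨_, by rw [pow_zero, one_smul]⟩
    have h1 : redOne p g = redOne p g' := redPow_one_eq_of_le hm hg
    choose y hy using fun x => h.lipschitz m g g' hg (Φ (redOne p g • x))
    refine ⟨y, funext fun x => ?_⟩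
    simp only [Pi.sub_apply, coindRep_apply, ← h1, Pi.smul_apply, hy]
  surjective Φ := by
    choose y hy using h.surjective
    exact ⟨fun x => y (Φ x), funext fun x => hy _⟩
  ker Φ hΦ := by
    choose y hy using fun x => h.ker (Φ x) (congrFun hΦ x)
    exact ⟨y, funext hy⟩
  equivariant g Φ := funext fun x => h.equivariant g _

lemma reduction_apply (x : iwasawaAlgebra p O) : reduction p O x =
    MonoidAlgebra.mapRingHom (GL (Fin 2) (ZMod p)) (IsLocalRing.residue O)
      (MonoidAlgebra.mapDomain (levelOne p) (x.1 1)) := rfl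

lemma reduction_groupElt (g : Kp p) :
    reduction p O (groupElt p O g) = MonoidAlgebra.single (redOne p g) 1 := by
  rw [reduction_apply, groupElt, MonoidAlgebra.mapDomain_single, levelOne_redPow]
  simp

variable [Algebra ℤ_[p] O] [Module.Finite ℤ_[p] O] [FaithfulSMul ℤ_[p] O]

lemma IsReduction.map_p_smul (red : V →ₛₗ[IsLocalRing.residue O] V') (v : V) :
    red ((p : O) • v) = 0 := by
  rw [LinearMap.map_smulₛₗ, (IsLocalRing.residue_eq_zero_iff _).2 (p_mem_maximalIdeal p O),
    zero_smul]

/-- The action of the Iwasawa algebra on the reduction of a lattice factors through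
`𝔽[GL₂(𝔽_p)]`. -/
lemma IsReduction.map_iwasawaAct (h : IsReduction ϖ ρ ρ' red)
    [IsAdicComplete (Ideal.span {(p : O)}) V] (w : V) (x : iwasawaAlgebra p O) :
    red (iwasawaAct h.lipschitz w x) =
      (MonoidAlgebra.lift (IsLocalRing.ResidueField O) _ _ ρ' (reduction p O x)).unop (red w) := by
  have hle : (Ideal.span {(p : O)} ^ 1 • ⊤ : Submodule O V) ≤ LinearMap.ker red := by
    intro v hv
    rw [mem_span_pow_smul_top, pow_one] at hv
    obtain ⟨y, rfl⟩ := hv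
    exact IsReduction.map_p_smul red y
  let redQ := Submodule.liftQ _ red hle
  have hQ : ∀ v, redQ (Submodule.Quotient.mk v) = red v := fun v => Submodule.liftQ_apply _ _ v
  rw [← hQ, mk_iwasawaAct h.lipschitz w x 1, reduction_apply]
  generalize x.1 1 = y
  induction y using monoidAlgebra_induction with
  | hadd y z hy hz =>
    simp only [MonoidAlgebra.mapDomain_add, map_add, unop_add, LinearMap.add_apply, hy, hz]
  | hsingle g r =>
    rw [levelAlg_single, hQ, LinearMap.map_smulₛₗ, h.equivariant, MonoidAlgebra.mapDomain_single,
      levelOne_redPow]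
    simp

variable {H : Type*} [AddCommGroup H] [Module O H] [Module (iwasawaAlgebra p O)ᵐᵒᵖ H]
  [IsScalarTower O (iwasawaAlgebra p O)ᵐᵒᵖ H]

/-- Equivariant maps from a projective module to the reduction of a lattice lift to the lattice. -/
lemma IsReduction.exists_lift (h : IsReduction ϖ ρ ρ' red) [Module.Finite O V] [Module.Free O V]
    [hV : IsAdicComplete (Ideal.span {(p : O)}) V]
    (hproj : Module.Projective (iwasawaAlgebra p O)ᵐᵒᵖ H) (ψ : H →+ V')
    (hψ : ∀ (x : iwasawaAlgebra p O) y, ψ (op x • y) =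
      (MonoidAlgebra.lift (IsLocalRing.ResidueField O) _ _ ρ' (reduction p O x)).unop (ψ y)) :
    ∃ φ : H →ₗ[O] V, (∀ (x : iwasawaAlgebra p O) y, φ (op x • y) = iwasawaAct h.lipschitz (φ y) x) ∧
      ∀ y, red (φ y) = ψ y := by
  let _ : Module (iwasawaAlgebra p O)ᵐᵒᵖ V := iwasawaModule h.lipschitz
  let R : (iwasawaAlgebra p O)ᵐᵒᵖ →+* Module.End (IsLocalRing.ResidueField O) V' :=
    (RingEquiv.opOp _).symm.toRingHom.comp (RingHom.op ((MonoidAlgebra.lift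
      (IsLocalRing.ResidueField O) _ _ ρ').toRingHom.comp (reduction p O)))
  let _ : Module (iwasawaAlgebra p O)ᵐᵒᵖ V' := Module.compHom V' R
  let f : V →ₗ[(iwasawaAlgebra p O)ᵐᵒᵖ] V' :=
    { red.toAddMonoidHom with map_smul' := fun x w => h.map_iwasawaAct w x.unop }
  let ψ' : H →ₗ[(iwasawaAlgebra p O)ᵐᵒᵖ] V' := { ψ with map_smul' := fun x w => hψ x.unop w }
  obtain ⟨φ, hφ⟩ := Module.projective_lifting_property f ψ' h.surjective
  refine ⟨{ φ with map_smul' := fun c y => ?_ }, fun x y => map_smul φ (op x) y,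
    fun y => LinearMap.congr_fun hφ y⟩
  change φ (c • y) = c • φ y
  rw [← one_smul (iwasawaAlgebra p O)ᵐᵒᵖ y, ← smul_assoc, map_smul, one_smul]
  change iwasawaAct h.lipschitz (φ y) (c • 1) = _
  rw [map_smul]
  congr 1
  exact one_smul (iwasawaAlgebra p O)ᵐᵒᵖ (φ y)

end Reduction

/-! ### The rank of a module of equivariant forms -/

section RankFormula

variable {p : ℕ} [Fact p.Prime] {O : Type*} [CommRing O] [IsDomain O] [IsDiscreteValuationRing O]
  {V : Type*} [AddCommGroup V] [Module O V]
  {V' : Type*} [AddCommGroup V'] [Module (IsLocalRing.ResidueField O) V']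
  {ϖ : O} {ρ : Kp p →* (Module.End O V)ᵐᵒᵖ}
  {ρ' : GL (Fin 2) (ZMod p) →* (Module.End (IsLocalRing.ResidueField O) V')ᵐᵒᵖ}
  {red : V →ₛₗ[IsLocalRing.residue O] V'}
  {H : Type*} [AddCommGroup H] [Module O H] [Module (iwasawaAlgebra p O)ᵐᵒᵖ H]
  [IsScalarTower O (iwasawaAlgebra p O)ᵐᵒᵖ H]
  {J : Subgroup (GL (Fin 2) (ZMod p))}

lemma redOne_surjective : Function.Surjective (redOne p) := by
  have h : Function.Surjective (levelOne p) := by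
    intro g
    have e := ZMod.ringEquivCongr (pow_one p).symm
    refine ⟨Matrix.GeneralLinearGroup.map e.toRingHom g, ?_⟩
    ext i j
    change ((ZMod.castHom (dvd_of_eq (pow_one p).symm) (ZMod p)).comp e.toRingHom) (g.1 i j) = g.1 i j
    rw [Subsingleton.elim ((ZMod.castHom (dvd_of_eq (pow_one p).symm) (ZMod p)).comp e.toRingHom)
      (RingHom.id _)]
    rfl
  intro g
  obtain ⟨g, rfl⟩ := h g
  obtain ⟨g, rfl⟩ := redPow_surjective p 1 g
  exact ⟨g, (levelOne_redPow p g).symm⟩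

variable [Algebra ℤ_[p] O] [Module.Finite ℤ_[p] O] [FaithfulSMul ℤ_[p] O]

/-- The reduction of a continuous equivariant form is killed by the kernel of
`𝒪⟦K_p⟧ → 𝔽[GL₂(𝔽_p)]`: by continuity the elements of this kernel may be replaced by finite
combinations of group elements. -/
lemma IsReduction.red_eq_zero (h : IsReduction ϖ ρ ρ' red) [Module.Finite O V] [Module.Free O V]
    {φ : H →ₗ[O] V} (hφ : φ ∈ levelForms ρ H J) (x : iwasawaAlgebra p O)
    (hx : reduction p O x = 0) (y : H) : red (φ (op x • y)) = 0 := by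
  -- the reduction of `φ(y · g)` only depends on the reduction of `g`
  let lift : GL (Fin 2) (ZMod p) → Kp p := Function.surjInv redOne_surjective
  let Ψ : GL (Fin 2) (ZMod p) → V' := fun c => red (φ (op (groupElt p O (lift c)) • y))
  have hΨ : ∀ g, red (φ (op (groupElt p O g) • y)) = Ψ (redOne p g) := by
    intro g
    let k := (lift (redOne p g))⁻¹ * g
    have hk : redOne p k = 1 := by
      simp only [k, lift, map_mul, map_inv, Function.surjInv_eq, inv_mul_cancel]
    have hg : g = lift (redOne p g) * k := by simp [k]
    conv_lhs => rw [hg, groupElt_mul, op_mul, mul_smul, hφ.2 k (hk ▸ J.one_mem),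
      h.equivariant, hk, map_one, unop_one, Module.End.one_apply]
  -- approximation by finite sums
  let b := Module.Free.chooseBasis O V
  have hcont : ∃ m, ∀ z : iwasawaAlgebra p O, z.1 m = 0 → red (φ (op z • y)) = 0 := by
    have h1 : ∀ᶠ z in @nhds _ (iwasawaTopology p O) 0, ∀ i, (p : O) ∣ b.repr (φ (z • y)) i := by
      rw [Filter.eventually_all]
      intro i
      let _ := iwasawaTopology p O
      let _ := canonicalTopology p O H
      have : IsModuleTopology (iwasawaAlgebra p O)ᵐᵒᵖ H := ⟨rfl⟩
      have : ContinuousSMul (iwasawaAlgebra p O)ᵐᵒᵖ H := ModuleTopology.continuousSMul _ _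
      let _ := padicTopology p O
      have h2 : Continuous fun z : (iwasawaAlgebra p O)ᵐᵒᵖ => b.coord i (φ (z • y)) :=
        (hφ.1 (b.coord i)).comp (continuous_id.smul continuous_const)
      filter_upwards [(continuous_padic_iff (p := p) _).1 h2 1 0] with z hz
      simpa using hz
    obtain ⟨m, hm⟩ := exists_level_of_mem_nhds h1
    refine ⟨m, fun z hz => ?_⟩
    choose c hc using hm z hz
    have : φ (op z • y) = (p : O) • ∑ i, c i • b i := by
      refine b.repr.injective (Finsupp.ext fun i => ?_)
      simp [hc, Finsupp.single_apply]
    rw [this, IsReduction.map_p_smul]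
  obtain ⟨m, hm⟩ := hcont
  -- the finite sum, at a level `n ≥ 1`
  let n := m + 1
  let s : KQuot p n → Kp p := Function.surjInv (redPow_surjective p n)
  have hs : ∀ g, redPow p n (s g) = g := Function.surjInv_eq _
  let x' : iwasawaAlgebra p O := (x.1 n).coeff.sum fun g r => r • groupElt p O (s g)
  have hx' : x'.1 n = x.1 n := by
    have h1 : x'.1 n = (x.1 n).coeff.sum fun g r => MonoidAlgebra.single g r := by
      simp only [x', Finsupp.sum, AddSubmonoidClass.coe_finsetSum, Finset.sum_apply]
      refine Finset.sum_congr rfl fun g _ => ?_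
      change (x.1 n).coeff g • MonoidAlgebra.single (redPow p n (s g)) (1 : O) = _
      rw [hs, MonoidAlgebra.smul_single, smul_eq_mul, mul_one]
    rw [h1]
    exact MonoidAlgebra.sum_coeff_single _
  have h1 : red (φ (op (x - x') • y)) = 0 :=
    hm _ (iwasawaAlgebra_eq_zero_of_le _ m.le_succ (by
      change x.1 n - x'.1 n = 0
      rw [hx', sub_self]))
  rw [op_sub, sub_smul, map_sub, map_sub, sub_eq_zero] at h1
  rw [h1]
  have h2 : red (φ (op x' • y)) = evalSum O (fun g => Ψ (redOne p (s g))) (x.1 n) := by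
    simp only [x', Finsupp.sum, evalSum, Finset.op_sum, Finset.sum_smul, map_sum]
    refine Finset.sum_congr rfl fun g _ => ?_
    rw [op_smul, smul_assoc, map_smul, LinearMap.map_smulₛₗ, hΨ]
  -- descent to level one
  have h3 : ∀ (k : ℕ) (t : ∀ k, KQuot p k → Kp p), (∀ k g, redPow p k (t k g) = g) →
      evalSum O (fun g => Ψ (redOne p (t (k + 1) g))) (x.1 (k + 1)) =
        evalSum O (fun g => Ψ (redOne p (t 1 g))) (x.1 1) := by
    intro k t ht
    induction k with
    | zero => rfl
    | succ k ih =>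
      rw [← ih, ← iwasawaAlgebra_transition x (k + 1), evalSum_mapDomain]
      congr 1
      funext g
      refine congrArg Ψ (redPow_one_eq_of_le (n := k + 1) (by omega) ?_)
      rw [ht, ← transition_redPow, ht]
  have h4 := h3 m (fun k => Function.surjInv (redPow_surjective p k))
    (fun k g => Function.surjInv_eq _ g)
  rw [h2]
  refine h4.trans ?_
  have h5 : (fun g => Ψ (redOne p (Function.surjInv (redPow_surjective p 1) g))) =
      Ψ ∘ levelOne p := by
    funext g
    rw [← levelOne_redPow, Function.surjInv_eq (redPow_surjective p 1)]; rfl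
  rw [h5, ← evalSum_mapDomain]
  exact evalSum_eq_zero _ _ hx

variable {P : Type*} [AddCommGroup P] [Module (IsLocalRing.ResidueField O) P]
  [Module (MonoidAlgebra (IsLocalRing.ResidueField O) (GL (Fin 2) (ZMod p)))ᵐᵒᵖ P]
  [IsScalarTower (IsLocalRing.ResidueField O)
    (MonoidAlgebra (IsLocalRing.ResidueField O) (GL (Fin 2) (ZMod p)))ᵐᵒᵖ P]
  {q : H →ₛₗ[(reduction p O).op] P}

lemma map_op_smul (q : H →ₛₗ[(reduction p O).op] P) (x : iwasawaAlgebra p O) (y : H) :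
    q (op x • y) = op (reduction p O x) • q y := q.map_smulₛₗ _ _

lemma map_groupElt_smul (q : H →ₛₗ[(reduction p O).op] P) (g : Kp p) (y : H) :
    q (op (groupElt p O g) • y) =
      op (MonoidAlgebra.single (redOne p g) (1 : IsLocalRing.ResidueField O)) • q y := by
  rw [map_op_smul, reduction_groupElt]

/-- The map `q` is semilinear for `𝒪 → 𝔽`, as the scalars act through the group algebras. -/
lemma map_coeff_smul (q : H →ₛₗ[(reduction p O).op] P) (c : O) (y : H) :
    q (c • y) = IsLocalRing.residue O c • q y := by
  rw [← one_smul (iwasawaAlgebra p O)ᵐᵒᵖ y, ← smul_assoc, ← op_one, ← op_smul, map_op_smul,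
    map_op_smul]
  have h : reduction p O (c • 1) = MonoidAlgebra.single 1 (IsLocalRing.residue O c) := by
    rw [reduction_apply]
    change MonoidAlgebra.mapRingHom _ _ (MonoidAlgebra.mapDomain (levelOne p)
      (c • (1 : MonoidAlgebra O (KQuot p 1)))) = _
    rw [MonoidAlgebra.one_def, MonoidAlgebra.smul_single, MonoidAlgebra.mapDomain_single]
    simp
  rw [h, map_one, op_one, one_smul, op_single_smul, op_single_one_smul]

/-- The reduction of a continuous equivariant form vanishes on the kernel of `q`, hence factors
through the reduction of `H`. -/
lemma IsReduction.red_eq_zero_of_ker (h : IsReduction ϖ ρ ρ' red) [Module.Finite O V]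
    [Module.Free O V] (hker : LinearMap.ker q = Submodule.span (iwasawaAlgebra p O)ᵐᵒᵖ
      {y : H | ∃ (x : iwasawaAlgebra p O) (h : H), reduction p O x = 0 ∧ y = op x • h})
    {φ : H →ₗ[O] V} (hφ : φ ∈ levelForms ρ H J) {y : H} (hy : q y = 0) : red (φ y) = 0 := by
  have h1 : y ∈ Submodule.span (iwasawaAlgebra p O)ᵐᵒᵖ
      {y : H | ∃ (x : iwasawaAlgebra p O) (h : H), reduction p O x = 0 ∧ y = op x • h} := by
    rw [← hker]; exact hy
  clear hy
  suffices h2 : ∀ z : (iwasawaAlgebra p O)ᵐᵒᵖ, red (φ (z • y)) = 0 by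
    simpa using h2 1
  induction h1 using Submodule.span_induction with
  | mem y hy' =>
    obtain ⟨x, y, hx, rfl⟩ := hy'
    intro z
    have : z • op x • y = op (x * z.unop) • y := by rw [op_mul, op_unop, mul_smul]
    rw [this]
    exact h.red_eq_zero hφ _ (by rw [map_mul, hx, zero_mul]) y
  | zero => simp
  | add y y' _ _ hy hy' => intro z; rw [smul_add, map_add, map_add, hy, hy', add_zero]
  | smul a y _ hy => intro z; rw [← mul_smul]; exact hy _

/-- Continuous equivariant forms reduce to equivariant maps on the reduction of `H`. -/
lemma IsReduction.exists_reduction (h : IsReduction ϖ ρ ρ' red) [Module.Finite O V]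
    [Module.Free O V] (hq : Function.Surjective q)
    (hker : LinearMap.ker q = Submodule.span (iwasawaAlgebra p O)ᵐᵒᵖ
      {y : H | ∃ (x : iwasawaAlgebra p O) (h : H), reduction p O x = 0 ∧ y = op x • h}) :
    ∃ T : levelForms ρ H J →ₛₗ[IsLocalRing.residue O]
      eqHom P J (fun g => (ρ' g).unop) (⊤ : Submodule (IsLocalRing.ResidueField O) V'),
      ∀ φ y, (T φ).1 (q y) = red (φ.1 y) := by
  have key : ∀ φ ∈ levelForms ρ H J, ∀ y y', q y = q y' → red (φ y) = red (φ y') := by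
    intro φ hφ y y' hy
    rw [← sub_eq_zero, ← map_sub, ← map_sub]
    exact h.red_eq_zero_of_ker hker hφ (by rw [map_sub, hy, sub_self])
  let s : P → H := Function.surjInv hq
  have hs : ∀ y, q (s y) = y := Function.surjInv_eq hq
  let T₀ : levelForms ρ H J → (P →ₗ[IsLocalRing.ResidueField O] V') := fun φ =>
    { toFun := fun y => red (φ.1 (s y))
      map_add' := fun y y' => by
        rw [← map_add, ← map_add]
        exact key _ φ.2 _ _ (by rw [map_add, hs, hs, hs])
      map_smul' := fun c y => by
        obtain ⟨c, rfl⟩ := IsLocalRing.residue_surjective c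
        rw [RingHom.id_apply, ← LinearMap.map_smulₛₗ, ← map_smul]
        exact key _ φ.2 _ _ (by rw [map_coeff_smul, hs, hs]) }
  have hT₀ : ∀ φ y, T₀ φ (q y) = red (φ.1 y) := fun φ y => key _ φ.2 _ _ (hs _)
  refine ⟨{ toFun := fun φ => ⟨T₀ φ, fun _ => trivial, ?_⟩, map_add' := ?_, map_smul' := ?_ }, hT₀⟩
  · intro g hg x
    obtain ⟨y, rfl⟩ := hq x
    obtain ⟨g, rfl⟩ := redOne_surjective g
    rw [← map_groupElt_smul, hT₀, hT₀, φ.2.2 g hg, h.equivariant]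
  · intro φ ψ
    refine Subtype.ext (LinearMap.ext fun x => ?_)
    change red ((φ.1 + ψ.1) (s x)) = red (φ.1 (s x)) + red (ψ.1 (s x))
    rw [LinearMap.add_apply, map_add]
  · intro c φ
    refine Subtype.ext (LinearMap.ext fun x => ?_)
    change red ((c • φ.1) (s x)) = IsLocalRing.residue O c • red (φ.1 (s x))
    rw [LinearMap.smul_apply, LinearMap.map_smulₛₗ]

/-- Equivariant maps on the reduction of `H` lift to continuous equivariant forms. -/
lemma IsReduction.exists_form (h : IsReduction ϖ ρ ρ' red) [Module.Finite O V]
    [Module.Free O V] (hproj : Module.Projective (iwasawaAlgebra p O)ᵐᵒᵖ H)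
    (q : H →ₛₗ[(reduction p O).op] P) (ψ : P →ₗ[IsLocalRing.ResidueField O] V')
    (hψ : ψ ∈ eqHom P J (fun g => (ρ' g).unop) ⊤) :
    ∃ φ ∈ levelForms ρ H J, ∀ y, red (φ y) = ψ (q y) := by
  let X := GL (Fin 2) (ZMod p) ⧸ J
  have hX := h.coind X
  -- `Ψ` corresponds to `ψ` by Frobenius reciprocity
  let Ψ : P →ₗ[IsLocalRing.ResidueField O] (X → V') :=
    { toFun := fun y x => (ρ' (Quotient.out x)⁻¹).unop
        (ψ (op (MonoidAlgebra.single (Quotient.out x) (1 : IsLocalRing.ResidueField O)) • y))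
      map_add' := fun y y' => by ext; simp
      map_smul' := fun c y => by ext x; simp [op_single_smul_smul] }
  have hΨ : ∀ y (c : GL (Fin 2) (ZMod p)), Ψ y (c : X) =
      (ρ' c⁻¹).unop (ψ (op (MonoidAlgebra.single c (1 : IsLocalRing.ResidueField O)) • y)) := by
    intro y c
    obtain ⟨j, hj⟩ := QuotientGroup.mk_out_eq_mul J c
    change (ρ' (Quotient.out (c : X))⁻¹).unop (ψ (op (MonoidAlgebra.single
      (Quotient.out (c : X)) (1 : IsLocalRing.ResidueField O)) • y)) = _
    rw [show Quotient.out (c : X) = c * j from hj, op_single_mul_smul, hψ.2 j j.2, mul_inv_rev,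
      ← Module.End.mul_apply, ← unop_mul, ← map_mul]
    congr 4
    group
  have hΨe : ∀ g y, Ψ (op (MonoidAlgebra.single g (1 : IsLocalRing.ResidueField O)) • y) =
      (coindRep (MonoidHom.id _) X ρ' g).unop (Ψ y) := by
    intro g y
    funext x
    obtain ⟨c, rfl⟩ := QuotientGroup.mk_surjective x
    have : (MonoidHom.id (GL (Fin 2) (ZMod p)) g) • (c : X) = ((g * c : GL (Fin 2) (ZMod p)) : X) :=
      rfl
    rw [coindRep_apply, this, hΨ, hΨ, ← op_single_mul_smul, ← Module.End.mul_apply, ← unop_mul,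
      ← map_mul]
    congr 4
    group
  have := isAdicComplete_span_p p O
  have : IsAdicComplete (Ideal.span {(p : O)}) (X → V) := isAdicComplete_of_free (p : O)
  obtain ⟨Φ, hΦ, hΦr⟩ := hX.exists_lift hproj (Ψ.toAddMonoidHom.comp q.toAddMonoidHom) (by
    intro x y
    exact (congrArg Ψ (map_op_smul q x y)).trans (lift_equivariant _ Ψ hΨe _ _))
  let e : X := ((1 : GL (Fin 2) (ZMod p)) : X)
  refine ⟨LinearMap.proj e ∘ₗ Φ, ⟨fun l => ?_, fun g hg y => ?_⟩, fun y => ?_⟩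
  · exact continuous_of_iwasawa_linear hX.lipschitz Φ.toAddMonoidHom hΦ (l ∘ₗ LinearMap.proj e)
  · have he : redOne p g • e = e := by
      change ((redOne p g * 1 : GL (Fin 2) (ZMod p)) : X) = ((1 : GL (Fin 2) (ZMod p)) : X)
      rw [mul_one]
      exact QuotientGroup.eq.2 (by simpa using hg)
    change Φ (op (groupElt p O g) • y) e = (ρ g).unop (Φ y e)
    rw [hΦ, iwasawaAct_groupElt, coindRep_apply, he]
  · have h1 := congrFun (hΦr y) e
    change red (Φ y e) = ψ (q y)
    refine h1.trans ?_
    change Ψ (q y) e = _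
    rw [hΨ, inv_one, map_one, unop_one, Module.End.one_apply, op_single_one_smul]

/-- A finitely generated module over the Iwasawa algebra has finite-dimensional reduction. -/
lemma finite_reduction (hfin : Module.Finite (iwasawaAlgebra p O)ᵐᵒᵖ H)
    (q : H →ₛₗ[(reduction p O).op] P) (hq : Function.Surjective q) :
    Module.Finite (IsLocalRing.ResidueField O) P := by
  obtain ⟨n, s, hs⟩ := Module.Finite.exists_fin (R := (iwasawaAlgebra p O)ᵐᵒᵖ) (M := H)
  let f : Fin n × GL (Fin 2) (ZMod p) → P := fun i =>
    op (MonoidAlgebra.single i.2 (1 : IsLocalRing.ResidueField O)) • q (s i.1)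
  suffices h : Submodule.span (IsLocalRing.ResidueField O) (Set.range f) = ⊤ from
    ⟨⟨(Set.finite_range f).toFinset, by simpa using h⟩⟩
  rw [eq_top_iff]
  rintro x -
  obtain ⟨y, rfl⟩ := hq x
  have hy : y ∈ Submodule.span (iwasawaAlgebra p O)ᵐᵒᵖ (Set.range s) := hs ▸ trivial
  have key : ∀ (r : MonoidAlgebra (IsLocalRing.ResidueField O) (GL (Fin 2) (ZMod p))) (x : P),
      x ∈ Submodule.span (IsLocalRing.ResidueField O) (Set.range f) →
      op r • x ∈ Submodule.span (IsLocalRing.ResidueField O) (Set.range f) := by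
    intro r x hx
    induction r using MonoidAlgebra.induction_linear with
    | zero => simp
    | add r t hr ht => rw [op_add, add_smul]; exact Submodule.add_mem _ hr ht
    | single g c =>
      rw [op_single_smul]
      refine Submodule.smul_mem _ _ ?_
      induction hx using Submodule.span_induction with
      | mem x hx =>
        obtain ⟨i, rfl⟩ := hx
        refine Submodule.subset_span ⟨(i.1, i.2 * g), ?_⟩
        exact op_single_mul_smul _ _ _
      | zero => simp
      | add x y _ _ hx hy => rw [smul_add]; exact Submodule.add_mem _ hx hy
      | smul a x _ hx => rw [op_single_smul_smul]; exact Submodule.smul_mem _ _ hx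
  induction hy using Submodule.span_induction with
  | mem y hy =>
    obtain ⟨i, rfl⟩ := hy
    refine Submodule.subset_span ⟨(i, 1), op_single_one_smul _⟩
  | zero => simp
  | add x y _ _ hx hy => rw [map_add]; exact Submodule.add_mem _ hx hy
  | smul a x _ hx => rw [q.map_smulₛₗ]; exact key _ _ hx

/-- The rank of a module of equivariant forms is the dimension of the space of equivariant maps on
the reduction of `H`. -/
theorem IsReduction.finrank_levelForms (hϖ : Irreducible ϖ) (h : IsReduction ϖ ρ ρ' red)
    [Module.Finite O V] [Module.Free O V] (hfin : Module.Finite (iwasawaAlgebra p O)ᵐᵒᵖ H)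
    (hproj : Module.Projective (iwasawaAlgebra p O)ᵐᵒᵖ H)
    (q : H →ₛₗ[(reduction p O).op] P) (hq : Function.Surjective q)
    (hker : LinearMap.ker q = Submodule.span (iwasawaAlgebra p O)ᵐᵒᵖ
      {y : H | ∃ (x : iwasawaAlgebra p O) (h : H), reduction p O x = 0 ∧ y = op x • h}) :
    Module.finrank O (levelForms ρ H J) = Module.finrank (IsLocalRing.ResidueField O)
      (eqHom P J (fun g => (ρ' g).unop) (⊤ : Submodule (IsLocalRing.ResidueField O) V')) := by
  obtain ⟨T, hT⟩ := h.exists_reduction (J := J) hq hker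
  -- a form with zero reduction is divisible by `ϖ`
  have hdiv : ∀ φ : levelForms ρ H J, T φ = 0 → ∃ φ' : levelForms ρ H J, φ = ϖ • φ' := by
    intro φ hφ
    have h0 : ∀ y, ∃ v, φ.1 y = ϖ • v := fun y => h.ker _ (by rw [← hT, hφ]; rfl)
    choose f hf using h0
    have hinj : ∀ v w : V, ϖ • v = ϖ • w → v = w := fun v w => smul_right_injective V hϖ.ne_zero
      |>.eq_iff.1
    let φ' : H →ₗ[O] V :=
      { toFun := f
        map_add' := fun y y' => hinj _ _ (by rw [← hf, map_add, smul_add, ← hf, ← hf])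
        map_smul' := fun c y => hinj _ _ (by
          rw [← hf, map_smul, RingHom.id_apply, smul_comm, ← hf]) }
    refine ⟨⟨φ', fun l => ?_, fun g hg y => hinj _ _ ?_⟩, Subtype.ext (LinearMap.ext hf)⟩
    · let _ := canonicalTopology p O H
      refine (continuous_padic_iff (p := p) _).2 fun M y₀ => ?_
      filter_upwards [(continuous_padic_iff (p := p) _).1 (φ.2.1 l) (M + 1) y₀] with y hy
      obtain ⟨b, hb⟩ : ϖ ∣ (p : O) := by
        rw [← Ideal.mem_span_singleton, ← hϖ.maximalIdeal_eq]
        exact p_mem_maximalIdeal p O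
      obtain ⟨c, hc⟩ := hy
      refine ⟨b * c, mul_left_cancel₀ hϖ.ne_zero ?_⟩
      rw [hf, hf, map_smul, map_smul, smul_eq_mul, smul_eq_mul, pow_succ, hb] at hc
      rw [hb]
      change ϖ * (l (f y) - l (f y₀)) = _
      rw [mul_sub, hc]; ring
    · change ϖ • f _ = ϖ • (ρ g).unop (f y)
      rw [← hf, φ.2.2 g hg, ← map_smul, ← hf]
  have hsurj : Function.Surjective T := by
    intro ψ
    obtain ⟨φ, hφ, hφψ⟩ := h.exists_form hproj q ψ.1 ψ.2
    refine ⟨⟨φ, hφ⟩, Subtype.ext (LinearMap.ext fun x => ?_)⟩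
    obtain ⟨y, rfl⟩ := hq x
    rw [hT, hφψ]
  -- finiteness: a form is determined by its values at lifts of generators of the reduction
  have hfinite : Module.Finite O (levelForms ρ H J) := by
    have := finite_reduction hfin q hq
    obtain ⟨n, s, hs⟩ := Module.Finite.exists_fin (R := IsLocalRing.ResidueField O) (M := P)
    choose t ht using fun i => hq (s i)
    let E : levelForms ρ H J →ₗ[O] (Fin n → V) :=
      { toFun := fun φ i => φ.1 (t i)
        map_add' := fun φ ψ => rfl
        map_smul' := fun c φ => rfl }
    refine Module.Finite.of_injective E ((injective_iff_map_eq_zero E).2 fun φ hφ => ?_)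
    have step : ∀ ψ, E ψ = 0 → ∃ ψ', E ψ' = 0 ∧ ψ = ϖ • ψ' := by
      intro ψ hψ
      have h1 : T ψ = 0 := by
        refine Subtype.ext (LinearMap.ext_on_range hs fun i => ?_)
        rw [← ht, hT]
        change red (E ψ i) = 0
        rw [hψ]; exact map_zero red
      obtain ⟨ψ', rfl⟩ := hdiv ψ h1
      refine ⟨ψ', ?_, rfl⟩
      rw [map_smul] at hψ
      exact (smul_eq_zero.1 hψ).resolve_left hϖ.ne_zero
    have hpow : ∀ n : ℕ, ∃ ψ', E ψ' = 0 ∧ φ = ϖ ^ n • ψ' := by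
      intro n
      induction n with
      | zero => exact ⟨φ, hφ, by simp⟩
      | succ n ih =>
        obtain ⟨ψ, hψ, hn⟩ := ih
        obtain ⟨ψ', hψ', rfl⟩ := step ψ hψ
        exact ⟨ψ', hψ', by rw [hn, smul_smul, pow_succ]⟩
    refine Subtype.ext (LinearMap.ext fun y => eq_zero_of_forall_dvd O hϖ _ fun n => ?_)
    obtain ⟨ψ', -, rfl⟩ := hpow n
    exact ⟨ψ'.1 y, rfl⟩
  exact finrank_eq_finrank_reduction hϖ T hsurj hdiv

end RankFormula

/-! ### Exactness of equivariant maps out of a projective module -/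

section Higman

variable {F G : Type*} [Field F] [Group G] [Finite G] {P : Type*} [AddCommGroup P] [Module F P]
  [Module (MonoidAlgebra F G)ᵐᵒᵖ P] [IsScalarTower F (MonoidAlgebra F G)ᵐᵒᵖ P]

/-- Higman's criterion: the identity of a projective module is the trace of a linear map. -/
lemma exists_trace_eq_id [Fintype G] (hP : Module.Projective (MonoidAlgebra F G)ᵐᵒᵖ P) :
    ∃ α : P →ₗ[F] P, ∀ x : P, ∑ g : G, op (MonoidAlgebra.single g (1 : F)) •
      α (op (MonoidAlgebra.single g⁻¹ (1 : F)) • x) = x := by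
  obtain ⟨s, hs⟩ := Module.projective_def'.1 hP
  let c₁ : P → P →ₗ[F] F := fun y =>
    { toFun := fun x => (s x y).unop.coeff 1
      map_add' := fun x x' => by simp
      map_smul' := fun c x => by
        rw [← one_smul (MonoidAlgebra F G)ᵐᵒᵖ x, ← smul_assoc, map_smul]
        simp }
  let α₀ : P → P := fun x => (s x).sum fun y r => r.unop.coeff 1 • y
  have hα₀ : ∀ x (S : Finset P), (s x).support ⊆ S → α₀ x = ∑ y ∈ S, c₁ y x • y := by
    intro x S hS
    exact Finsupp.sum_of_support_subset _ hS _ (by simp)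
  let α : P →ₗ[F] P :=
    { toFun := α₀
      map_add' := fun x x' => by
        classical
        let S := (s x).support ∪ (s x').support ∪ (s (x + x')).support
        rw [hα₀ x S (fun y hy => by simp [S, Finset.mem_union, Finsupp.mem_support_iff.1 hy]),
          hα₀ x' S (fun y hy => by simp [S, Finset.mem_union, Finsupp.mem_support_iff.1 hy]),
          hα₀ (x + x') S Finset.subset_union_right, ← Finset.sum_add_distrib]
        exact Finset.sum_congr rfl fun y _ => by rw [map_add, add_smul]
      map_smul' := fun c x => by
        classical
        let S := (s x).support ∪ (s (c • x)).support
        rw [hα₀ x S Finset.subset_union_left, hα₀ (c • x) S Finset.subset_union_right,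
          RingHom.id_apply, Finset.smul_sum]
        exact Finset.sum_congr rfl fun y _ => by rw [map_smul, smul_assoc] }
  refine ⟨α, fun x => ?_⟩
  have h1 : ∀ g : G, α (op (MonoidAlgebra.single g⁻¹ (1 : F)) • x) =
      (s x).sum fun y r => r.unop.coeff g • y := by
    intro g
    have h2 : (s (op (MonoidAlgebra.single g⁻¹ (1 : F)) • x)).support ⊆ (s x).support := by
      rw [map_smul]; exact Finsupp.support_smul
    refine (hα₀ _ _ h2).trans (Finset.sum_congr rfl fun y _ => ?_)
    change (s (op (MonoidAlgebra.single g⁻¹ (1 : F)) • x) y).unop.coeff 1 • y = _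
    rw [map_smul, Finsupp.smul_apply, smul_eq_mul, unop_mul, unop_op]
    congr 1
    simp
  simp only [h1, Finsupp.sum, Finset.smul_sum]
  rw [Finset.sum_comm]
  conv_rhs => rw [← LinearMap.id_apply (R := (MonoidAlgebra F G)ᵐᵒᵖ) x, ← hs,
    LinearMap.comp_apply, Finsupp.linearCombination_apply, Finsupp.sum]
  refine Finset.sum_congr rfl fun y _ => ?_
  rw [id, ← op_unop (s x y)]
  generalize (s x y).unop = r
  rw [unop_op]
  have h3 : ∀ g, op (MonoidAlgebra.single g (1 : F)) • r.coeff g • y =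
      op (MonoidAlgebra.single g (r.coeff g)) • y := fun g => by
    rw [op_single_smul_smul, op_single_smul g (r.coeff g) y]
  simp only [h3]
  rw [← Finset.sum_smul, ← Finset.op_sum]
  congr 2
  ext g
  simp

lemma exists_trace_eq_id_subgroup (hP : Module.Projective (MonoidAlgebra F G)ᵐᵒᵖ P)
    (J : Subgroup G) [Fintype J] :
    ∃ α : P →ₗ[F] P, ∀ x : P, ∑ j : J, op (MonoidAlgebra.single (j : G) (1 : F)) •
      α (op (MonoidAlgebra.single (j : G)⁻¹ (1 : F)) • x) = x := by
  have := Fintype.ofFinite G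
  have := Fintype.ofFinite (G ⧸ J)
  obtain ⟨α, hα⟩ := exists_trace_eq_id hP
  refine ⟨∑ c : G ⧸ J,
    { toFun := fun x => op (MonoidAlgebra.single (Quotient.out c) (1 : F)) •
        α (op (MonoidAlgebra.single (Quotient.out c)⁻¹ (1 : F)) • x)
      map_add' := fun x y => by rw [smul_add, map_add, smul_add]
      map_smul' := fun a x => by
        rw [op_single_smul_smul, map_smul, op_single_smul_smul, RingHom.id_apply] },
    fun x => ?_⟩
  simp only [LinearMap.sum_apply, LinearMap.coe_mk, AddHom.coe_mk, Finset.smul_sum]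
  refine Eq.trans ?_ (hα x)
  rw [← Fintype.sum_prod_type']
  let e : J × (G ⧸ J) → G := fun i => Quotient.out i.2 * i.1
  have he : Function.Bijective e := by
    constructor
    · rintro ⟨j, c⟩ ⟨j', c'⟩ h
      have h1 : c = c' := by
        have := congrArg (fun g : G => (g : G ⧸ J)) h
        simp only [e] at this
        rw [QuotientGroup.mk_mul_of_mem _ j.2, QuotientGroup.mk_mul_of_mem _ j'.2] at this
        simpa using this
      subst h1
      simp only [e, mul_right_inj, SetLike.coe_eq_coe] at h
      rw [h]
    · intro g
      obtain ⟨j, hj⟩ := QuotientGroup.mk_out_eq_mul J g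
      refine ⟨(j⁻¹, (g : G ⧸ J)), ?_⟩
      change Quotient.out (g : G ⧸ J) * _ = g
      rw [hj]; simp
  refine Fintype.sum_bijective e he _ _ fun i => ?_
  simp only [e]
  rw [← op_single_mul_smul, ← op_single_mul_smul, mul_inv_rev]

variable {W W' : Type*} [AddCommGroup W] [Module F W] [AddCommGroup W'] [Module F W']
  {J : Subgroup G} {σ : G → Module.End F W} {σ' : G → Module.End F W'}
  {N : Submodule F W} {N' : Submodule F W'} {π : W →ₗ[F] W'}

/-- The endomorphisms `σ g` of `W`, for `g ∈ J`, define a right action of `J` on the subspace `N`. -/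
structure IsStable (J : Subgroup G) (σ : G → Module.End F W) (N : Submodule F W) : Prop where
  mem : ∀ g ∈ J, ∀ w ∈ N, σ g w ∈ N
  mul : ∀ g ∈ J, ∀ h ∈ J, ∀ w ∈ N, σ (g * h) w = σ h (σ g w)

/-- Equivariant maps out of a projective module lift along equivariant surjections. -/
lemma exists_eqHom_lift (hP : Module.Projective (MonoidAlgebra F G)ᵐᵒᵖ P) (hN : IsStable J σ N)
    (hπ : ∀ g ∈ J, ∀ w ∈ N, π (σ g w) = σ' g (π w)) (hsurj : ∀ w' ∈ N', ∃ w ∈ N, π w = w')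
    {ψ : P →ₗ[F] W'} (hψ : ψ ∈ eqHom P J σ' N') : ∃ φ ∈ eqHom P J σ N, π ∘ₗ φ = ψ := by
  have := Fintype.ofFinite J
  obtain ⟨α, hα⟩ := exists_trace_eq_id_subgroup hP J
  obtain ⟨l, hl⟩ : ∃ l : P →ₗ[F] N, ∀ x, π (l x) = ψ x := by
    let f := (π ∘ₗ N.subtype).rangeRestrict
    let g : P →ₗ[F] LinearMap.range (π ∘ₗ N.subtype) := ψ.codRestrict _ fun x => by
      obtain ⟨w, hw, hwx⟩ := hsurj _ (hψ.1 x)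
      exact ⟨⟨w, hw⟩, hwx⟩
    obtain ⟨l, hl⟩ := Module.projective_lifting_property f g (LinearMap.surjective_rangeRestrict _)
    exact ⟨l, fun x => congrArg Subtype.val (LinearMap.congr_fun hl x)⟩
  let τ : P → J → P := fun x j => α (op (MonoidAlgebra.single (j : G)⁻¹ (1 : F)) • x)
  let φ : P →ₗ[F] W :=
    { toFun := fun x => ∑ j : J, σ j (l (τ x j))
      map_add' := fun x y => by
        rw [← Finset.sum_add_distrib]
        exact Finset.sum_congr rfl fun j _ => by simp [τ]
      map_smul' := fun c x => by
        rw [RingHom.id_apply, Finset.smul_sum]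
        exact Finset.sum_congr rfl fun j _ => by simp only [τ, op_single_smul_smul]; simp }
  refine ⟨φ, ⟨fun x => N.sum_mem fun j _ => hN.mem _ j.2 _ (l _).2, fun k hk x => ?_⟩,
    LinearMap.ext fun x => ?_⟩
  · change ∑ j : J, σ j (l (τ _ j)) = σ k (∑ j : J, σ j (l (τ x j)))
    rw [map_sum]
    refine (Fintype.sum_equiv (Equiv.mulRight (⟨k, hk⟩ : J)) _ _ fun j => ?_).symm
    rw [← hN.mul _ j.2 _ hk _ (l _).2]
    simp only [τ, Equiv.coe_mulRight, Subgroup.coe_mul, ← op_single_mul_smul]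
    congr 6
    group
  · change π (∑ j : J, σ j (l (τ x j))) = ψ x
    conv_rhs => rw [← hα x]
    rw [map_sum, map_sum]
    refine Finset.sum_congr rfl fun j _ => ?_
    rw [hπ _ j.2 _ (l _).2, hl, hψ.2 _ j.2]

variable [Module.Finite F P]

lemma finite_eqHom [Module.Finite F N] : Module.Finite F (eqHom P J σ N) := by
  let E : eqHom P J σ N →ₗ[F] (P →ₗ[F] N) :=
    { toFun := fun φ => φ.1.codRestrict N φ.2.1
      map_add' := fun φ ψ => rfl
      map_smul' := fun c φ => rfl }
  refine Module.Finite.of_injective E fun φ ψ h => Subtype.ext (LinearMap.ext fun x => ?_)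
  exact congrArg Subtype.val (LinearMap.congr_fun h x)

/-- Additivity of the dimension of spaces of equivariant maps along short exact sequences. -/
lemma finrank_eqHom_add (hP : Module.Projective (MonoidAlgebra F G)ᵐᵒᵖ P) (hN : IsStable J σ N)
    [Module.Finite F N]
    (hπ : ∀ g ∈ J, ∀ w ∈ N, π (σ g w) = σ' g (π w)) (hle : ∀ w ∈ N, π w ∈ N')
    (hsurj : ∀ w' ∈ N', ∃ w ∈ N, π w = w') :
    Module.finrank F (eqHom P J σ N) =
      Module.finrank F (eqHom P J σ (N ⊓ LinearMap.ker π)) +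
        Module.finrank F (eqHom P J σ' N') := by
  have := finite_eqHom (P := P) (J := J) (σ := σ) (N := N)
  let pr : eqHom P J σ N →ₗ[F] eqHom P J σ' N' :=
    { toFun := fun φ => ⟨π ∘ₗ φ.1, fun x => hle _ (φ.2.1 x), fun g hg x => by
        rw [LinearMap.comp_apply, φ.2.2 g hg, hπ g hg _ (φ.2.1 x)]; rfl⟩
      map_add' := fun φ ψ => Subtype.ext (LinearMap.ext fun x => map_add π _ _)
      map_smul' := fun c φ => Subtype.ext (LinearMap.ext fun x => map_smul π _ _) }
  have hpr : Function.Surjective pr := by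
    intro ψ
    obtain ⟨φ, hφ, h⟩ := exists_eqHom_lift hP hN hπ hsurj ψ.2
    exact ⟨⟨φ, hφ⟩, Subtype.ext h⟩
  let e : LinearMap.ker pr ≃ₗ[F] eqHom P J σ (N ⊓ LinearMap.ker π) :=
    { toFun := fun φ => ⟨φ.1.1, fun x => ⟨φ.1.2.1 x,
        LinearMap.congr_fun (congrArg Subtype.val φ.2) x⟩, φ.1.2.2⟩
      map_add' := fun _ _ => rfl
      map_smul' := fun _ _ => rfl
      invFun := fun φ => ⟨⟨φ.1, fun x => (φ.2.1 x).1, φ.2.2⟩,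
        Subtype.ext (LinearMap.ext fun x => (φ.2.1 x).2)⟩
      left_inv := fun _ => rfl
      right_inv := fun _ => rfl }
  rw [← LinearMap.finrank_range_add_finrank_ker pr, LinearMap.range_eq_top.2 hpr, finrank_top,
    e.finrank_eq, add_comm]

lemma finrank_eqHom_bot : Module.finrank F (eqHom P J σ (⊥ : Submodule F W)) = 0 := by
  have : Subsingleton (eqHom P J σ (⊥ : Submodule F W)) :=
    ⟨fun φ ψ => Subtype.ext (LinearMap.ext fun x => by
      rw [(Submodule.mem_bot F).1 (φ.2.1 x), (Submodule.mem_bot F).1 (ψ.2.1 x)])⟩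
  exact Module.finrank_zero_of_subsingleton

/-- Spaces of equivariant maps to isomorphic targets have the same dimension. -/
lemma finrank_eqHom_congr (hP : Module.Projective (MonoidAlgebra F G)ᵐᵒᵖ P) (hN : IsStable J σ N)
    [Module.Finite F N]
    (hπ : ∀ g ∈ J, ∀ w ∈ N, π (σ g w) = σ' g (π w)) (hle : ∀ w ∈ N, π w ∈ N')
    (hinj : ∀ w ∈ N, π w = 0 → w = 0) (hsurj : ∀ w' ∈ N', ∃ w ∈ N, π w = w') :
    Module.finrank F (eqHom P J σ N) = Module.finrank F (eqHom P J σ' N') := by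
  have h : N ⊓ LinearMap.ker π = ⊥ := by
    rw [eq_bot_iff]
    rintro w ⟨h1, h2⟩
    exact hinj w h1 h2
  rw [finrank_eqHom_add hP hN hπ hle hsurj, h, finrank_eqHom_bot, zero_add]

end Higman

/-! ### Serre weights for `GL₂(𝔽_p)` -/

section Weights

variable (p : ℕ) [Fact p.Prime] (F : Type*) [Field F] [CharP F p]

/-- The embedding of the prime field. -/
def primeHom : ZMod p →+* F := ZMod.castHom (dvd_refl p) F

variable {F}

/-- The right action of `GL₂(𝔽_p)` on polynomials underlying `Sym^b ⊗ det^m`. -/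
def weightAct (b m : ℕ) (g : GL (Fin 2) (ZMod p)) : Module.End F F[X] :=
  primeHom p F g.1.det ^ m • polyActionₗ b (g.1.map (primeHom p F))

lemma weightAct_apply (b m : ℕ) (g : GL (Fin 2) (ZMod p)) (f : F[X]) :
    weightAct p b m g f =
      primeHom p F g.1.det ^ m • polyAction b (g.1.map (primeHom p F)) f := rfl

lemma weightAct_mul (b m : ℕ) (g h : GL (Fin 2) (ZMod p)) (f : F[X]) :
    weightAct p b m (g * h) f = weightAct p b m h (weightAct p b m g f) := by
  simp only [weightAct_apply, polyAction_smul, smul_smul, ← polyAction_mul, ← Matrix.map_mul,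
    Units.val_mul, Matrix.det_mul, map_mul, mul_pow]
  rw [mul_comm]

lemma isStable_weightAct (J : Subgroup (GL (Fin 2) (ZMod p))) (b m : ℕ) :
    IsStable J (weightAct (F := F) p b m) (degreeLT F (b + 1)) :=
  ⟨fun _ _ _ _ => Submodule.smul_mem _ _ (polyAction_mem _ _ _),
    fun g _ h _ f _ => weightAct_mul p b m g h f⟩

lemma primeHom_det_ne_zero (g : GL (Fin 2) (ZMod p)) : primeHom p F g.1.det ≠ 0 := by
  exact (_root_.map_ne_zero _).2 g.det.ne_zero

lemma polyAction_mem_of_weightAct_mem {b m : ℕ} {g : GL (Fin 2) (ZMod p)} {f : F[X]}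
    {N : Submodule F F[X]} (h : weightAct p b m g f ∈ N) :
    polyAction b (g.1.map (primeHom p F)) f ∈ N := by
  rw [weightAct_apply] at h
  exact (N.smul_mem_iff (pow_ne_zero m (primeHom_det_ne_zero p g))).1 h

/-- A polynomial of degree less than `p` which is constant on `𝔽_p` is constant. -/
lemma eq_C_of_forall_eval {f : F[X]} (hf : f.natDegree < p) {c : F}
    (h : ∀ t : ZMod p, f.eval (primeHom p F t) = c) : f = C c := by
  rw [← sub_eq_zero]
  refine eq_zero_of_natDegree_lt_card_of_eval_eq_zero _ (primeHom p F).injective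
    (fun t => by simp [h]) ?_
  rw [natDegree_sub_C, ZMod.card]
  exact hf

/-- The translation `z ↦ z + t`. -/
def translation (t : ZMod p) : GL (Fin 2) (ZMod p) :=
  Matrix.GeneralLinearGroup.mkOfDetNeZero !![1, t; 0, 1] (by simp)

lemma translation_val (t : ZMod p) : (translation p t).1 = !![1, t; 0, 1] := rfl

lemma polyAction_translation {b : ℕ} {f : F[X]} (hf : f.natDegree ≤ b) (t : ZMod p) :
    polyAction b ((translation p t).1.map (primeHom p F)) f = f.comp (X + C (primeHom p F t)) := by
  rw [polyAction_eq_homEval, translation_val]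
  refine Eq.trans ?_ ((homEval_one_right hf (X + C (primeHom p F t))).trans rfl)
  simp

/-- Polynomials of degree less than `p` fixed by all translations are constant. -/
lemma eq_C_of_translation_invariant {f : F[X]} (hf : f.natDegree < p)
    (h : ∀ t : ZMod p, f.comp (X + C (primeHom p F t)) = f) : f = C (f.eval 0) :=
  eq_C_of_forall_eval p hf fun t => by
    conv_rhs => rw [← h t]
    simp

/-- `Sym^b` is irreducible for `b < p`. -/
lemma degreeLT_le_of_stable {b : ℕ} (hb : b < p) {N : Submodule F F[X]}
    (hN : N ≤ degreeLT F (b + 1))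
    (hst : ∀ g : GL (Fin 2) (ZMod p), ∀ f ∈ N, polyAction b (g.1.map (primeHom p F)) f ∈ N)
    (hne : N ≠ ⊥) : degreeLT F (b + 1) ≤ N := by
  -- a nonzero element of minimal degree is constant
  have h1 : (1 : F[X]) ∈ N := by
    obtain ⟨f, ⟨hf, hf0⟩, hmin⟩ := (measure natDegree).wf.has_min {f : F[X] | f ∈ N ∧ f ≠ 0}
      (by obtain ⟨f, hf, hf0⟩ := N.ne_bot_iff.1 hne; exact ⟨f, hf, hf0⟩)
    have hfb := natDegree_le_of_mem (hN hf)
    have hinv : ∀ t : ZMod p, f.comp (X + C (primeHom p F t)) = f := by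
      intro t
      by_contra hne
      have hmem : f.comp (X + C (primeHom p F t)) - f ∈ N :=
        N.sub_mem (by rw [← polyAction_translation p hfb]; exact hst _ _ hf) hf
      refine hmin _ ⟨hmem, sub_ne_zero.2 hne⟩ ?_
      have hd : (f.comp (X + C (primeHom p F t))).degree = f.degree := by
        rw [degree_eq_natDegree hf0, degree_eq_natDegree (fun h => hf0 ?_), natDegree_comp,
          natDegree_X_add_C, mul_one]
        exact comp_X_add_C_eq_zero_iff.1 h
      refine natDegree_lt_natDegree (sub_ne_zero.2 hne) ?_
      rw [← hd]
      refine degree_sub_lt_left hd (fun h => hf0 (comp_X_add_C_eq_zero_iff.1 h)) ?_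
      rw [leadingCoeff_comp (by simp)]
      simp
    rw [eq_C_of_translation_invariant p (hfb.trans_lt hb) hinv] at hf hf0
    have := N.smul_mem (f.eval 0)⁻¹ hf
    rwa [smul_C, smul_eq_mul, inv_mul_cancel₀ (fun h => hf0 (by rw [h, C_0])), C_1] at this
  intro f hf
  by_contra hfN
  -- a linear form vanishing on `N` kills `(t z + 1)^b` for all `t`, hence all monomials
  obtain ⟨l, hlf, hlN⟩ := Submodule.exists_le_ker_of_notMem hfN
  have h2 : ∀ t : ZMod p, ∑ i ∈ Finset.range (b + 1),
      l (X ^ i) * (b.choose i : F) * primeHom p F t ^ i = 0 := by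
    intro t
    let g : GL (Fin 2) (ZMod p) := Matrix.GeneralLinearGroup.mkOfDetNeZero !![1, 0; t, 1] (by simp)
    have hg : g.1 = !![1, 0; t, 1] := rfl
    have h3 := hlN (hst g 1 h1)
    rw [polyAction_eq_homEval, hg, homEval_eq_sum, Finset.sum_eq_single 0] at h3
    · simp only [coeff_one_zero, map_one, pow_zero, one_mul, Nat.sub_zero, Matrix.map_apply,
        Matrix.of_apply, Matrix.cons_val', Matrix.cons_val_zero, Matrix.cons_val_one,
        Matrix.cons_val_fin_one] at h3
      rw [LinearMap.mem_ker, add_pow, map_sum] at h3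
      rw [← h3]
      refine Finset.sum_congr rfl fun i _ => ?_
      have h4 : (C (primeHom p F t) * X) ^ i * 1 ^ (b - i) * (b.choose i : F[X]) =
          ((b.choose i : F) * primeHom p F t ^ i) • X ^ i := by
        rw [smul_eq_C_mul, C_mul, C_pow, C_eq_natCast]; ring
      rw [h4, map_smul, smul_eq_mul]
      ring
    · intro i _ hi
      rw [coeff_one, if_neg hi]; simp
    · simp
  have h3 : (∑ i ∈ Finset.range (b + 1), C (l (X ^ i) * (b.choose i : F)) * X ^ i : F[X]) = C 0 := by
    refine eq_C_of_forall_eval p (lt_of_le_of_lt ?_ hb) fun t => ?_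
    · refine natDegree_sum_le_of_forall_le _ _ fun i hi => (natDegree_C_mul_X_pow_le _ _).trans ?_
      exact Nat.lt_succ_iff.1 (Finset.mem_range.1 hi)
    · rw [eval_finsetSum]
      simpa using h2 t
  have h4 : ∀ i ∈ Finset.range (b + 1), l (X ^ i) = 0 := by
    intro i hi
    have := congrArg (fun q => coeff q i) h3
    simp only [finsetSum_coeff, coeff_C_mul, coeff_X_pow, C_0, coeff_zero] at this
    rw [Finset.sum_eq_single i (fun j _ hj => by rw [if_neg hj.symm, mul_zero])
      (fun h => absurd hi h), if_pos rfl, mul_one, mul_eq_zero] at this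
    refine this.resolve_right fun h => ?_
    rw [CharP.cast_eq_zero_iff F p] at h
    have hib := Nat.lt_succ_iff.1 (Finset.mem_range.1 hi)
    have hp := (Fact.out : p.Prime)
    exact absurd ((hp.dvd_factorial.1 ((h.mul_right _).mul_right _ |>.trans
      (dvd_of_eq (Nat.choose_mul_factorial_mul_factorial hib)))) ) (not_le.2 hb)
  refine hlf ?_
  rw [as_sum_range' f (b + 1) (Nat.lt_succ_of_le (natDegree_le_of_mem hf)), map_sum]
  refine Finset.sum_eq_zero fun i hi => ?_
  rw [← C_mul_X_pow_eq_monomial, ← smul_eq_C_mul, map_smul, h4 i hi, smul_zero]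

/-- Powers of all nonzero elements of `𝔽_p` agree exactly when the exponents agree modulo
`p - 1`. -/
lemma forall_primeHom_pow_eq_iff {i j : ℕ} :
    (∀ x : (ZMod p)ˣ, primeHom p F x ^ i = primeHom p F x ^ j) ↔ i ≡ j [MOD p - 1] := by
  have h1 : ∀ x : (ZMod p)ˣ, primeHom p F x ^ i = primeHom p F x ^ j ↔ x ^ i = x ^ j := by
    intro x
    rw [← map_pow, ← map_pow, (primeHom p F).injective.eq_iff, Units.ext_iff]
    simp
  simp only [h1]
  obtain ⟨ζ, hζ⟩ := IsCyclic.exists_generator (α := (ZMod p)ˣ)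
  have hord : orderOf ζ = p - 1 := by
    rw [orderOf_eq_card_of_forall_mem_zpowers hζ, Nat.card_eq_fintype_card, ZMod.card_units]
  constructor
  · intro h
    rw [← hord]
    exact pow_eq_pow_iff_modEq.1 (h ζ)
  · intro h x
    refine pow_eq_pow_iff_modEq.2 (h.of_dvd ?_)
    rw [← ZMod.card_units p]
    exact orderOf_dvd_card

end Weights

/-! ### Multiplicities of the Serre weights in the envelope -/

section Envelope

variable {p : ℕ} [Fact p.Prime] {F : Type*} [Field F] [CharP F p] {P : Type*} [AddCommGroup P]
  [Module (MonoidAlgebra F (GL (Fin 2) (ZMod p)))ᵐᵒᵖ P] [Module F P]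
  [IsScalarTower F (MonoidAlgebra F (GL (Fin 2) (ZMod p)))ᵐᵒᵖ P]

/-- The diagonal matrix with entries `α`, `δ`. -/
def diagUnits (α δ : (ZMod p)ˣ) : GL (Fin 2) (ZMod p) :=
  Matrix.GeneralLinearGroup.mkOfDetNeZero !![(α : ZMod p), 0; 0, (δ : ZMod p)] (by simp)

lemma diagUnits_val (α δ : (ZMod p)ˣ) :
    (diagUnits α δ).1 = !![(α : ZMod p), 0; 0, (δ : ZMod p)] := rfl

lemma polyAction_C (n : ℕ) (g : Matrix (Fin 2) (Fin 2) F) (c : F) :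
    polyAction n g (C c) = C c * (C (g 1 0) * X + C (g 1 1)) ^ n := by
  rw [polyAction, Finset.sum_eq_single 0]
  · simp
  · intro i _ hi; simp [coeff_C, hi]
  · simp

lemma polyAction_diagUnits_C (n : ℕ) (α δ : (ZMod p)ˣ) (c : F) :
    polyAction n ((diagUnits α δ).1.map (primeHom p F)) (C c) =
      C (primeHom p F δ ^ n * c) := by
  rw [polyAction_C, diagUnits_val, C_mul, mul_comm]
  simp

/-- The surjection from the envelope onto `Sym^a` as an equivariant linear map: a submodule that
maps onto `Sym^a` is the whole envelope. -/
lemma IsSerreEnvelope.exists_linear {a : ℕ} (hP : IsSerreEnvelope p a F P) :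
    ∃ f ∈ eqHom P ⊤ (weightAct p a 0) (degreeLT F (a + 1)),
      (∀ v ∈ degreeLT F (a + 1), ∃ x, f x = v) ∧
      ∀ N : Submodule (MonoidAlgebra F (GL (Fin 2) (ZMod p)))ᵐᵒᵖ P,
        (∀ x, ∃ y ∈ N, f (x - y) = 0) → N = ⊤ := by
  obtain ⟨_, f, hf, hsurj, hsup⟩ := hP
  have hf1 : ∀ (c : F) (x : P), (f (c • x) : F[X]) = c • (f x : F[X]) := by
    intro c x
    have h1 := hf c 1 x
    rw [op_single_smul, op_single_one_smul] at h1
    rw [h1, Units.val_one]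
    congr 1
    have h2 : (1 : Matrix (Fin 2) (Fin 2) (ZMod p)).map (fun y : ZMod p => (y.cast : F)) = 1 :=
      (primeHom p F).mapMatrix.map_one
    rw [h2, polyAction_one (natDegree_le_of_mem (f x).2)]
  refine ⟨{ toFun := fun x => (f x : F[X]), map_add' := fun x y => by simp, map_smul' := hf1 },
    ⟨fun x => (f x).2, fun g _ x => ?_⟩, fun v hv => ?_, fun N hN => hsup N ?_⟩
  · have h1 := hf 1 g x
    rw [one_smul] at h1
    refine h1.trans ?_
    rw [weightAct_apply, pow_zero, one_smul]
    rfl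
  · obtain ⟨x, hx⟩ := hsurj ⟨v, hv⟩
    exact ⟨x, congrArg Subtype.val hx⟩
  · rw [eq_top_iff]
    rintro x -
    obtain ⟨y, hy, hxy⟩ := hN x
    rw [← add_sub_cancel y x]
    exact AddSubgroup.add_mem_sup hy (Subtype.ext hxy)

/-- The kernel of an equivariant map is a submodule. -/
def eqHomKer {b m : ℕ} {N : Submodule F F[X]} {φ : P →ₗ[F] F[X]}
    (hφ : φ ∈ eqHom P ⊤ (weightAct p b m) N) :
    Submodule (MonoidAlgebra F (GL (Fin 2) (ZMod p)))ᵐᵒᵖ P where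
  carrier := {x | φ x = 0}
  add_mem' := fun {x y} hx hy => by
    rw [Set.mem_ofPred_eq] at *
    rw [map_add, hx, hy, add_zero]
  zero_mem' := map_zero φ
  smul_mem' := fun r x hx => by
    rw [Set.mem_ofPred_eq] at *
    rw [← op_unop r]
    generalize r.unop = r
    induction r using MonoidAlgebra.induction_linear with
    | zero => simp
    | add r s hr hs => rw [op_add, add_smul, map_add, hr, hs, add_zero]
    | single g c =>
      rw [op_single_smul, map_smul, hφ.2 g (Subgroup.mem_top g), hx, map_zero, smul_zero]

/-- Multiplicities of Serre weights in the cosocle of the projective envelope of `Sym^a`. -/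
theorem IsSerreEnvelope.finrank_eqHom_weight {a : ℕ} (hP : IsSerreEnvelope p a F P) (ha : 1 ≤ a)
    (ha' : a < p - 1) {b m : ℕ} (hb : b < p) :
    Module.finrank F (eqHom P ⊤ (weightAct p b m) (degreeLT F (b + 1))) =
      if b = a ∧ m ≡ 0 [MOD p - 1] then 1 else 0 := by
  obtain ⟨f, hf, hsurj, hsup⟩ := hP.exists_linear
  have hap : a < p := by omega
  -- an equivariant map vanishes on the kernel of the envelope
  have key1 : ∀ φ ∈ eqHom P ⊤ (weightAct p b m) (degreeLT F (b + 1)), ∀ x, f x = 0 → φ x = 0 := by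
    intro φ hφ x hx
    by_contra hφx
    have hN := degreeLT_le_of_stable p hb (N := (LinearMap.ker f).map φ)
      (by rintro _ ⟨y, _, rfl⟩; exact hφ.1 y)
      (by
        rintro g _ ⟨y, hy, rfl⟩
        refine polyAction_mem_of_weightAct_mem p (m := m) ?_
        refine ⟨_, ?_, hφ.2 g (Subgroup.mem_top g) y⟩
        change f _ = 0
        rw [hf.2 g (Subgroup.mem_top g), LinearMap.mem_ker.1 hy, map_zero])
      (Submodule.ne_bot_iff _ |>.2 ⟨_, ⟨x, hx, rfl⟩, hφx⟩)
    have htop := hsup (eqHomKer hφ) fun x => by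
      obtain ⟨y, hy, hyx⟩ := hN (hφ.1 x)
      refine ⟨x - y, ?_, by rw [sub_sub_cancel]; exact hy⟩
      change φ (x - y) = 0
      rw [map_sub, hyx, sub_self]
    exact hφx (htop.symm ▸ Submodule.mem_top : x ∈ eqHomKer hφ)
  obtain ⟨x₀, hx₀⟩ := hsurj 1 (mem_of_natDegree_le (by simp))
  have key2 : ∀ φ ∈ eqHom P ⊤ (weightAct p b m) (degreeLT F (b + 1)), φ x₀ = 0 → φ = 0 := by
    intro φ hφ h0
    have hN := degreeLT_le_of_stable p hap (N := (LinearMap.ker φ).map f)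
      (by rintro _ ⟨y, _, rfl⟩; exact hf.1 y)
      (by
        rintro g _ ⟨y, hy, rfl⟩
        refine polyAction_mem_of_weightAct_mem p (m := 0) ?_
        refine ⟨_, ?_, hf.2 g (Subgroup.mem_top g) y⟩
        change φ _ = 0
        rw [hφ.2 g (Subgroup.mem_top g), LinearMap.mem_ker.1 hy, map_zero])
      (Submodule.ne_bot_iff _ |>.2 ⟨_, ⟨x₀, h0, rfl⟩, by rw [hx₀]; exact one_ne_zero⟩)
    ext1 x
    obtain ⟨y, hy, hyx⟩ := hN (hf.1 x)
    have := key1 φ hφ (x - y) (by rw [map_sub, hyx, sub_self])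
    rw [map_sub, LinearMap.mem_ker.1 hy, sub_zero] at this
    exact this
  -- the image of a highest weight vector is a highest weight vector
  have key3 : ∀ φ ∈ eqHom P ⊤ (weightAct p b m) (degreeLT F (b + 1)), ∃ c, φ x₀ = C c := by
    intro φ hφ
    have hdeg := natDegree_le_of_mem (hφ.1 x₀)
    refine ⟨_, eq_C_of_translation_invariant p (hdeg.trans_lt hb) fun t => ?_⟩
    rw [← polyAction_translation p hdeg]
    have h1 := hφ.2 (translation p t) (Subgroup.mem_top _) x₀
    have h2 := hf.2 (translation p t) (Subgroup.mem_top _) x₀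
    rw [hx₀, weightAct_apply, pow_zero, one_smul, polyAction_translation p (by simp), one_comp,
      ← hx₀, ← sub_eq_zero, ← map_sub] at h2
    have h3 := key1 φ hφ _ h2
    rw [map_sub, sub_eq_zero, h1, weightAct_apply] at h3
    have hdet : (translation p t).1.det = 1 := by simp [translation_val]
    rwa [hdet, map_one, one_pow, one_smul] at h3
  have key4 : ∀ φ ∈ eqHom P ⊤ (weightAct p b m) (degreeLT F (b + 1)), ∀ c, φ x₀ = C c → c ≠ 0 →
      b = a ∧ m ≡ 0 [MOD p - 1] := by
    intro φ hφ c hc hc0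
    have h1 : ∀ α δ : (ZMod p)ˣ, primeHom p F δ ^ a =
        (primeHom p F α * primeHom p F δ) ^ m * primeHom p F δ ^ b := by
      intro α δ
      have h1 := hφ.2 (diagUnits α δ) (Subgroup.mem_top _) x₀
      have h2 := hf.2 (diagUnits α δ) (Subgroup.mem_top _) x₀
      have hdet : (diagUnits α δ).1.det = α * δ := by simp [diagUnits_val]
      rw [hx₀, weightAct_apply, pow_zero, one_smul, ← C_1, polyAction_diagUnits_C] at h2
      rw [hc, weightAct_apply, polyAction_diagUnits_C, hdet, map_mul, smul_C, smul_eq_mul] at h1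
      have h3 : f (op (MonoidAlgebra.single (diagUnits α δ) (1 : F)) • x₀ -
          primeHom p F δ ^ a • x₀) = 0 := by
        rw [map_sub, h2, map_smul, hx₀, smul_eq_C_mul, mul_one, mul_one, sub_self]
      have h4 := key1 φ hφ _ h3
      rw [map_sub, h1, map_smul, hc, smul_C, smul_eq_mul, sub_eq_zero, C_inj] at h4
      apply mul_right_cancel₀ hc0
      rw [← h4]; ring
    have hm : m ≡ 0 [MOD p - 1] := by
      refine (forall_primeHom_pow_eq_iff p (F := F)).1 fun x => ?_
      have := h1 x 1
      simp only [Units.val_one, map_one, one_pow, mul_one] at this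
      rw [pow_zero, ← this]
    have hab : a ≡ b [MOD p - 1] := by
      refine (forall_primeHom_pow_eq_iff p (F := F)).1 fun x => ?_
      have h2 := h1 1 x
      have h3 := (forall_primeHom_pow_eq_iff p (F := F)).2 hm x
      rw [Units.val_one, map_one, one_mul, h3, pow_zero, one_mul] at h2
      exact h2
    refine ⟨?_, hm⟩
    rcases Nat.lt_or_ge b (p - 1) with h | h
    · exact ((Nat.ModEq.eq_of_lt_of_lt hab ha' h)).symm
    · have : b = p - 1 := by omega
      rw [this, Nat.modEq_iff_dvd' (by omega)] at hab
      have h5 := Nat.le_of_dvd (by omega) hab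
      omega
  split_ifs with hcond
  · obtain ⟨rfl, hm⟩ := hcond
    have hf' : f ∈ eqHom P ⊤ (weightAct p b m) (degreeLT F (b + 1)) := by
      refine ⟨hf.1, fun g hg x => ?_⟩
      have hm' : primeHom p F g.1.det ^ m = 1 :=
        ((forall_primeHom_pow_eq_iff p (F := F)).2 hm g.det).trans (pow_zero _)
      rw [hf.2 g hg, weightAct_apply, weightAct_apply, pow_zero, hm']
    refine finrank_eq_one (⟨f, hf'⟩ : eqHom P ⊤ (weightAct p b m) (degreeLT F (b + 1))) ?_ ?_
    · intro h
      have h1 := LinearMap.congr_fun (congrArg Subtype.val h) x₀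
      exact one_ne_zero (hx₀.symm.trans h1)
    · rintro ⟨φ, hφ⟩
      obtain ⟨c, hc⟩ := key3 φ hφ
      refine ⟨c, Subtype.ext ?_⟩
      refine sub_eq_zero.1 (key2 _ (Submodule.sub_mem _ (Submodule.smul_mem _ c hf') hφ) ?_)
      change c • f x₀ - φ x₀ = 0
      rw [hx₀, hc, smul_eq_C_mul, mul_one, sub_self]
  · have : Subsingleton (eqHom P ⊤ (weightAct p b m) (degreeLT F (b + 1))) := by
      refine subsingleton_of_forall_eq 0 ?_
      rintro ⟨φ, hφ⟩
      obtain ⟨c, hc⟩ := key3 φ hφ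
      refine Subtype.ext (key2 φ hφ ?_)
      by_cases hc0 : c = 0
      · rw [hc, hc0, C_0]
      · exact absurd (key4 φ hφ c hc hc0) hcond
    exact Module.finrank_zero_of_subsingleton

end Envelope

/-! ### Homogeneous functions on the plane over `𝔽_p` -/

section HomogeneousFunctions

variable (p : ℕ) [Fact p.Prime] (F : Type*) [Field F] [CharP F p]

/-- Functions on the plane over `𝔽_p` which are homogeneous of degree `b`: the induction of a
character of the Borel subgroup. -/
def homogFun (b : ℕ) : Submodule F ((Fin 2 → ZMod p) → F) where
  carrier := {φ | ∀ (c : ZMod p) (v : Fin 2 → ZMod p), φ (c • v) = primeHom p F c ^ b * φ v}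
  add_mem' := fun {φ ψ} hφ hψ c v => by rw [Pi.add_apply, hφ c v, hψ c v, Pi.add_apply, mul_add]
  zero_mem' := fun c v => by simp
  smul_mem' := fun r φ hφ c v => by
    rw [Pi.smul_apply, hφ c v, Pi.smul_apply, smul_eq_mul, smul_eq_mul, mul_left_comm]

variable {F}

/-- The right action of `GL₂(𝔽_p)` on functions on the plane, twisted by `det^m`. -/
def funAct (m : ℕ) (g : GL (Fin 2) (ZMod p)) : Module.End F ((Fin 2 → ZMod p) → F) :=
  primeHom p F g.1.det ^ m • LinearMap.funLeft F F g.1.mulVec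

lemma funAct_apply (m : ℕ) (g : GL (Fin 2) (ZMod p)) (φ : (Fin 2 → ZMod p) → F)
    (v : Fin 2 → ZMod p) :
    funAct p m g φ v = primeHom p F g.1.det ^ m * φ (g.1.mulVec v) := rfl

lemma isStable_funAct (J : Subgroup (GL (Fin 2) (ZMod p))) (b m : ℕ) :
    IsStable J (funAct (F := F) p m) (homogFun p F b) where
  mem := fun g _ φ hφ c v => by
    rw [funAct_apply, funAct_apply, Matrix.mulVec_smul, hφ, mul_left_comm]
  mul := fun g _ h _ φ _ => by
    ext v
    simp only [funAct_apply, Units.val_mul, Matrix.det_mul, map_mul, mul_pow, Matrix.mulVec_mulVec]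
    ring

lemma homogFun_ext {b : ℕ} {φ ψ : (Fin 2 → ZMod p) → F} (hφ : φ ∈ homogFun p F b)
    (hψ : ψ ∈ homogFun p F b) (h : ∀ t : ZMod p, φ ![t, 1] = ψ ![t, 1])
    (h' : φ ![1, 0] = ψ ![1, 0]) : φ = ψ := by
  ext v
  by_cases hv : v 1 = 0
  · have : v = v 0 • ![1, 0] := by
      ext i; fin_cases i <;> simp [hv]
    rw [this, hφ, hψ, h']
  · have : v = v 1 • ![v 0 / v 1, 1] := by
      ext i; fin_cases i <;> simp [mul_div_cancel₀, hv]
    rw [this, hφ, hψ, h]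

variable (F) in
/-- The function on the plane defined by a binary form. -/
def evalFun (b : ℕ) : F[X] →ₗ[F] ((Fin 2 → ZMod p) → F) where
  toFun := fun f v => homEval b f (primeHom p F (v 0)) (primeHom p F (v 1))
  map_add' := fun _ _ => funext fun _ => homEval_add _ _ _ _ _
  map_smul' := fun _ _ => funext fun _ => homEval_smul _ _ _ _ _

lemma evalFun_apply (b : ℕ) (f : F[X]) (v : Fin 2 → ZMod p) :
    evalFun p F b f v = homEval b f (primeHom p F (v 0)) (primeHom p F (v 1)) := rfl

lemma evalFun_weightAct (b m : ℕ) (g : GL (Fin 2) (ZMod p)) (f : F[X]) :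
    evalFun p F b (weightAct p b m g f) = funAct p m g (evalFun p F b f) := by
  ext v
  rw [weightAct_apply, map_smul, Pi.smul_apply, evalFun_apply, homEval_polyAction, funAct_apply,
    evalFun_apply, smul_eq_mul]
  simp [Matrix.mulVec, dotProduct, Fin.sum_univ_two]

lemma evalFun_mem (b : ℕ) (f : F[X]) : evalFun p F b f ∈ homogFun p F b := by
  intro c v
  rw [evalFun_apply, evalFun_apply, ← homEval_smul_smul]
  simp

lemma evalFun_one {b : ℕ} {f : F[X]} (hf : f.natDegree ≤ b) (t : ZMod p) :
    evalFun p F b f ![t, 1] = f.eval (primeHom p F t) := by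
  have := homEval_one_right hf (primeHom p F t)
  simpa [evalFun_apply, aeval_def, eval₂_eq_eval_map] using this

lemma evalFun_one_zero (b : ℕ) (f : F[X]) : evalFun p F b f ![1, 0] = f.coeff b := by
  have := homEval_one_zero (A := F) b f
  simpa [evalFun_apply] using this

lemma primeHom_pow_card (t : ZMod p) : primeHom p F t ^ p = primeHom p F t := by
  rw [← map_pow, ZMod.pow_card]

/-- For `b ≥ p`, every homogeneous function of degree `b` is given by a binary form. -/
lemma exists_evalFun_eq {b : ℕ} (hb : p ≤ b) {φ : (Fin 2 → ZMod p) → F}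
    (hφ : φ ∈ homogFun p F b) : ∃ f ∈ degreeLT F (b + 1), evalFun p F b f = φ := by
  classical
  have hp := (Fact.out : p.Prime).two_le
  let f₀ : F[X] := Lagrange.interpolate Finset.univ (primeHom p F) fun t => φ ![t, 1]
  have hinj : Set.InjOn (primeHom p F) (Finset.univ : Finset (ZMod p)) :=
    (primeHom p F).injective.injOn
  have hf₀ : f₀.degree < p := by
    have := Lagrange.degree_interpolate_lt (fun t => φ ![t, 1]) hinj
    rwa [Finset.card_univ, ZMod.card] at this
  have hd₀ : f₀.natDegree ≤ b :=
    natDegree_le_of_degree_le (hf₀.le.trans (by exact_mod_cast hb))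
  have hd : (f₀ + C (φ ![1, 0]) * (X ^ b - X ^ (b - p + 1))).natDegree ≤ b := by
    refine (natDegree_add_le _ _).trans (max_le hd₀ ((natDegree_C_mul_le _ _).trans ?_))
    refine (natDegree_sub_le _ _).trans (max_le ?_ ?_)
    · rw [natDegree_X_pow]
    · rw [natDegree_X_pow]; omega
  refine ⟨_, mem_of_natDegree_le hd, homogFun_ext p (evalFun_mem p b _) hφ (fun t => ?_) ?_⟩
  · rw [evalFun_one p hd, eval_add, Lagrange.eval_interpolate_at_node _ hinj (Finset.mem_univ t)]
    have : primeHom p F t ^ b = primeHom p F t ^ (b - p + 1) := by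
      conv_lhs => rw [← Nat.sub_add_cancel hb, pow_add, primeHom_pow_card]
      rw [pow_succ]
    simp [this]
  · rw [evalFun_one_zero, coeff_add, coeff_eq_zero_of_degree_lt
      (hf₀.trans_le (by exact_mod_cast hb)), coeff_C_mul, coeff_sub, coeff_X_pow_self,
      coeff_X_pow, if_neg (by omega)]
    ring

/-- Binary forms vanishing on the rational points of the plane are multiples of `z^p - z`. -/
lemma exists_eq_mul_of_evalFun_eq_zero {b : ℕ} (hb : p ≤ b) {f : F[X]}
    (hf : f ∈ degreeLT F (b + 1)) (h : evalFun p F b f = 0) :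
    ∃ q ∈ degreeLT F (b - p), f = (X ^ p - X) * q := by
  have hp := (Fact.out : p.Prime).two_le
  have hmonic : (X ^ p - X : F[X]).Monic := monic_X_pow_sub (by rw [degree_X]; exact_mod_cast hp)
  have hdeg : (X ^ p - X : F[X]).degree = p := by
    rw [degree_sub_eq_left_of_degree_lt (by rw [degree_X, degree_X_pow]; exact_mod_cast hp),
      degree_X_pow]
  have hr : f %ₘ (X ^ p - X) = C 0 := by
    refine eq_C_of_forall_eval p ?_ fun t => ?_
    · refine (natDegree_modByMonic_lt f hmonic fun h1 => ?_).trans_eq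
        (natDegree_eq_of_degree_eq_some hdeg)
      rw [h1, degree_one] at hdeg
      have h2 : 0 = p := by exact_mod_cast hdeg
      omega
    · have h1 := congrFun h ![t, 1]
      rw [evalFun_one p (natDegree_le_of_mem hf), Pi.zero_apply] at h1
      have h2 := congrArg (eval (primeHom p F t)) (modByMonic_add_div f (X ^ p - X))
      rw [eval_add, eval_mul, eval_sub, eval_pow, eval_X, primeHom_pow_card, sub_self, zero_mul,
        add_zero, h1] at h2
      exact h2
  have hfq : f = (X ^ p - X) * (f /ₘ (X ^ p - X)) := by
    have := modByMonic_add_div f (X ^ p - X)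
    rw [hr, C_0, zero_add] at this
    exact this.symm
  refine ⟨f /ₘ (X ^ p - X), ?_, hfq⟩
  by_cases hq : f /ₘ (X ^ p - X) = 0
  · rw [hq]; exact Submodule.zero_mem _
  have h2 : f.natDegree = p + (f /ₘ (X ^ p - X)).natDegree := by
    have := congrArg natDegree hfq
    rwa [natDegree_mul hmonic.ne_zero hq, natDegree_eq_of_degree_eq_some hdeg] at this
  have hf0 : f ≠ 0 := by
    intro h3
    exact hq (by rw [h3, zero_divByMonic])
  have h3 : f.natDegree ≠ b := by
    intro h3
    have h4 := congrFun h ![1, 0]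
    rw [evalFun_one_zero, Pi.zero_apply, ← h3] at h4
    exact hf0 (leadingCoeff_eq_zero.1 h4)
  have h4 := natDegree_le_of_mem hf
  rw [mem_degreeLT, degree_eq_natDegree hq]
  exact_mod_cast (by omega : (f /ₘ (X ^ p - X)).natDegree < b - p)

/-- Multiplication by the invariant `z^p - z` raises the weight by `p + 1` and untwists. -/
lemma weightAct_mul_dickson {c m : ℕ} (g : GL (Fin 2) (ZMod p)) {f : F[X]}
    (hf : f ∈ degreeLT F (c + 1)) :
    (X ^ p - X) * weightAct p c (m + 1) g f = weightAct p (p + 1 + c) m g ((X ^ p - X) * f) := by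
  have hp := (Fact.out : p.Prime).two_le
  have hd : (X ^ p - X : F[X]).natDegree ≤ p + 1 := by
    refine (natDegree_sub_le _ _).trans (max_le ?_ ?_)
    · rw [natDegree_X_pow]; omega
    · rw [natDegree_X]; omega
  rw [weightAct_apply, weightAct_apply, polyAction_eq_homEval (p + 1 + c),
    homEval_mul hd (natDegree_le_of_mem hf), ← polyAction_eq_homEval, ← polyAction_eq_homEval]
  have h1 : polyAction (p + 1) (g.1.map (primeHom p F)) (X ^ p - X : F[X]) =
      C (primeHom p F g.1.det) * (X ^ p - X) := by
    rw [polyAction_eq_homEval]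
    have h2 : ∀ u v : F[X], homEval (p + 1) (X ^ p - X : F[X]) u v = u ^ p * v - u * v ^ p := by
      intro u v
      rw [sub_eq_add_neg, ← neg_one_smul F, homEval_add, homEval_smul, homEval_eq_sum,
        homEval_eq_sum, Finset.sum_eq_single p, Finset.sum_eq_single 1]
      · simp; ring
      · intro i _ hi; simp [coeff_X, hi.symm]
      · intro h; simp at h
      · intro i _ hi; simp [coeff_X_pow, hi]
      · intro h; simp at h
    have h3 : ∀ x y : ZMod p, (C (primeHom p F x) * X + C (primeHom p F y)) ^ p =
        C (primeHom p F x) * X ^ p + C (primeHom p F y) := by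
      intro x y
      rw [add_pow_char, mul_pow, ← C_pow, ← C_pow, primeHom_pow_card, primeHom_pow_card]
    rw [h2]
    simp only [Matrix.map_apply, h3, Matrix.det_fin_two, map_sub, map_mul]
    ring
  rw [h1, smul_eq_C_mul, smul_eq_C_mul, pow_succ, C_mul]
  ring

end HomogeneousFunctions

/-! ### The Borel subgroup and Frobenius reciprocity -/

section Borel

variable (p : ℕ) [Fact p.Prime] (F : Type*) [Field F] [CharP F p]

/-- The upper triangular Borel subgroup of `GL₂(𝔽_p)`. -/
def borel : Subgroup (GL (Fin 2) (ZMod p)) where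
  carrier := {g | g.1 1 0 = 0}
  mul_mem' := fun {g h} hg hh => by
    change (g.1 * h.1) 1 0 = 0
    rw [Matrix.mul_apply, Fin.sum_univ_two, show g.1 1 0 = 0 from hg, show h.1 1 0 = 0 from hh]
    simp
  one_mem' := by change (1 : Matrix (Fin 2) (Fin 2) (ZMod p)) 1 0 = 0; simp
  inv_mem' := fun {g} hg => by
    change (g⁻¹).1 1 0 = 0
    rw [Matrix.coe_units_inv, Matrix.inv_def, Matrix.adjugate_fin_two]
    simp [show g.1 1 0 = 0 from hg]

variable {p} in
lemma mem_borel {g : GL (Fin 2) (ZMod p)} : g ∈ borel p ↔ g.1 1 0 = 0 := Iff.rfl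

/-- The character `α^i δ^j` of the Borel subgroup. -/
def borelChar (i j : ℕ) (g : GL (Fin 2) (ZMod p)) : Module.End F F :=
  (primeHom p F (g.1 0 0) ^ i * primeHom p F (g.1 1 1) ^ j) • LinearMap.id

lemma borelChar_apply (i j : ℕ) (g : GL (Fin 2) (ZMod p)) (c : F) :
    borelChar p F i j g c = primeHom p F (g.1 0 0) ^ i * primeHom p F (g.1 1 1) ^ j * c := rfl

variable {p F}

lemma det_of_mem_borel {g : GL (Fin 2) (ZMod p)} (hg : g ∈ borel p) :
    g.1.det = g.1 0 0 * g.1 1 1 := by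
  rw [Matrix.det_fin_two, mem_borel.1 hg]; ring

lemma borelChar_congr {i i' j j' : ℕ} (hi : i ≡ i' [MOD p - 1]) (hj : j ≡ j' [MOD p - 1])
    {g : GL (Fin 2) (ZMod p)} (hg : g ∈ borel p) : borelChar p F i j g = borelChar p F i' j' g := by
  have hdet := g.det.ne_zero
  rw [show ((Matrix.GeneralLinearGroup.det g : (ZMod p)ˣ) : ZMod p) = g.1.det from rfl,
    det_of_mem_borel hg, mul_ne_zero_iff] at hdet
  have h0 := (forall_primeHom_pow_eq_iff p (F := F)).2 hi (Units.mk0 _ hdet.1)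
  have h1 := (forall_primeHom_pow_eq_iff p (F := F)).2 hj (Units.mk0 _ hdet.2)
  rw [Units.val_mk0] at h0 h1
  rw [borelChar, borelChar, h0, h1]

/-- `GL₂(𝔽_p)` acts transitively on the nonzero vectors. -/
lemma exists_mulVec_eq {v : Fin 2 → ZMod p} (hv : v ≠ 0) :
    ∃ g : GL (Fin 2) (ZMod p), g.1.mulVec ![1, 0] = v := by
  by_cases h : v 0 = 0
  · have h1 : v 1 ≠ 0 := fun h1 => hv (by ext i; fin_cases i <;> simp [h, h1])
    refine ⟨Matrix.GeneralLinearGroup.mkOfDetNeZero !![0, 1; v 1, 0] (by simpa using h1), ?_⟩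
    change (!![0, 1; v 1, 0] : Matrix _ _ _).mulVec ![1, 0] = v
    ext i; fin_cases i <;> simp [h]
  · refine ⟨Matrix.GeneralLinearGroup.mkOfDetNeZero !![v 0, 0; v 1, 1] (by simpa using h), ?_⟩
    change (!![v 0, 0; v 1, 1] : Matrix _ _ _).mulVec ![1, 0] = v
    ext i; fin_cases i <;> simp

variable {P : Type*} [AddCommGroup P]
  [Module (MonoidAlgebra F (GL (Fin 2) (ZMod p)))ᵐᵒᵖ P] [Module F P]
  [IsScalarTower F (MonoidAlgebra F (GL (Fin 2) (ZMod p)))ᵐᵒᵖ P]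

lemma apply_mulVec_basis (g : Matrix (Fin 2) (Fin 2) (ZMod p)) :
    g.mulVec ![1, 0] = ![g 0 0, g 1 0] := by
  ext i; fin_cases i <;> simp [Matrix.mulVec, dotProduct, Fin.sum_univ_two]

/-- Frobenius reciprocity for the Borel subgroup. -/
lemma finrank_eqHom_homogFun {b : ℕ} (hb : b ≠ 0) (m : ℕ) :
    Module.finrank F (eqHom P ⊤ (funAct p m) (homogFun p F b)) =
      Module.finrank F (eqHom P (borel p) (borelChar p F (b + m) m) ⊤) := by
  let ev : (P →ₗ[F] ((Fin 2 → ZMod p) → F)) →ₗ[F] (P →ₗ[F] F) :=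
    LinearMap.compRight F (LinearMap.proj ![1, 0])
  have hev : ∀ φ x, ev φ x = φ x ![1, 0] := fun _ _ => rfl
  have hmem : ∀ φ ∈ eqHom P ⊤ (funAct p m) (homogFun p F b),
      ev φ ∈ eqHom P (borel p) (borelChar p F (b + m) m) ⊤ := by
    intro φ hφ
    refine ⟨fun _ => Submodule.mem_top, fun g hg x => ?_⟩
    rw [hev, hev, hφ.2 g (Subgroup.mem_top g), funAct_apply, borelChar_apply, det_of_mem_borel hg,
      apply_mulVec_basis, mem_borel.1 hg, map_mul, mul_pow, pow_add]
    have := hφ.1 x (g.1 0 0) ![1, 0]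
    rw [show g.1 0 0 • (![1, 0] : Fin 2 → ZMod p) = ![g.1 0 0, 0] by simp] at this
    rw [this]; ring
  refine (LinearEquiv.ofBijective (ev.restrict hmem) ⟨?_, ?_⟩).finrank_eq
  · rw [injective_iff_map_eq_zero]
    rintro ⟨φ, hφ⟩ h0
    have h1 : ∀ x, φ x ![1, 0] = 0 := fun x => LinearMap.congr_fun (congrArg Subtype.val h0) x
    refine Subtype.ext (LinearMap.ext fun x => funext fun v => ?_)
    change φ x v = 0
    by_cases hv : v = 0
    · have := hφ.1 x 0 v
      rwa [zero_smul, map_zero, zero_pow hb, zero_mul, ← hv] at this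
    · obtain ⟨g, rfl⟩ := exists_mulVec_eq hv
      have h2 := h1 (op (MonoidAlgebra.single g (1 : F)) • x)
      rw [hφ.2 g (Subgroup.mem_top g), funAct_apply] at h2
      exact (mul_eq_zero.1 h2).resolve_left (pow_ne_zero _ (primeHom_det_ne_zero p g))
  · rintro ⟨ψ, hψ⟩
    have hex : ∀ v : Fin 2 → ZMod p, ∃ g : GL (Fin 2) (ZMod p), v ≠ 0 → g.1.mulVec ![1, 0] = v :=
      fun v => by
        by_cases hv : v = 0
        · exact ⟨1, fun h => absurd hv h⟩
        · obtain ⟨g, hg⟩ := exists_mulVec_eq hv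
          exact ⟨g, fun _ => hg⟩
    choose γ hγ using hex
    -- the value at `v ≠ 0` does not depend on the matrix moving the base point to `v`
    have hval : ∀ (g h : GL (Fin 2) (ZMod p)) (c : ZMod p) (x : P),
        h.1.mulVec ![1, 0] = c • g.1.mulVec ![1, 0] →
        (primeHom p F h.1.det ^ m)⁻¹ * ψ (op (MonoidAlgebra.single h (1 : F)) • x) =
          primeHom p F c ^ b *
            ((primeHom p F g.1.det ^ m)⁻¹ * ψ (op (MonoidAlgebra.single g (1 : F)) • x)) := by
      intro g h c x hgh
      have h1 : (g⁻¹ * h).1.mulVec ![1, 0] = ![c, 0] := by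
        rw [Units.val_mul, ← Matrix.mulVec_mulVec, hgh, Matrix.mulVec_smul, Matrix.mulVec_mulVec,
          ← Units.val_mul, inv_mul_cancel, Units.val_one, Matrix.one_mulVec]
        simp
      rw [apply_mulVec_basis] at h1
      have hk : g⁻¹ * h ∈ borel p := congrFun h1 1
      have hk0 : (g⁻¹ * h).1 0 0 = c := congrFun h1 0
      have hh : h = g * (g⁻¹ * h) := by group
      have hdet : primeHom p F h.1.det =
          primeHom p F g.1.det * (primeHom p F c * primeHom p F ((g⁻¹ * h).1 1 1)) := by
        conv_lhs => rw [hh, Units.val_mul, Matrix.det_mul, det_of_mem_borel hk, hk0]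
        rw [map_mul, map_mul]
      have h2 := primeHom_det_ne_zero p (F := F) h
      rw [hdet] at h2
      have h3 := left_ne_zero_of_mul h2
      have h4 := right_ne_zero_of_mul h2
      have h5 : ψ (op (MonoidAlgebra.single h (1 : F)) • x) =
          primeHom p F c ^ (b + m) * primeHom p F ((g⁻¹ * h).1 1 1) ^ m *
            ψ (op (MonoidAlgebra.single g (1 : F)) • x) := by
        conv_lhs => rw [hh]
        rw [op_single_mul_smul, hψ.2 _ hk, borelChar_apply, hk0]
      rw [h5, hdet]
      have h6 := left_ne_zero_of_mul h4
      have h7 := right_ne_zero_of_mul h4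
      rw [mul_pow, mul_pow, pow_add]
      field_simp
    let φ : P →ₗ[F] ((Fin 2 → ZMod p) → F) := LinearMap.pi fun v =>
      (if v = 0 then 0 else (primeHom p F (γ v).1.det ^ m)⁻¹) •
        (ψ ∘ₗ
          { toFun := fun x => op (MonoidAlgebra.single (γ v) (1 : F)) • x
            map_add' := fun x y => smul_add _ x y
            map_smul' := fun c x => op_single_smul_smul (γ v) c x })
    have hφ : ∀ x v, φ x v = (if v = 0 then 0 else (primeHom p F (γ v).1.det ^ m)⁻¹) *
        ψ (op (MonoidAlgebra.single (γ v) (1 : F)) • x) := fun _ _ => rfl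
    have hφ0 : ∀ x, φ x 0 = 0 := fun x => by rw [hφ, if_pos rfl, zero_mul]
    have hφ1 : ∀ x (g : GL (Fin 2) (ZMod p)), φ x (g.1.mulVec ![1, 0]) =
        (primeHom p F g.1.det ^ m)⁻¹ * ψ (op (MonoidAlgebra.single g (1 : F)) • x) := by
      intro x g
      have hne : g.1.mulVec ![1, 0] ≠ 0 := by
        intro h
        have h1 := congrArg (g⁻¹).1.mulVec h
        rw [Matrix.mulVec_mulVec, ← Units.val_mul, inv_mul_cancel, Units.val_one,
          Matrix.one_mulVec, Matrix.mulVec_zero] at h1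
        exact one_ne_zero (congrFun h1 0)
      rw [hφ, if_neg hne, hval g (γ _) 1 x (by rw [one_smul, hγ _ hne]), map_one, one_pow, one_mul]
    refine ⟨⟨φ, fun x c v => ?_, fun g _ x => funext fun v => ?_⟩,
      Subtype.ext (LinearMap.ext fun x => ?_)⟩
    · by_cases hv : v = 0
      · rw [hv, smul_zero, hφ0, mul_zero]
      by_cases hc : c = 0
      · rw [hc, zero_smul, hφ0, map_zero, zero_pow hb, zero_mul]
      · obtain ⟨h, hh⟩ := exists_mulVec_eq (smul_ne_zero hc hv)
        obtain ⟨g, rfl⟩ := exists_mulVec_eq hv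
        rw [← hh, hφ1, hφ1, hval g h c x hh]
    · rw [funAct_apply]
      by_cases hv : v = 0
      · rw [hv, Matrix.mulVec_zero, hφ0, hφ0, mul_zero]
      · obtain ⟨h, rfl⟩ := exists_mulVec_eq hv
        rw [hφ1, Matrix.mulVec_mulVec, ← Units.val_mul, hφ1, op_single_mul_smul, Units.val_mul,
          Matrix.det_mul, map_mul, mul_pow, mul_inv]
        have := pow_ne_zero m (primeHom_det_ne_zero p (F := F) g)
        field_simp
    · change φ x ![1, 0] = ψ x
      have h1 := hφ1 x 1
      rw [Units.val_one, Matrix.one_mulVec, op_single_one_smul, Matrix.det_one, map_one, one_pow,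
        inv_one, one_mul] at h1
      exact h1

end Borel

/-! ### The recursion for symmetric powers -/

section Recursion

variable {p : ℕ} [Fact p.Prime] {F : Type*} [Field F] [CharP F p] {P : Type*} [AddCommGroup P]
  [Module (MonoidAlgebra F (GL (Fin 2) (ZMod p)))ᵐᵒᵖ P] [Module F P]
  [IsScalarTower F (MonoidAlgebra F (GL (Fin 2) (ZMod p)))ᵐᵒᵖ P] [Module.Finite F P]

instance finite_degreeLT (n : ℕ) : Module.Finite F (degreeLT F n) :=
  Module.Finite.equiv (degreeLTEquiv F n).symm

lemma finrank_degreeLT (n : ℕ) : Module.finrank F (degreeLT F n) = n := by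
  rw [(degreeLTEquiv F n).finrank_eq, Module.finrank_fin_fun]

/-- For `b ≥ p` evaluation on the plane maps `Sym^b` onto the homogeneous functions of degree
`b`. -/
lemma finrank_eqHom_evalFun (hP : Module.Projective (MonoidAlgebra F (GL (Fin 2) (ZMod p)))ᵐᵒᵖ P)
    {b : ℕ} (hb : p ≤ b) (m : ℕ) :
    Module.finrank F (eqHom P ⊤ (weightAct p b m) (degreeLT F (b + 1))) =
      Module.finrank F (eqHom P ⊤ (weightAct p b m)
        (degreeLT F (b + 1) ⊓ LinearMap.ker (evalFun p F b))) +
      Module.finrank F (eqHom P (borel p) (borelChar p F (b + m) m) ⊤) := by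
  have hp := (Fact.out : p.Prime).pos
  rw [← finrank_eqHom_homogFun (by omega)]
  exact finrank_eqHom_add hP (isStable_weightAct p ⊤ b m)
    (fun g _ f _ => evalFun_weightAct p b m g f) (fun f _ => evalFun_mem p b f)
    (fun φ hφ => exists_evalFun_eq p hb hφ)

/-- Multiplicities in `Sym^b` for `b > p`, reduced to smaller weights. -/
lemma finrank_eqHom_weight_add
    (hP : Module.Projective (MonoidAlgebra F (GL (Fin 2) (ZMod p)))ᵐᵒᵖ P) (c m : ℕ) :
    Module.finrank F (eqHom P ⊤ (weightAct p (p + 1 + c) m) (degreeLT F (p + 1 + c + 1))) =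
      Module.finrank F (eqHom P ⊤ (weightAct p c (m + 1)) (degreeLT F (c + 1))) +
      Module.finrank F (eqHom P (borel p) (borelChar p F (p + 1 + c + m) m) ⊤) := by
  have hp := (Fact.out : p.Prime).two_le
  have hX : (X ^ p - X : F[X]) ≠ 0 := FiniteField.X_pow_card_sub_X_ne_zero F hp
  have hdeg : (X ^ p - X : F[X]).natDegree ≤ p :=
    (natDegree_sub_le _ _).trans (max_le (natDegree_X_pow_le _) (natDegree_X_le.trans (by omega)))
  rw [finrank_eqHom_evalFun hP (by omega) m]
  congr 1
  symm
  refine finrank_eqHom_congr (π := LinearMap.mulLeft F (X ^ p - X)) hP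
    (isStable_weightAct p ⊤ c (m + 1)) (fun g _ f hf => weightAct_mul_dickson p g hf)
    (fun f hf => ⟨mem_of_natDegree_le ?_, ?_⟩) (fun f _ hf => ?_) (fun f hf => ?_)
  · have := natDegree_le_of_mem hf
    exact natDegree_mul_le.trans (by omega)
  · have hf := natDegree_le_of_mem hf
    have hd : ((X ^ p - X) * f).natDegree ≤ p + c := natDegree_mul_le.trans (by omega)
    refine homogFun_ext p (evalFun_mem p _ _) (Submodule.zero_mem _) (fun t => ?_) ?_
    · rw [LinearMap.mulLeft_apply, evalFun_one p (hd.trans (by omega))]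
      simp [primeHom_pow_card]
    · rw [LinearMap.mulLeft_apply, evalFun_one_zero, Pi.zero_apply,
        coeff_eq_zero_of_natDegree_lt (by omega)]
  · exact (mul_eq_zero.1 hf).resolve_left hX
  · obtain ⟨q, hq, rfl⟩ := exists_eq_mul_of_evalFun_eq_zero p (by omega) hf.1 hf.2
    exact ⟨q, by rwa [show p + 1 + c - p = c + 1 by omega] at hq, rfl⟩

/-- For `b = p` evaluation on the plane is bijective. -/
lemma finrank_eqHom_weight_p
    (hP : Module.Projective (MonoidAlgebra F (GL (Fin 2) (ZMod p)))ᵐᵒᵖ P) (m : ℕ) :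
    Module.finrank F (eqHom P ⊤ (weightAct p p m) (degreeLT F (p + 1))) =
      Module.finrank F (eqHom P (borel p) (borelChar p F (p + m) m) ⊤) := by
  rw [finrank_eqHom_evalFun hP le_rfl m]
  have : degreeLT F (p + 1) ⊓ LinearMap.ker (evalFun p F p) = ⊥ := by
    rw [eq_bot_iff]
    intro f hf
    obtain ⟨q, hq, rfl⟩ := exists_eq_mul_of_evalFun_eq_zero p le_rfl hf.1 hf.2
    rw [Nat.sub_self, mem_degreeLT, Nat.cast_zero, Nat.WithBot.lt_zero_iff, degree_eq_bot] at hq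
    rw [hq, mul_zero]
    exact Submodule.zero_mem _
  rw [this, finrank_eqHom_bot, zero_add]

variable (p F) in
/-- The map from functions on the plane to binary forms of degree `n` whose kernel, on homogeneous
functions of degree `p - 1 - n`, consists of the binary forms. -/
def pairing (n : ℕ) : ((Fin 2 → ZMod p) → F) →ₗ[F] F[X] :=
  Fintype.linearCombination F fun v =>
    (C (-primeHom p F (v 1)) * X + C (primeHom p F (v 0))) ^ n

lemma pairing_apply (n : ℕ) (φ : (Fin 2 → ZMod p) → F) :
    pairing p F n φ = ∑ v, φ v • (C (-primeHom p F (v 1)) * X + C (primeHom p F (v 0))) ^ n :=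
  Fintype.linearCombination_apply _ _ _

lemma pairing_mem (n : ℕ) (φ : (Fin 2 → ZMod p) → F) : pairing p F n φ ∈ degreeLT F (n + 1) := by
  rw [pairing_apply]
  exact Submodule.sum_mem _ fun v _ =>
    Submodule.smul_mem _ _ (mem_of_natDegree_le (natDegree_linear_pow_le _ _ _))

lemma homEval_linear_pow {A : Type*} [CommRing A] [Algebra F A] (u v : F) (n : ℕ) (x y : A) :
    homEval n ((C u * X + C v) ^ n) x y = (u • x + v • y) ^ n := by
  have := homEval_pow (natDegree_linear_le (a := u) (b := v)) x y n
  rwa [one_mul, homEval_linear] at this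

/-- The pairing is equivariant up to the twist by `det^r`, because `det^(n + r) = 1`. -/
lemma pairing_funAct {n r : ℕ} (hn : n + r = p - 1) (m : ℕ) (g : GL (Fin 2) (ZMod p))
    (φ : (Fin 2 → ZMod p) → F) :
    pairing p F n (funAct p m g φ) = weightAct p n (m + r) g (pairing p F n φ) := by
  have hd := primeHom_det_ne_zero p (F := F) g
  have hcard : primeHom p F g.1.det ^ (n + r) = 1 := by
    rw [hn, ← map_pow, ZMod.pow_card_sub_one_eq_one (fun h => hd (by rw [h, map_zero])), map_one]
  rw [pairing_apply, pairing_apply, weightAct_apply]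
  change _ = _ • polyActionₗ n _ _
  rw [map_sum, Finset.smul_sum]
  let e : (Fin 2 → ZMod p) ≃ (Fin 2 → ZMod p) :=
    { toFun := g.1.mulVec
      invFun := (g⁻¹).1.mulVec
      left_inv := fun v => by
        rw [Matrix.mulVec_mulVec, ← Units.val_mul, inv_mul_cancel, Units.val_one, Matrix.one_mulVec]
      right_inv := fun v => by
        rw [Matrix.mulVec_mulVec, ← Units.val_mul, mul_inv_cancel, Units.val_one,
          Matrix.one_mulVec] }
  refine Fintype.sum_equiv e _ _ fun v => ?_
  have hev : e v = g.1.mulVec v := rfl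
  have h0 : (g.1.mulVec v) 0 = g.1 0 0 * v 0 + g.1 0 1 * v 1 := by
    simp [Matrix.mulVec, dotProduct, Fin.sum_univ_two]
  have h1 : (g.1.mulVec v) 1 = g.1 1 0 * v 0 + g.1 1 1 * v 1 := by
    simp [Matrix.mulVec, dotProduct, Fin.sum_univ_two]
  have hlin : -primeHom p F (g.1.mulVec v 1) • (C (g.1.map (primeHom p F) 0 0) * X +
        C (g.1.map (primeHom p F) 0 1)) + primeHom p F (g.1.mulVec v 0) •
        (C (g.1.map (primeHom p F) 1 0) * X + C (g.1.map (primeHom p F) 1 1)) =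
      C (primeHom p F g.1.det) * (C (-primeHom p F (v 1)) * X + C (primeHom p F (v 0))) := by
    rw [h0, h1, Matrix.det_fin_two]
    simp only [Matrix.map_apply, smul_eq_C_mul, map_add, map_mul, map_neg, map_sub]
    ring
  rw [hev, funAct_apply, map_smul, polyActionₗ_apply, polyAction_eq_homEval, homEval_linear_pow,
    hlin, mul_pow, ← C_pow, ← smul_eq_C_mul (_ ^ n), smul_smul, smul_smul]
  congr 1
  rw [pow_add] at hcard ⊢
  linear_combination (-(primeHom p F g.1.det ^ m * φ (g.1.mulVec v))) * hcard

lemma sum_monomial_eq_zero {k l : ℕ} (h : k + l = p - 1) :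
    ∑ v : Fin 2 → ZMod p, primeHom p F (v 0) ^ k * primeHom p F (v 1) ^ l = 0 := by
  have hp := (Fact.out : p.Prime).two_le
  rw [← (finTwoArrowEquiv (ZMod p)).symm.sum_comp, Fintype.sum_prod_type]
  simp only [finTwoArrowEquiv_symm_apply, Matrix.cons_val_zero, Matrix.cons_val_one,
    ← Finset.mul_sum, ← Finset.sum_mul, ← map_pow, ← map_sum]
  by_cases hk : k < p - 1
  · rw [FiniteField.sum_pow_lt_card_sub_one (ZMod p) k (by rwa [ZMod.card]), map_zero, zero_mul]
  · rw [FiniteField.sum_pow_lt_card_sub_one (ZMod p) l (by rw [ZMod.card]; omega), map_zero,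
      mul_zero]

/-- The pairing vanishes on binary forms, because the sums over the plane of the monomials of
degree `p - 1` vanish. -/
lemma pairing_evalFun {n r : ℕ} (hn : n + r = p - 1) (f : F[X]) :
    pairing p F n (evalFun p F r f) = 0 := by
  rw [pairing_apply]
  have h1 : ∀ v : Fin 2 → ZMod p,
      evalFun p F r f v • (C (-primeHom p F (v 1)) * X + C (primeHom p F (v 0))) ^ n =
      ∑ i ∈ Finset.range (r + 1), ∑ j ∈ Finset.range (n + 1),
        (primeHom p F (v 0) ^ (i + (n - j)) * primeHom p F (v 1) ^ (r - i + j)) •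
          (C (f.coeff i * (n.choose j : F) * (-1) ^ j) * X ^ j) := by
    intro v
    rw [evalFun_apply, homEval_eq_sum, Finset.sum_smul]
    refine Finset.sum_congr rfl fun i _ => ?_
    rw [add_pow, Finset.smul_sum]
    refine Finset.sum_congr rfl fun j _ => ?_
    simp only [smul_eq_C_mul, Algebra.algebraMap_self_apply, C_mul, C_pow, C_neg, map_natCast,
      pow_add, mul_pow, C_1, neg_pow (C (primeHom p F (v 1)))]
    ring
  simp only [h1]
  rw [Finset.sum_comm]
  refine Finset.sum_eq_zero fun i hi => ?_
  rw [Finset.sum_comm]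
  refine Finset.sum_eq_zero fun j hj => ?_
  have hi := Finset.mem_range.1 hi
  have hj := Finset.mem_range.1 hj
  rw [← Finset.sum_smul, sum_monomial_eq_zero (by omega), zero_smul]

/-- The pairing is nonzero on a function supported on the line through `(1, 0)`. -/
lemma exists_pairing_ne_zero {n r : ℕ} (hn : n + r = p - 1) (hr : 1 ≤ r) :
    ∃ φ ∈ homogFun p F r, pairing p F n φ ≠ 0 := by
  classical
  have hp := (Fact.out : p.Prime).two_le
  refine ⟨fun v => if v 1 = 0 then primeHom p F (v 0) ^ r else 0, fun c v => ?_, fun h => ?_⟩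
  · by_cases hc : c = 0
    · simp [hc, zero_pow (by omega : r ≠ 0)]
    · simp only [Pi.smul_apply, smul_eq_mul, mul_eq_zero, hc, false_or, map_mul, mul_pow]
      split_ifs <;> simp
  · have h1 := congrArg (eval 0) h
    rw [pairing_apply, eval_finsetSum, eval_zero, ← (finTwoArrowEquiv (ZMod p)).symm.sum_comp,
      Fintype.sum_prod_type] at h1
    simp only [finTwoArrowEquiv_symm_apply, Matrix.cons_val_zero, Matrix.cons_val_one, eval_smul,
      eval_pow, eval_add, eval_mul, eval_C, eval_X, mul_zero, zero_add, smul_eq_mul, ite_mul,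
      zero_mul, Finset.sum_ite_eq', Finset.mem_univ, if_true, ← pow_add, add_comm r n, hn] at h1
    have h2 : ∀ x : ZMod p, primeHom p F x ^ (p - 1) = 1 - if x = 0 then 1 else 0 := by
      intro x
      by_cases hx : x = 0
      · rw [if_pos hx, hx, map_zero, zero_pow (by omega), sub_self]
      · rw [if_neg hx, ← map_pow, ZMod.pow_card_sub_one_eq_one hx, map_one, sub_zero]
    simp [h2] at h1

lemma natDegree_lt_of_evalFun_eq_zero {r : ℕ} (hr : 1 ≤ r) {f : F[X]} (hf : f.natDegree ≤ r)
    (h : evalFun p F r f = 0) : f.natDegree < r := by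
  refine lt_of_le_of_ne hf fun h1 => ?_
  have h2 := congrFun h ![1, 0]
  rw [evalFun_one_zero, Pi.zero_apply, ← h1] at h2
  rw [leadingCoeff_eq_zero.1 h2, natDegree_zero] at h1
  omega

lemma evalFun_injective {r : ℕ} (hr : 1 ≤ r) (hrp : r ≤ p) {f : F[X]}
    (hf : f ∈ degreeLT F (r + 1)) (h : evalFun p F r f = 0) : f = 0 := by
  have hd := natDegree_le_of_mem hf
  rw [← C_0]
  refine eq_C_of_forall_eval p ((natDegree_lt_of_evalFun_eq_zero hr hd h).trans_le hrp) fun t => ?_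
  rw [← evalFun_one p hd, h, Pi.zero_apply]

/-- The pairing is onto, because `Sym^n` is irreducible. -/
lemma pairing_surjective {n r : ℕ} (hn : n + r = p - 1) (hr : 1 ≤ r) {w : F[X]}
    (hw : w ∈ degreeLT F (n + 1)) : ∃ φ ∈ homogFun p F r, pairing p F n φ = w := by
  have hp := (Fact.out : p.Prime).two_le
  obtain ⟨φ, hφ, hne⟩ := exists_pairing_ne_zero (F := F) hn hr
  refine degreeLT_le_of_stable p (by omega) (N := (homogFun p F r).map (pairing p F n))
    (by rintro _ ⟨φ, _, rfl⟩; exact pairing_mem n φ) ?_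
    ((Submodule.ne_bot_iff _).2 ⟨_, ⟨φ, hφ, rfl⟩, hne⟩) hw
  rintro g _ ⟨φ, hφ, rfl⟩
  refine polyAction_mem_of_weightAct_mem p (m := 0 + r) ?_
  rw [← pairing_funAct hn]
  exact ⟨_, (isStable_funAct p ⊤ r 0).mem g (Subgroup.mem_top g) φ hφ, rfl⟩

lemma finrank_homogFun_le (r : ℕ) : Module.finrank F (homogFun p F r) ≤ p + 1 := by
  let T : homogFun p F r →ₗ[F] (Option (ZMod p) → F) :=
    (LinearMap.funLeft F F (fun o : Option (ZMod p) => o.elim ![1, 0] fun t => ![t, 1])) ∘ₗ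
      (homogFun p F r).subtype
  have hT : Function.Injective T := by
    intro φ ψ h
    exact Subtype.ext (homogFun_ext p φ.2 ψ.2 (fun t => congrFun h (some t)) (congrFun h none))
  refine (LinearMap.finrank_le_finrank_of_injective hT).trans_eq ?_
  rw [Module.finrank_fintype_fun_eq_card, Fintype.card_option, ZMod.card]

/-- The kernel of the pairing consists of the functions given by binary forms. -/
lemma exists_evalFun_eq_of_pairing {n r : ℕ} (hn : n + r = p - 1) (hr : 1 ≤ r)
    {φ : (Fin 2 → ZMod p) → F} (hφ : φ ∈ homogFun p F r) (h : pairing p F n φ = 0) :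
    ∃ f ∈ degreeLT F (r + 1), evalFun p F r f = φ := by
  have hp := (Fact.out : p.Prime).two_le
  obtain ⟨κ, hκ⟩ : ∃ κ : homogFun p F r →ₗ[F] degreeLT F (n + 1),
      ∀ φ, (κ φ : F[X]) = pairing p F n φ :=
    ⟨(pairing p F n).restrict fun φ _ => pairing_mem n φ, fun _ => LinearMap.coe_restrict_apply _ _⟩
  obtain ⟨ι, hι⟩ : ∃ ι : degreeLT F (r + 1) →ₗ[F] homogFun p F r,
      ∀ f, (ι f : (Fin 2 → ZMod p) → F) = evalFun p F r f :=
    ⟨(evalFun p F r).restrict fun f _ => evalFun_mem p r f, fun _ => LinearMap.coe_restrict_apply _ _⟩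
  have hsurj : Function.Surjective κ := by
    rintro ⟨w, hw⟩
    obtain ⟨φ, hφ, h⟩ := pairing_surjective hn hr hw
    exact ⟨⟨φ, hφ⟩, Subtype.ext ((hκ _).trans h)⟩
  have hinj : Function.Injective ι := by
    rw [injective_iff_map_eq_zero]
    intro f hf
    refine Subtype.ext (evalFun_injective hr (by omega) f.2 ?_)
    rw [← hι, hf, Submodule.coe_zero]
  have hle : LinearMap.range ι ≤ LinearMap.ker κ := by
    rintro _ ⟨f, rfl⟩
    refine Subtype.ext ?_
    rw [hκ, hι, pairing_evalFun hn, Submodule.coe_zero]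
  have h1 := LinearMap.finrank_range_add_finrank_ker κ
  rw [LinearMap.range_eq_top.2 hsurj, finrank_top, finrank_degreeLT] at h1
  have h2 := LinearMap.finrank_range_of_inj hinj
  rw [finrank_degreeLT] at h2
  have h3 := finrank_homogFun_le (p := p) (F := F) r
  have h4 : Module.finrank F (LinearMap.ker κ) ≤ Module.finrank F (LinearMap.range ι) := by
    rw [h2]
    generalize Module.finrank F (LinearMap.ker κ) = k at h1 ⊢
    generalize Module.finrank F (homogFun p F r) = l at h1 h3
    clear h2
    omega
  have heq := Submodule.eq_of_le_of_finrank_le hle h4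
  have hmem : (⟨φ, hφ⟩ : homogFun p F r) ∈ LinearMap.ker κ :=
    Subtype.ext ((hκ _).trans h)
  rw [← heq] at hmem
  obtain ⟨f, hf⟩ := hmem
  exact ⟨f, f.2, (hι f).symm.trans (congrArg Subtype.val hf)⟩

/-- The constituents of the induction of a character of the Borel subgroup. -/
lemma finrank_eqHom_borel_of_add
    (hP : Module.Projective (MonoidAlgebra F (GL (Fin 2) (ZMod p)))ᵐᵒᵖ P) {n r : ℕ}
    (hn : n + r = p - 1) (hr : 1 ≤ r) (m : ℕ) :
    Module.finrank F (eqHom P (borel p) (borelChar p F (r + m) m) ⊤) =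
      Module.finrank F (eqHom P ⊤ (weightAct p r m) (degreeLT F (r + 1))) +
      Module.finrank F (eqHom P ⊤ (weightAct p n (m + r)) (degreeLT F (n + 1))) := by
  have hp := (Fact.out : p.Prime).two_le
  rw [← finrank_eqHom_homogFun (by omega), finrank_eqHom_add (π := pairing p F n) hP
    (isStable_funAct p ⊤ r m) (fun g _ φ _ => pairing_funAct hn m g φ)
    (fun φ _ => pairing_mem n φ) (fun w hw => pairing_surjective hn hr hw)]
  congr 1
  symm
  exact finrank_eqHom_congr (π := evalFun p F r) hP (isStable_weightAct p ⊤ r m)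
    (fun g _ f _ => evalFun_weightAct p r m g f)
    (fun f _ => ⟨evalFun_mem p r f, pairing_evalFun hn f⟩)
    (fun f hf h => evalFun_injective hr (by omega) hf h)
    (fun φ hφ => exists_evalFun_eq_of_pairing hn hr hφ.1 hφ.2)

/-- The Borel characters occurring in the cosocle of the projective envelope of `Sym^a`. -/
theorem IsSerreEnvelope.finrank_eqHom_borel {a : ℕ} (hP : IsSerreEnvelope p a F P) (ha : 1 ≤ a)
    (ha' : a < p - 1) (i j : ℕ) :
    Module.finrank F (eqHom P (borel p) (borelChar p F i j) ⊤) =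
      (if i ≡ a [MOD p - 1] ∧ j ≡ 0 [MOD p - 1] then 1 else 0) +
        if i ≡ 0 [MOD p - 1] ∧ j ≡ a [MOD p - 1] then 1 else 0 := by
  have hp := (Fact.out : p.Prime).two_le
  -- the representative `r` of `i - j` modulo `p - 1` in `[1, p - 1]`
  obtain ⟨r, hr1, hr2, hr⟩ : ∃ r, 1 ≤ r ∧ r ≤ p - 1 ∧ r + j ≡ i [MOD p - 1] := by
    have h1 := Nat.mod_lt (i + (p - 2) * j) (by omega : 0 < p - 1)
    have h2 : (i + (p - 2) * j) % (p - 1) + j ≡ i [MOD p - 1] := by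
      refine ((Nat.mod_modEq _ _).add_right j).trans ?_
      have : i + (p - 2) * j + j = i + (p - 1) * j := by
        obtain ⟨q, rfl⟩ := Nat.exists_eq_add_of_le hp
        rw [show 2 + q - 2 = q by omega, show 2 + q - 1 = q + 1 by omega]; ring
      rw [this]
      simp [Nat.ModEq]
    rcases Nat.eq_zero_or_pos ((i + (p - 2) * j) % (p - 1)) with h | h
    · refine ⟨p - 1, by omega, le_rfl, ?_⟩
      rw [h] at h2
      refine Nat.ModEq.trans ?_ h2
      simp [Nat.ModEq]
    · exact ⟨_, h, h1.le, h2⟩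
  have hcongr : eqHom P (borel p) (borelChar p F i j) ⊤ =
      eqHom P (borel p) (borelChar p F (r + j) j) ⊤ := by
    ext φ
    refine and_congr_right fun _ => forall₂_congr fun g hg => forall_congr' fun x => ?_
    rw [borelChar_congr hr rfl hg]
  have hr' : ∀ {b c}, b ≤ p - 1 → 1 ≤ b → c < p - 1 → 1 ≤ c → (b ≡ c [MOD p - 1] ↔ b = c) := by
    intro b c hb hb1 hc hc1
    refine ⟨fun h => ?_, fun h => h ▸ rfl⟩
    rcases hb.lt_or_eq with hb | rfl
    · exact h.eq_of_lt_of_lt hb hc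
    · have h3 : (0 : ℕ) ≡ c [MOD p - 1] := Nat.ModEq.trans (by simp [Nat.ModEq]) h
      have := h3.eq_of_lt_of_lt (by omega) hc
      omega
  rw [hcongr, finrank_eqHom_borel_of_add hP.1 (show p - 1 - r + r = p - 1 by omega) hr1,
    hP.finrank_eqHom_weight ha ha' (by omega), hP.finrank_eqHom_weight ha ha' (by omega)]
  congr 1
  · refine if_congr (and_congr_left fun hj => ?_) rfl rfl
    rw [← hr' hr2 hr1 ha' ha]
    have h1 : r + 0 ≡ i [MOD p - 1] := (hj.symm.add_left r).trans hr
    rw [add_zero] at h1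
    exact ⟨fun h => h1.symm.trans h, fun h => h1.trans h⟩
  · refine if_congr ?_ rfl rfl
    have h1 : j + r ≡ 0 [MOD p - 1] ↔ i ≡ 0 [MOD p - 1] := by
      rw [add_comm]
      exact ⟨fun h => hr.symm.trans h, fun h => hr.trans h⟩
    rw [h1, and_comm]
    refine and_congr_right fun hi => ?_
    have h2 : p - 1 - r = a ↔ r = p - 1 - a := by omega
    rw [h2, ← hr' hr2 hr1 (by omega) (by omega)]
    have h3 : r + j ≡ 0 [MOD p - 1] := hr.trans hi
    have h4 : (p - 1 - a) + a ≡ 0 [MOD p - 1] := by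
      rw [Nat.sub_add_cancel (by omega)]; simp [Nat.ModEq]
    constructor
    · intro h
      exact Nat.ModEq.add_left_cancel h (h3.trans h4.symm)
    · intro h
      exact Nat.ModEq.add_right_cancel h (h3.trans h4.symm)

lemma coeff_linear_pow_self (u v : F) (n : ℕ) : ((C u * X + C v) ^ n).coeff n = u ^ n := by
  have h := homEval_linear_pow (A := F) u v n 1 0
  rw [homEval_one_zero] at h
  simpa using h

/-- The restriction of `Sym^b` to the Borel subgroup is filtered by characters. -/
lemma finrank_eqHom_borel_weight
    (hP : Module.Projective (MonoidAlgebra F (GL (Fin 2) (ZMod p)))ᵐᵒᵖ P) (b m : ℕ) :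
    Module.finrank F (eqHom P (borel p) (weightAct p b m) (degreeLT F (b + 1))) =
      ∑ j ∈ Finset.range (b + 1),
        Module.finrank F (eqHom P (borel p) (borelChar p F (j + m) (b - j + m)) ⊤) := by
  suffices h : ∀ c ≤ b + 1, IsStable (borel p) (weightAct p b m) (degreeLT F c) ∧
      Module.finrank F (eqHom P (borel p) (weightAct p b m) (degreeLT F c)) =
      ∑ j ∈ Finset.range c,
        Module.finrank F (eqHom P (borel p) (borelChar p F (j + m) (b - j + m)) ⊤) from
    (h _ le_rfl).2
  have hlead : ∀ c ≤ b, ∀ g ∈ borel p, ∀ f ∈ degreeLT F (c + 1),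
      (weightAct p b m g f ∈ degreeLT F (c + 1)) ∧
      lcoeff F c (weightAct p b m g f) = borelChar p F (c + m) (b - c + m) g (lcoeff F c f) := by
    intro c hc g hg f hf
    have hd := natDegree_le_of_mem hf
    have h1 : polyAction b (g.1.map (primeHom p F)) f = ∑ i ∈ Finset.range (b + 1),
        C (f.coeff i * primeHom p F (g.1 1 1) ^ (b - i)) *
          (C (primeHom p F (g.1 0 0)) * X + C (primeHom p F (g.1 0 1))) ^ i := by
      refine Finset.sum_congr rfl fun i _ => ?_
      rw [Matrix.map_apply, Matrix.map_apply, Matrix.map_apply, Matrix.map_apply,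
        mem_borel.1 hg, map_zero, C_0, zero_mul, zero_add, C_mul, C_pow]
      ring
    constructor
    · refine Submodule.smul_mem _ _ (mem_of_natDegree_le ?_)
      change (polyAction _ _ _).natDegree ≤ c
      rw [h1]
      refine natDegree_sum_le_of_forall_le _ _ fun i _ => ?_
      by_cases hi : i ≤ c
      · exact (natDegree_C_mul_le _ _).trans ((natDegree_linear_pow_le _ _ _).trans hi)
      · rw [coeff_eq_zero_of_natDegree_lt (by omega), zero_mul, C_0, zero_mul, natDegree_zero]
        exact Nat.zero_le c
    · rw [weightAct_apply, map_smul, lcoeff_apply, lcoeff_apply, h1, finsetSum_coeff,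
        Finset.sum_eq_single c, coeff_C_mul, coeff_linear_pow_self, borelChar_apply,
        det_of_mem_borel hg, map_mul, smul_eq_mul]
      · rw [pow_add, pow_add]; ring
      · intro i _ hi
        rw [coeff_C_mul]
        rcases lt_or_gt_of_ne hi with h | h
        · rw [coeff_eq_zero_of_natDegree_lt ((natDegree_linear_pow_le _ _ _).trans_lt h), mul_zero]
        · rw [coeff_eq_zero_of_natDegree_lt (hd.trans_lt h), zero_mul, zero_mul]
      · intro h; exact absurd (Finset.mem_range.2 (Nat.lt_succ_of_le hc)) h
  intro c hc
  induction c with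
  | zero =>
    have : degreeLT F 0 = ⊥ := by
      rw [eq_bot_iff]; intro f hf
      rwa [mem_degreeLT, Nat.cast_zero, Nat.WithBot.lt_zero_iff, degree_eq_bot] at hf
    rw [this]
    refine ⟨⟨fun g _ w hw => ?_, fun g _ h _ w _ => weightAct_mul p b m g h w⟩, ?_⟩
    · rw [(Submodule.mem_bot F).1 hw, map_zero]; exact Submodule.zero_mem _
    · rw [finrank_eqHom_bot, Finset.range_zero, Finset.sum_empty]
  | succ c ih =>
    have hst : IsStable (borel p) (weightAct p b m) (degreeLT F (c + 1)) :=
      ⟨fun g hg f hf => (hlead c (by omega) g hg f hf).1,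
        fun g _ h _ w _ => weightAct_mul p b m g h w⟩
    refine ⟨hst, ?_⟩
    have : degreeLT F (c + 1) ⊓ LinearMap.ker (lcoeff F c) = degreeLT F c := by
      ext f
      rw [Submodule.mem_inf, LinearMap.mem_ker, lcoeff_apply, mem_degreeLT, mem_degreeLT]
      constructor
      · rintro ⟨h1, h2⟩
        rw [degree_lt_iff_coeff_zero] at h1 ⊢
        intro k hk
        rcases hk.lt_or_eq with hk | rfl
        · exact h1 k hk
        · exact h2
      · intro h
        exact ⟨h.trans (by exact_mod_cast Nat.lt_succ_self c), coeff_eq_zero_of_degree_lt h⟩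
    rw [finrank_eqHom_add (π := lcoeff F c) hP hst
      (fun g hg f hf => (hlead c (by omega) g hg f hf).2) (fun _ _ => Submodule.mem_top)
      (fun r _ => ⟨C r * X ^ c, mem_of_natDegree_le (natDegree_C_mul_X_pow_le _ _), by simp⟩),
      this, Finset.sum_range_succ, ← (ih (by omega)).2]

end Recursion

/-! ### Ranks of forms and the reduction of polynomial lattices -/

section Lattice

variable {p : ℕ} [Fact p.Prime] {O : Type*} [CommRing O] [IsDomain O] [IsDiscreteValuationRing O]
  [Algebra ℤ_[p] O] [Module.Finite ℤ_[p] O] [FaithfulSMul ℤ_[p] O]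

/-- The weight `n` action of a matrix on polynomials of degree at most `n`. -/
def polyEnd {R : Type*} [CommRing R] (n : ℕ) (g : Matrix (Fin 2) (Fin 2) R) :
    Module.End R (degreeLT R (n + 1)) :=
  (polyActionₗ n g).restrict fun f _ => polyAction_mem n g f

lemma coe_polyEnd {R : Type*} [CommRing R] (n : ℕ) (g : Matrix (Fin 2) (Fin 2) R)
    (f : degreeLT R (n + 1)) : ((polyEnd n g f : degreeLT R (n + 1)) : R[X]) = polyAction n g f :=
  LinearMap.coe_restrict_apply _ _

lemma polyEnd_mul {R : Type*} [CommRing R] (n : ℕ) (g h : Matrix (Fin 2) (Fin 2) R) :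
    polyEnd n (g * h) = polyEnd n h * polyEnd n g := by
  refine LinearMap.ext fun f => Subtype.ext ?_
  rw [Module.End.mul_apply, coe_polyEnd, coe_polyEnd, coe_polyEnd, polyAction_mul]

lemma polyEnd_one {R : Type*} [CommRing R] (n : ℕ) :
    polyEnd n (1 : Matrix (Fin 2) (Fin 2) R) = 1 := by
  refine LinearMap.ext fun f => Subtype.ext ?_
  rw [coe_polyEnd, polyAction_one (natDegree_le_of_mem f.2), Module.End.one_apply]

/-- The right action of `K_p` on `𝒪[z]^{≤ n} ⊗ η ∘ det`. -/
def latticeAct (n : ℕ) (η : (ZMod p)ˣ →* Oˣ) :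
    Kp p →* (Module.End O (degreeLT O (n + 1)))ᵐᵒᵖ where
  toFun g := op ((η (unitRed p (Matrix.GeneralLinearGroup.det g)) : O) •
    polyEnd n (g.1.map (algebraMap ℤ_[p] O)))
  map_one' := by
    have h : (1 : Matrix (Fin 2) (Fin 2) ℤ_[p]).map (algebraMap ℤ_[p] O) = 1 :=
      (algebraMap ℤ_[p] O).mapMatrix.map_one
    rw [map_one, map_one, map_one, Units.val_one, one_smul, Units.val_one, h, polyEnd_one, op_one]
  map_mul' g h := by
    refine unop_injective ?_
    rw [unop_mul, unop_op, unop_op, unop_op, map_mul, map_mul, map_mul, Units.val_mul,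
      Units.val_mul, Matrix.map_mul, polyEnd_mul, smul_mul_smul_comm, mul_comm]

lemma latticeAct_apply (n : ℕ) (η : (ZMod p)ˣ →* Oˣ) (g : Kp p) (f : degreeLT O (n + 1)) :
    (((latticeAct n η g).unop f : degreeLT O (n + 1)) : O[X]) =
      (η (unitRed p (Matrix.GeneralLinearGroup.det g)) : O) •
        polyAction n (g.1.map (algebraMap ℤ_[p] O)) (f : O[X]) := by
  rw [← coe_polyEnd]; rfl

/-- The right action of `GL₂(𝔽_p)` on `Sym^n ⊗ det^m`. -/
def weightRep (p : ℕ) [Fact p.Prime] (F : Type*) [Field F] [CharP F p] (n m : ℕ) :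
    GL (Fin 2) (ZMod p) →* (Module.End F (degreeLT F (n + 1)))ᵐᵒᵖ where
  toFun g := op (primeHom p F g.1.det ^ m • polyEnd n (g.1.map (primeHom p F)))
  map_one' := by
    have h : (1 : Matrix (Fin 2) (Fin 2) (ZMod p)).map (primeHom p F) = 1 :=
      (primeHom p F).mapMatrix.map_one
    rw [Units.val_one, Matrix.det_one, map_one, one_pow, one_smul, h, polyEnd_one, op_one]
  map_mul' g h := by
    refine unop_injective ?_
    rw [unop_mul, unop_op, unop_op, unop_op, Units.val_mul, Matrix.det_mul, map_mul, mul_pow,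
      Matrix.map_mul, polyEnd_mul, smul_mul_smul_comm, mul_comm]

lemma weightRep_apply {F : Type*} [Field F] [CharP F p] (n m : ℕ) (g : GL (Fin 2) (ZMod p))
    (f : degreeLT F (n + 1)) :
    (((weightRep p F n m g).unop f : degreeLT F (n + 1)) : F[X]) = weightAct p n m g f := by
  rw [weightAct_apply, ← coe_polyEnd]; rfl

/-- Reduction of the coefficients of polynomials of degree at most `n`. -/
def reducePoly (O : Type*) [CommRing O] [IsLocalRing O] (n : ℕ) :
    degreeLT O (n + 1) →ₛₗ[IsLocalRing.residue O]
      degreeLT (IsLocalRing.ResidueField O) (n + 1) where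
  toFun f := ⟨(f : O[X]).map (IsLocalRing.residue O),
    mem_of_natDegree_le (natDegree_map_le.trans (natDegree_le_of_mem f.2))⟩
  map_add' _ _ := Subtype.ext (Polynomial.map_add _)
  map_smul' _ _ := Subtype.ext (Polynomial.map_smul _ _)

lemma exists_eq_smul_of_dvd {n : ℕ} {c : O} (hc : c ≠ 0) (f : degreeLT O (n + 1))
    (h : ∀ i, c ∣ (f : O[X]).coeff i) : ∃ y : degreeLT O (n + 1), f = c • y := by
  obtain ⟨y, hy⟩ := (C_dvd_iff_dvd_coeff c (f : O[X])).2 h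
  have hmem := f.2
  rw [hy, mem_degreeLT, degree_C_mul hc] at hmem
  exact ⟨⟨y, mem_degreeLT.2 hmem⟩, Subtype.ext (hy.trans (smul_eq_C_mul c).symm)⟩

lemma residue_algebraMap [CharP (IsLocalRing.ResidueField O) p] (x : ℤ_[p]) :
    IsLocalRing.residue O (algebraMap ℤ_[p] O x) =
      primeHom p (IsLocalRing.ResidueField O) (PadicInt.toZMod x) := by
  have h := PadicInt.sub_zmodRepr_mem x
  rw [PadicInt.maximalIdeal_eq_span_p, Ideal.mem_span_singleton] at h
  obtain ⟨c, hc⟩ := h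
  rw [← sub_add_cancel x (x.zmodRepr : ℤ_[p]), hc]
  simp

lemma residue_map (n : ℕ) (f : degreeLT O (n + 1)) :
    ((reducePoly O n f : degreeLT (IsLocalRing.ResidueField O) (n + 1)) :
      (IsLocalRing.ResidueField O)[X]) = (f : O[X]).map (IsLocalRing.residue O) := rfl

lemma polyAction_sub_dvd {n l : ℕ} {g g' : Kp p} (h : redPow p l g = redPow p l g') (f : O[X])
    (i : ℕ) : (p : O) ^ l ∣ (polyAction n (g.1.map (algebraMap ℤ_[p] O)) f -
      polyAction n (g'.1.map (algebraMap ℤ_[p] O)) f).coeff i := by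
  rw [← Ideal.mem_span_singleton, ← Ideal.Quotient.eq_zero_iff_mem, ← coeff_map,
    Polynomial.map_sub, map_polyAction, map_polyAction]
  have hgg : ((g.1.map (algebraMap ℤ_[p] O)).map (Ideal.Quotient.mk (Ideal.span {(p : O) ^ l}))) =
      (g'.1.map (algebraMap ℤ_[p] O)).map (Ideal.Quotient.mk (Ideal.span {(p : O) ^ l})) := by
    ext i j
    have h1 : PadicInt.toZModPow l (g.1 i j) = PadicInt.toZModPow l (g'.1 i j) :=
      congrArg (fun x : KQuot p l => x.1 i j) h
    rw [← sub_eq_zero, ← map_sub, ← RingHom.mem_ker, PadicInt.ker_toZModPow,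
      Ideal.mem_span_singleton] at h1
    obtain ⟨c, hc⟩ := h1
    simp only [Matrix.map_apply]
    rw [Ideal.Quotient.eq, Ideal.mem_span_singleton, ← map_sub, hc]
    exact ⟨algebraMap ℤ_[p] O c, by simp⟩
  rw [hgg, sub_self, coeff_zero]

lemma unitRed_det_eq {g g' : Kp p} (h : redOne p g = redOne p g') :
    unitRed p (Matrix.GeneralLinearGroup.det g) = unitRed p (Matrix.GeneralLinearGroup.det g') := by
  have key : ∀ g : Kp p, unitRed p (Matrix.GeneralLinearGroup.det g) =
      Matrix.GeneralLinearGroup.det (redOne p g) := fun g =>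
    Units.ext (RingHom.map_det (PadicInt.toZMod (p := p)) g.1)
  rw [key, key, h]

/-- The reduction modulo `ϖ` of the lattice of polynomials of degree at most `n`, twisted by a
character `η ∘ det`, is `Sym^n ⊗ det^m` if `η` reduces to the `m`-th power. -/
lemma isReduction_lattice [CharP (IsLocalRing.ResidueField O) p] {ϖ : O} (hϖ : Irreducible ϖ)
    (n m : ℕ) {η : (ZMod p)ˣ →* Oˣ}
    (hη : ∀ x : (ZMod p)ˣ, IsLocalRing.residue O (η x : O) =
      primeHom p (IsLocalRing.ResidueField O) x ^ m) :
    IsReduction ϖ (latticeAct n η) (weightRep p (IsLocalRing.ResidueField O) n m)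
      (reducePoly O n) where
  lipschitz l g g' h f := by
    rcases Nat.eq_zero_or_pos l with rfl | hl
    · exact ⟨_, by rw [pow_zero, one_smul]⟩
    refine exists_eq_smul_of_dvd (pow_ne_zero l (p_ne_zero p O)) _ fun i => ?_
    rw [Submodule.coe_sub, latticeAct_apply, latticeAct_apply,
      unitRed_det_eq (redPow_one_eq_of_le hl h), ← smul_sub, coeff_smul, smul_eq_mul]
    exact (polyAction_sub_dvd h _ i).mul_left _
  surjective f := by
    choose r hr using IsLocalRing.residue_surjective (R := O)
    refine ⟨⟨∑ i ∈ Finset.range (n + 1), C (r ((f : (IsLocalRing.ResidueField O)[X]).coeff i)) *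
      X ^ i, Submodule.sum_mem _ fun i hi => mem_of_natDegree_le ?_⟩, Subtype.ext ?_⟩
    · exact (natDegree_C_mul_X_pow_le _ _).trans (Nat.lt_succ_iff.1 (Finset.mem_range.1 hi))
    · rw [residue_map, Polynomial.map_sum]
      conv_rhs => rw [as_sum_range' (f : (IsLocalRing.ResidueField O)[X]) (n + 1)
        (Nat.lt_succ_of_le (natDegree_le_of_mem f.2))]
      simp [hr, C_mul_X_pow_eq_monomial]
  ker f hf := by
    refine exists_eq_smul_of_dvd hϖ.ne_zero f fun i => ?_
    have h1 := congrArg (fun q => coeff q i) (congrArg Subtype.val hf)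
    rw [← Ideal.mem_span_singleton, ← hϖ.maximalIdeal_eq, ← IsLocalRing.residue_eq_zero_iff]
    simpa [residue_map] using h1
  equivariant g f := by
    refine Subtype.ext ?_
    rw [residue_map, latticeAct_apply, weightRep_apply, weightAct_apply, Polynomial.map_smul,
      map_polyAction, hη, residue_map]
    congr 2
    · rw [show (redOne p g).1.det = PadicInt.toZMod g.1.det from
        (RingHom.map_det (PadicInt.toZMod (p := p)) g.1).symm]
      rfl
    · ext i j
      exact residue_algebraMap (g.1 i j)

universe u

variable {H : Type u} [AddCommGroup H] [Module O H] [Module (iwasawaAlgebra p O)ᵐᵒᵖ H]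

/-- Continuity of all coefficients is continuity after every linear form. -/
lemma isContinuousForm_iff {n : ℕ} (φ : H →ₗ[O] degreeLT O n) :
    IsContinuousForm p O H φ ↔ ∀ l : degreeLT O n →ₗ[O] O,
      Continuous[canonicalTopology p O H, padicTopology p O] fun h => l (φ h) := by
  let _ := padicTopology p O
  let _ := canonicalTopology p O H
  have : NonarchimedeanRing O := Ideal.nonarchimedean (Ideal.span {(p : O)})
  constructor
  · intro h l
    have key : ∀ f : degreeLT O n,
        l f = ∑ i : Fin n, (f : O[X]).coeff i * l ((degreeLTEquiv O n).symm (Pi.single i 1)) := by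
      intro f
      have h1 := LinearMap.pi_apply_eq_sum_univ (l ∘ₗ (degreeLTEquiv O n).symm.toLinearMap)
        (degreeLTEquiv O n f)
      rw [LinearMap.comp_apply, LinearEquiv.coe_coe, LinearEquiv.symm_apply_apply] at h1
      rw [h1]
      refine Finset.sum_congr rfl fun i _ => congrArg₂ (· * ·) rfl (congrArg l (congrArg _ ?_))
      ext j
      simp [Pi.single_apply, eq_comm]
    rw [funext fun h => key (φ h)]
    exact continuous_finsetSum _ fun i _ => (h i).mul continuous_const
  · intro h i
    exact h (lcoeff O i ∘ₗ (degreeLT O n).subtype)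

lemma urForms_eq (n : ℕ) (η : (ZMod p)ˣ →* Oˣ) :
    urForms p O H (n + 2) η = levelForms (latticeAct n η) H ⊤ := by
  ext φ
  refine and_congr (isContinuousForm_iff φ) ⟨fun h g _ x => Subtype.ext (h g x), fun h g x => ?_⟩
  exact congrArg Subtype.val (h g (Subgroup.mem_top _) x)

lemma redOne_mem_borel (g : Kp p) : redOne p g ∈ borel p ↔ (p : ℤ_[p]) ∣ g.1 1 0 := by
  rw [mem_borel, show (redOne p g).1 1 0 = PadicInt.toZMod (g.1 1 0) from rfl, ← RingHom.mem_ker,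
    PadicInt.ker_toZMod, PadicInt.maximalIdeal_eq_span_p, Ideal.mem_span_singleton]

lemma iwForms_doubled_eq (n : ℕ) (η : (ZMod p)ˣ →* Oˣ) :
    iwForms p O H (n + 2) (doubled η) = levelForms (latticeAct n η) H (borel p) := by
  have hη : ∀ d δ : (ZMod p)ˣ, doubled η (d / δ, δ) = η d := fun d δ => by
    rw [doubled, MonoidHom.coprod_apply, ← map_mul, div_mul_cancel]
  ext φ
  refine and_congr (isContinuousForm_iff φ) ⟨fun h g hg x => Subtype.ext ?_,
    fun h g hg δ hδ x => ?_⟩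
  · have hdet := (Matrix.GeneralLinearGroup.det (redOne p g)).ne_zero
    rw [show ((Matrix.GeneralLinearGroup.det (redOne p g) : (ZMod p)ˣ) : ZMod p) =
      (redOne p g).1.det from rfl, det_of_mem_borel hg] at hdet
    have h1 := h g ((redOne_mem_borel g).1 hg) (Units.mk0 _ (right_ne_zero_of_mul hdet)) rfl x
    rw [hη] at h1
    exact h1
  · rw [hη]
    exact congrArg Subtype.val (h g ((redOne_mem_borel g).2 hg) x)

variable [IsScalarTower O (iwasawaAlgebra p O)ᵐᵒᵖ H]

/-- The ranks of the modules of forms are computed by equivariant maps from a projective envelope of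
`Sym^a` over the residue field. -/
theorem IsPrimitive.exists_envelope [CharP (IsLocalRing.ResidueField O) p] {a : ℕ}
    (hH : IsPrimitive p O a H) :
    ∃ (P : Type u) (_ : AddCommGroup P)
      (_ : Module (MonoidAlgebra (IsLocalRing.ResidueField O) (GL (Fin 2) (ZMod p)))ᵐᵒᵖ P)
      (_ : Module (IsLocalRing.ResidueField O) P)
      (_ : IsScalarTower (IsLocalRing.ResidueField O)
        (MonoidAlgebra (IsLocalRing.ResidueField O) (GL (Fin 2) (ZMod p)))ᵐᵒᵖ P)
      (_ : Module.Finite (IsLocalRing.ResidueField O) P),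
      IsSerreEnvelope p a (IsLocalRing.ResidueField O) P ∧
      ∀ (m : ℕ) (η : (ZMod p)ˣ →* Oˣ) (_ : ∀ x : (ZMod p)ˣ, IsLocalRing.residue O (η x : O) =
        primeHom p (IsLocalRing.ResidueField O) x ^ m) (n : ℕ),
        dUr p O H (n + 2) η = Module.finrank (IsLocalRing.ResidueField O)
          (eqHom P ⊤ (weightAct p n m) (degreeLT (IsLocalRing.ResidueField O) (n + 1))) ∧
        dIw p O H (n + 2) (doubled η) = Module.finrank (IsLocalRing.ResidueField O)
          (eqHom P (borel p) (weightAct p n m)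
            (degreeLT (IsLocalRing.ResidueField O) (n + 1))) := by
  obtain ⟨hfin, hproj, P, _, _, q, hq, hker, hP⟩ := hH
  let _ : Module (IsLocalRing.ResidueField O) P := Module.compHom P (algebraMap
    (IsLocalRing.ResidueField O)
    (MonoidAlgebra (IsLocalRing.ResidueField O) (GL (Fin 2) (ZMod p)))ᵐᵒᵖ)
  have : IsScalarTower (IsLocalRing.ResidueField O)
      (MonoidAlgebra (IsLocalRing.ResidueField O) (GL (Fin 2) (ZMod p)))ᵐᵒᵖ P :=
    ⟨fun c r x => by rw [Algebra.smul_def, mul_smul]; rfl⟩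
  have hPfin := finite_reduction hfin q hq
  obtain ⟨ϖ, hϖ⟩ := IsDiscreteValuationRing.exists_irreducible O
  refine ⟨P, inferInstance, inferInstance, inferInstance, inferInstance, hPfin, hP,
    fun m η hη n => ?_⟩
  have hfree : Module.Free O (degreeLT O (n + 1)) := Module.Free.of_equiv (degreeLTEquiv O _).symm
  have hfinite : Module.Finite O (degreeLT O (n + 1)) := Module.Finite.equiv (degreeLTEquiv O _).symm
  have key : ∀ J : Subgroup (GL (Fin 2) (ZMod p)),
      Module.finrank O (levelForms (latticeAct n η) H J) =
        Module.finrank (IsLocalRing.ResidueField O)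
          (eqHom P J (weightAct p n m) (degreeLT (IsLocalRing.ResidueField O) (n + 1))) := by
    intro J
    rw [(isReduction_lattice hϖ n m hη).finrank_levelForms hϖ hfin hproj q hq hker]
    refine finrank_eqHom_congr (π := (degreeLT _ (n + 1)).subtype) hP.1
      ⟨fun _ _ _ _ => Submodule.mem_top, fun g _ h _ w _ => ?_⟩ (fun g _ w _ => rfl)
      (fun w _ => w.2) (fun w _ hw => Subtype.ext hw)
      (fun w hw => ⟨⟨w, hw⟩, Submodule.mem_top, rfl⟩)
    rw [map_mul, unop_mul]; rfl
  constructor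
  · rw [← key, ← urForms_eq]; rfl
  · rw [← key, ← iwForms_doubled_eq]; rfl

end Lattice

/-! ### The dimension formulas -/

section Counting

/-- The positions `K_0 < K_1 < ⋯` of the jumps of the unramified dimension. -/
def jump (p a s n : ℕ) : ℕ :=
  (if Even n then tOne p a s else tTwo p a s) + (p + 1) * (n / 2)

/-- The number of the `i ≡ r` modulo `N` that satisfy a condition which cuts out the first `J` of
them. -/
lemma sum_indicator_eq {N r J L : ℕ} (hr : r < N) {Q : ℕ → Prop} {R : ℕ → Prop}
    [DecidablePred Q] [DecidablePred R] (hR : ∀ i, R i ↔ i ≡ r [MOD N])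
    (hQ : ∀ j, Q (r + N * j) ↔ j < J) (hL : ∀ i, Q i → i < L) :
    ∑ i ∈ Finset.range L, (if R i ∧ Q i then 1 else 0) = J := by
  rw [← Finset.card_filter]
  have h1 : (Finset.range L).filter (fun i => R i ∧ Q i) =
      (Finset.range J).image fun j => r + N * j := by
    ext i
    simp only [Finset.mem_filter, Finset.mem_range, Finset.mem_image]
    constructor
    · rintro ⟨-, h2, h3⟩
      rw [hR, Nat.ModEq, Nat.mod_eq_of_lt hr] at h2
      have h4 : r + N * (i / N) = i := by rw [← h2]; exact Nat.mod_add_div i N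
      exact ⟨i / N, by rw [← hQ, h4]; exact h3, h4⟩
    · rintro ⟨j, hj, rfl⟩
      have h2 := (hQ j).2 hj
      refine ⟨hL _ h2, (hR _).2 ?_, h2⟩
      simp [Nat.ModEq]
  rw [h1, Finset.card_image_of_injective, Finset.card_range]
  intro i j hij
  have hij : N * i = N * j := Nat.add_left_cancel hij
  exact Nat.eq_of_mul_eq_mul_left (by omega) hij

variable {p : ℕ} [Fact p.Prime] {F : Type*} [Field F] [CharP F p] {P : Type*} [AddCommGroup P]
  [Module (MonoidAlgebra F (GL (Fin 2) (ZMod p)))ᵐᵒᵖ P] [Module F P]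
  [IsScalarTower F (MonoidAlgebra F (GL (Fin 2) (ZMod p)))ᵐᵒᵖ P] [Module.Finite F P]

/-- The contribution of the `i`-th twist to the multiplicity of `Sym^b ⊗ det^m`. -/
def twistCount (p a b m i : ℕ) : ℕ :=
  (if i + m ≡ 0 [MOD p - 1] ∧ (p + 1) * i ≤ b then 1 else 0) +
    if i + m ≡ a [MOD p - 1] ∧ (p + 1) * i + p ≤ b then 1 else 0

lemma sum_twistCount_of_lt {a b m L : ℕ} (hb : b < p + 1) (hL : b < L) :
    ∑ i ∈ Finset.range L, twistCount p a b m i = twistCount p a b m 0 := by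
  refine Finset.sum_eq_single 0 (fun i _ hi => ?_) fun h => absurd (Finset.mem_range.2 (by omega)) h
  have h1 : p + 1 ≤ (p + 1) * i := Nat.le_mul_of_pos_right _ (Nat.pos_of_ne_zero hi)
  rw [twistCount, if_neg (by omega), if_neg (by omega), add_zero]

/-- The induced representation in the recursion for `Sym^b ⊗ det^m` contributes the untwisted
term. -/
lemma IsSerreEnvelope.finrank_borel_eq {a : ℕ} (hP : IsSerreEnvelope p a F P) (ha : 1 ≤ a)
    (ha' : a < p - 1) {b m : ℕ} (hbm : b + 2 * m ≡ a [MOD p - 1]) (hb : p ≤ b) :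
    Module.finrank F (eqHom P (borel p) (borelChar p F (b + m) m) ⊤) = twistCount p a b m 0 := by
  rw [hP.finrank_eqHom_borel ha ha', twistCount, zero_add]
  have h1 : b + m + m ≡ a [MOD p - 1] := by rwa [add_assoc, ← two_mul]
  congr 1
  · refine if_congr ⟨fun h => ⟨h.2, by omega⟩, fun h => ⟨?_, h.1⟩⟩ rfl rfl
    exact Nat.ModEq.trans (h.1.symm.add_left (b + m)) h1
  · refine if_congr ⟨fun h => ⟨h.2, by omega⟩, fun h => ⟨?_, h.1⟩⟩ rfl rfl
    refine Nat.ModEq.add_right_cancel h.1 ?_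
    rwa [zero_add]

/-- The multiplicity of `Sym^b ⊗ det^m`: the recursion lowers `b` by `p + 1` and raises `m` by
`1`. The sum may run over any range that contains all nonzero terms. -/
theorem IsSerreEnvelope.finrank_weight_eq_sum {a : ℕ} (hP : IsSerreEnvelope p a F P) (ha : 1 ≤ a)
    (ha' : a < p - 1) (b : ℕ) : ∀ m, b + 2 * m ≡ a [MOD p - 1] → ∀ L, b < L →
    Module.finrank F (eqHom P ⊤ (weightAct p b m) (degreeLT F (b + 1))) =
      ∑ i ∈ Finset.range L, twistCount p a b m i := by
  induction b using Nat.strong_induction_on with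
  | _ b ih =>
    intro m hbm L hL
    rcases lt_trichotomy b p with hb | rfl | hb
    · rw [sum_twistCount_of_lt (by omega) hL, hP.finrank_eqHom_weight ha ha' hb, twistCount,
        if_neg (by omega : ¬ (_ ∧ (p + 1) * 0 + p ≤ b)), add_zero, zero_add]
      refine if_congr ⟨fun h => ⟨h.2, by omega⟩, fun h => ⟨?_, h.1⟩⟩ rfl rfl
      have h1 : b ≡ a [MOD p - 1] := by
        have := (h.1.mul_left 2).add_left b
        rw [mul_zero, add_zero] at this
        exact this.symm.trans hbm
      rcases Nat.lt_or_ge b (p - 1) with h2 | h2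
      · exact h1.eq_of_lt_of_lt h2 ha'
      · obtain rfl : b = p - 1 := by omega
        have h3 : (0 : ℕ) ≡ a [MOD p - 1] := Nat.ModEq.trans (by simp [Nat.ModEq]) h1
        have := h3.eq_of_lt_of_lt (by omega) ha'
        omega
    · rw [sum_twistCount_of_lt (by omega) hL, finrank_eqHom_weight_p hP.1,
        hP.finrank_borel_eq ha ha' hbm le_rfl]
    · obtain ⟨c, rfl⟩ := Nat.exists_eq_add_of_le hb
      obtain ⟨L, rfl⟩ : ∃ L', L = L' + 1 := ⟨L - 1, by omega⟩
      rw [Nat.succ_eq_add_one, finrank_eqHom_weight_add hP.1,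
        hP.finrank_borel_eq ha ha' hbm (by omega), Finset.sum_range_succ',
        ih c (by omega) (m + 1) ?_ L (by omega)]
      · congr 1
        refine Finset.sum_congr rfl fun i _ => ?_
        rw [twistCount, twistCount]
        congr 1
        · refine if_congr (and_congr (by rw [add_right_comm, add_assoc]) ?_) rfl rfl
          rw [mul_add]; omega
        · refine if_congr (and_congr (by rw [add_right_comm, add_assoc]) ?_) rfl rfl
          rw [mul_add]; omega
      · refine Nat.ModEq.trans ?_ hbm
        have : p + 1 + c + 2 * m = c + 2 * (m + 1) + (p - 1) := by omega
        rw [Nat.succ_eq_add_one, this]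
        simp [Nat.ModEq]

/-- Numerical relations between the invariants `s`, `a` and `δ`, `t₁`, `t₂`. -/
lemma weight_relations {p a s : ℕ} (hp : 5 ≤ p) (ha' : a ≤ p - 4) (hs : s ≤ p - 2) :
    ∃ s' κ : ℕ, s' < p - 1 ∧ κ < p - 1 ∧ (a + s) % (p - 1) = s' ∧ (a + 2 * s) % (p - 1) = κ ∧
      s + s' = κ + (p - 1) * deltaEps p a s ∧ deltaEps p a s ≤ 1 ∧
      ((s' = a + s ∧ tOne p a s = s + deltaEps p a s ∧ tTwo p a s = a + s + deltaEps p a s + 2) ∨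
       (s' + (p - 1) = a + s ∧ tOne p a s = s' + deltaEps p a s + 1 ∧
          tTwo p a s = s + deltaEps p a s + 1)) := by
  have hpos : 0 < p - 1 := by omega
  have h1 := Nat.mod_lt (a + s) hpos
  have h2 := Nat.mod_lt (a + 2 * s) hpos
  have h3 : (s + (a + s) % (p - 1)) % (p - 1) = (a + 2 * s) % (p - 1) := by
    rw [Nat.add_mod_mod]; congr 1; ring
  have h4 := Nat.mod_add_div (s + (a + s) % (p - 1)) (p - 1)
  rw [h3] at h4
  refine ⟨_, _, h1, h2, rfl, rfl, h4.symm, ?_, ?_⟩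
  · rw [deltaEps]
    refine Nat.lt_succ_iff.1 ((Nat.div_lt_iff_lt_mul hpos).2 ?_)
    omega
  · by_cases h : a + s < p - 1
    · left
      rw [tOne, tTwo, if_pos h, if_pos h]
      exact ⟨Nat.mod_eq_of_lt h, rfl, rfl⟩
    · right
      rw [tOne, tTwo, if_neg h, if_neg h]
      refine ⟨?_, rfl, rfl⟩
      rw [Nat.mod_eq_sub_mod (by omega), Nat.mod_eq_of_lt (by omega)]
      omega

/-- Consecutive jumps differ by at least `3`, in both parities. -/
lemma tOne_add_three_le {p a s : ℕ} (hp : 5 ≤ p) (ha : 1 ≤ a) (ha' : a ≤ p - 4) (hs : s ≤ p - 2) :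
    tOne p a s + 3 ≤ tTwo p a s ∧ tTwo p a s + 2 ≤ tOne p a s + p ∧
      deltaEps p a s ≤ tOne p a s ∧ tTwo p a s ≤ p + deltaEps p a s := by
  obtain ⟨s', κ, h1, h2, h3, h4, h5, h6, h7⟩ := weight_relations hp ha' hs
  generalize deltaEps p a s = δ at *
  obtain rfl | rfl : δ = 0 ∨ δ = 1 := by omega
  all_goals omega

/-- The number of `j` with `t + (p + 1) j ≤ c`. -/
def progCount (p c t : ℕ) : ℕ := (c + (p + 1) - t) / (p + 1)

lemma lt_progCount {p c t j : ℕ} : j < progCount p c t ↔ t + (p + 1) * j ≤ c := by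
  rw [progCount, ← Nat.add_one_le_iff, Nat.le_div_iff_mul_le (by omega), add_mul, mul_comm j]
  omega

/-- The progressions of difference `p + 1` from `t₁` and from `t₂` interlace, so that `jump`
enumerates them together in increasing order. -/
lemma lt_progCount_add_iff {p a s c n : ℕ} (h1 : tOne p a s ≤ tTwo p a s)
    (h2 : tTwo p a s ≤ tOne p a s + (p + 1)) :
    n < progCount p c (tOne p a s) + progCount p c (tTwo p a s) ↔ jump p a s n ≤ c := by
  have k1 : progCount p c (tTwo p a s) ≤ progCount p c (tOne p a s) := by
    by_contra! h
    have h3 := lt_progCount.1 h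
    exact lt_irrefl (progCount p c (tOne p a s)) (lt_progCount.2 (by omega))
  have k2 : progCount p c (tOne p a s) ≤ progCount p c (tTwo p a s) + 1 := by
    by_contra! h
    have h3 := lt_progCount.1 h
    rw [mul_add] at h3
    exact lt_irrefl (progCount p c (tTwo p a s)) (lt_progCount.2 (by omega))
  rcases Nat.even_or_odd' n with ⟨m, rfl | rfl⟩
  · rw [jump, if_pos (even_two_mul m), Nat.mul_div_cancel_left m two_pos, ← lt_progCount]
    omega
  · rw [jump, if_neg (by simp), show (2 * m + 1) / 2 = m by omega, ← lt_progCount]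
    omega

lemma le_iff_of_add_eq {N X c r l κ : ℕ} (hr : r < N) (h : l + r = N * X + κ) :
    l ≤ κ + N * c ↔ X ≤ c := by
  constructor
  · intro h1
    by_contra! h2
    have := Nat.mul_le_mul_left N h2
    rw [Nat.succ_eq_add_one, mul_add] at this
    omega
  · intro h1
    have := Nat.mul_le_mul_left N h1
    omega

lemma modEq_of_eq_add {N x y k : ℕ} (h : x = y + N * k) : x ≡ y [MOD N] := by
  rw [h]; simp [Nat.ModEq]

lemma modEq_iff_of_add {N i m r r' : ℕ} (h : m + r ≡ r' [MOD N]) :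
    i + m ≡ r' [MOD N] ↔ i ≡ r [MOD N] := by
  rw [add_comm i]
  exact ⟨fun h1 => Nat.ModEq.add_left_cancel' m (h1.trans h.symm),
    fun h1 => (h1.add_left m).trans h⟩

/-- The residues modulo `p - 1` that govern the twist by `det^(p - 1 - s)`, the reduction of
`ω^(-s)`. -/
lemma twist_congruences {a s s' κ δ c : ℕ} (hs : s ≤ p - 2)
    (h5 : s + s' = κ + (p - 1) * δ) (h6 : δ ≤ 1) (h7 : s' = a + s ∨ s' + (p - 1) = a + s) :
    p - 1 - s + s ≡ 0 [MOD p - 1] ∧ p - 1 - s + s' ≡ a [MOD p - 1] ∧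
      κ + (p - 1) * c + 2 * (p - 1 - s) ≡ a [MOD p - 1] := by
  have hp := (Fact.out : p.Prime).two_le
  refine ⟨modEq_of_eq_add (k := 1) (by omega), ?_, ?_⟩
  · rcases h7 with h | h
    · exact modEq_of_eq_add (k := 1) (by omega)
    · exact modEq_of_eq_add (k := 0) (by omega)
  · obtain rfl | rfl : δ = 0 ∨ δ = 1 := by omega
    · rcases h7 with h | h
      · refine modEq_of_eq_add (k := c + 2) ?_
        rw [mul_add]; omega
      · refine modEq_of_eq_add (k := c + 1) ?_
        rw [mul_add]; omega
    · rcases h7 with h | h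
      · refine modEq_of_eq_add (k := c + 1) ?_
        rw [mul_add]; omega
      · refine modEq_of_eq_add (k := c) ?_
        omega

/-- The position of the jumps of the dimension in the unramified case. -/
theorem IsSerreEnvelope.lt_finrank_iff {a s c n : ℕ} (hP : IsSerreEnvelope p a F P) (hp : 5 ≤ p)
    (ha : 1 ≤ a) (ha' : a ≤ p - 4) (hs : s ≤ p - 2) :
    n < Module.finrank F (eqHom P ⊤ (weightAct p ((a + 2 * s) % (p - 1) + (p - 1) * c) (p - 1 - s))
      (degreeLT F ((a + 2 * s) % (p - 1) + (p - 1) * c + 1))) ↔ jump p a s n ≤ c := by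
  obtain ⟨s', κ, h1, h2, h3, h4, h5, h6, h7⟩ := weight_relations hp ha' hs
  obtain ⟨h8, h9, -, -⟩ := tOne_add_three_le hp ha ha' hs
  rw [h4]
  obtain ⟨hm, hm', hbm⟩ := twist_congruences (c := c) hs h5 h6 (h7.imp And.left And.left)
  rw [hP.finrank_weight_eq_sum ha (by omega) _ _ hbm _ (Nat.lt_succ_self _),
    ← lt_progCount_add_iff (by omega) (by omega)]
  simp only [twistCount, Finset.sum_add_distrib]
  obtain ⟨N, hN⟩ : ∃ N, N = p - 1 := ⟨_, rfl⟩
  have hpN : p = N + 1 := by omega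
  have key1 : ∀ t, s * N + 2 * s + a = N * t + κ →
      ∑ i ∈ Finset.range (κ + (p - 1) * c + 1),
        (if i + (p - 1 - s) ≡ 0 [MOD p - 1] ∧ (p + 1) * i ≤ κ + (p - 1) * c then 1 else 0) =
      progCount p c t := by
    intro t ht
    refine sum_indicator_eq (by omega : s < p - 1) (fun i => modEq_iff_of_add hm)
      (fun j => ?_) fun i hi => by rw [add_mul] at hi; omega
    rw [lt_progCount]
    refine le_iff_of_add_eq (r := a) (by omega) ?_
    rw [← hN, hpN]
    linarith
  have key2 : ∀ t, s' * N + 2 * s' + N + N = N * t + κ + a →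
      ∑ i ∈ Finset.range (κ + (p - 1) * c + 1),
        (if i + (p - 1 - s) ≡ a [MOD p - 1] ∧ (p + 1) * i + p ≤ κ + (p - 1) * c then 1 else 0) =
      progCount p c t := by
    intro t ht
    refine sum_indicator_eq h1 (fun i => modEq_iff_of_add hm')
      (fun j => ?_) fun i hi => by rw [add_mul] at hi; omega
    rw [lt_progCount]
    refine le_iff_of_add_eq (r := p - 2 - a) (by omega) ?_
    have hr : p - 2 - a + a + 1 = N := by omega
    rw [← hN]
    generalize p - 2 - a = r at hr
    rw [hpN]
    linarith
  rw [← hN] at h5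
  rcases h7 with ⟨h7, h10, h11⟩ | ⟨h7, h10, h11⟩
  · rw [key1 (tOne p a s) (by rw [h10]; linarith), key2 (tTwo p a s) (by rw [h11, h7]; linarith)]
  · rw [← hN] at h7
    rw [key1 (tTwo p a s) (by rw [h11]; linarith), key2 (tOne p a s) (by rw [h10]; linarith),
      add_comm]

/-- The dimension in the Iwahori case. -/
theorem IsSerreEnvelope.finrank_borel_weight_eq {a s c : ℕ} (hP : IsSerreEnvelope p a F P)
    (hp : 5 ≤ p) (ha : 1 ≤ a) (ha' : a ≤ p - 4) (hs : s ≤ p - 2) :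
    Module.finrank F (eqHom P (borel p)
      (weightAct p ((a + 2 * s) % (p - 1) + (p - 1) * c) (p - 1 - s))
      (degreeLT F ((a + 2 * s) % (p - 1) + (p - 1) * c + 1))) + 2 * deltaEps p a s =
      2 * c + 2 := by
  obtain ⟨s', κ, h1, h2, h3, h4, h5, h6, h7⟩ := weight_relations hp ha' hs
  rw [h4]
  obtain ⟨hm, hm', hbm⟩ := twist_congruences (c := c) hs h5 h6 (h7.imp And.left And.left)
  have key : ∀ r r' e, r < p - 1 → p - 1 - s + r ≡ r' [MOD p - 1] → e ≤ 1 →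
      (r ≤ κ ↔ e = 1) → ∑ j ∈ Finset.range (κ + (p - 1) * c + 1),
        (if j + (p - 1 - s) ≡ r' [MOD p - 1] ∧ j ≤ κ + (p - 1) * c then 1 else 0) = c + e := by
    intro r r' e hr hrm he hre
    refine sum_indicator_eq hr (fun i => modEq_iff_of_add hrm) (fun j => ?_) fun i hi => by omega
    rcases lt_trichotomy j c with h | rfl | h
    · have := Nat.mul_le_mul_left (p - 1) (Nat.succ_le_of_lt h)
      rw [Nat.succ_eq_add_one, mul_add] at this
      exact ⟨fun _ => by omega, fun _ => by omega⟩
    · exact ⟨fun _ => by omega, fun _ => by omega⟩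
    · have := Nat.mul_le_mul_left (p - 1) (Nat.succ_le_of_lt h)
      rw [Nat.succ_eq_add_one, mul_add] at this
      exact ⟨fun _ => by omega, fun _ => by omega⟩
  rw [finrank_eqHom_borel_weight hP.1]
  have hterm : ∀ j ∈ Finset.range (κ + (p - 1) * c + 1),
      Module.finrank F (eqHom P (borel p) (borelChar p F (j + (p - 1 - s))
        (κ + (p - 1) * c - j + (p - 1 - s))) ⊤) =
      (if j + (p - 1 - s) ≡ a [MOD p - 1] ∧ j ≤ κ + (p - 1) * c then 1 else 0) +
      (if j + (p - 1 - s) ≡ 0 [MOD p - 1] ∧ j ≤ κ + (p - 1) * c then 1 else 0) := by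
    intro j hj
    have hj := Nat.lt_succ_iff.1 (Finset.mem_range.1 hj)
    have hsum : j + (p - 1 - s) + (κ + (p - 1) * c - j + (p - 1 - s)) ≡ a [MOD p - 1] := by
      rwa [show j + (p - 1 - s) + (κ + (p - 1) * c - j + (p - 1 - s)) =
        κ + (p - 1) * c + 2 * (p - 1 - s) by omega]
    rw [hP.finrank_eqHom_borel ha (by omega)]
    congr 1
    · refine if_congr ⟨fun h => ⟨h.1, hj⟩, fun h => ⟨h.1, ?_⟩⟩ rfl rfl
      exact Nat.ModEq.add_left_cancel h.1 (by rwa [add_zero])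
    · refine if_congr ⟨fun h => ⟨h.1, hj⟩, fun h => ⟨h.1, ?_⟩⟩ rfl rfl
      exact Nat.ModEq.add_left_cancel h.1 (by rwa [zero_add])
  rw [Finset.sum_congr rfl hterm, Finset.sum_add_distrib]
  obtain hδ | hδ : deltaEps p a s = 0 ∨ deltaEps p a s = 1 := by omega
  · rw [hδ] at h5 ⊢
    rw [key s' a 1 h1 hm' le_rfl (by omega), key s 0 1 (by omega) hm le_rfl (by omega)]
    ring
  · rw [hδ] at h5 ⊢
    rw [key s' a 0 h1 hm' zero_le_one (by omega), key s 0 0 (by omega) hm zero_le_one (by omega)]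
    ring

end Counting

section Teichmuller

variable {p : ℕ} [Fact p.Prime] {O : Type*} [CommRing O] [IsDomain O] [IsDiscreteValuationRing O]
  [Algebra ℤ_[p] O] [Module.Finite ℤ_[p] O] [FaithfulSMul ℤ_[p] O]

lemma residue_teich [CharP (IsLocalRing.ResidueField O) p] (x : (ZMod p)ˣ) :
    IsLocalRing.residue O (teich p O x : O) = primeHom p (IsLocalRing.ResidueField O) x := by
  change IsLocalRing.residue O (algebraMap ℤ_[p] O
    (WittVector.equiv p (WittVector.teichmuller p (x : ZMod p)))) = _
  have h := ringHom_zmod_unique PadicInt.toZMod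
    ((WittVector.constantCoeff (p := p) (R := ZMod p)).comp (WittVector.equiv p).symm.toRingHom)
  rw [residue_algebraMap, h]
  simp

/-- The exponent `-s` of the Teichmüller character is replaced by `p - 1 - s ≥ 0`. -/
lemma residue_eq_of_teich [CharP (IsLocalRing.ResidueField O) p] {η : (ZMod p)ˣ →* Oˣ} {s : ℕ}
    (hs : s ≤ p - 2) (hη : ∀ x, η x = teich p O x ^ (-(s : ℤ))) (x : (ZMod p)ˣ) :
    IsLocalRing.residue O (η x : O) =
      primeHom p (IsLocalRing.ResidueField O) x ^ (p - 1 - s) := by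
  have hp := (Fact.out : p.Prime).two_le
  have h1 : teich p O x ^ (-(s : ℤ)) = teich p O x ^ (p - 1 - s) := by
    have h2 : teich p O x ^ (p - 1) = 1 := by
      rw [← map_pow, ZMod.units_pow_card_sub_one_eq_one, map_one]
    rw [zpow_neg, zpow_natCast, inv_eq_iff_mul_eq_one, ← pow_add, Nat.add_sub_cancel' (by omega),
      h2]
  rw [hη, h1, Units.val_pow_eq_pow_val, map_pow, residue_teich]

universe u

variable {H : Type u} [AddCommGroup H] [Module O H] [Module (iwasawaAlgebra p O)ᵐᵒᵖ H]
  [IsScalarTower O (iwasawaAlgebra p O)ᵐᵒᵖ H]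

/-- The ranks of the modules of forms of weights in the class of `k_ε`. -/
theorem IsPrimitive.rank_formulas {a s : ℕ} (hH : IsPrimitive p O a H) (hp : 5 ≤ p)
    (ha : 1 ≤ a) (ha' : a ≤ p - 4) (hs : s ≤ p - 2) {η : (ZMod p)ˣ →* Oˣ}
    (hη : ∀ x, η x = teich p O x ^ (-(s : ℤ))) (c : ℕ) :
    (∀ n, n < dUr p O H (kEps p a s + (p - 1) * c) η ↔ jump p a s n ≤ c) ∧
      dIw p O H (kEps p a s + (p - 1) * c) (doubled η) + 2 * deltaEps p a s = 2 * c + 2 := by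
  have := charP_residueField p O
  obtain ⟨P, _, _, _, _, _, hP, h⟩ := hH.exists_envelope
  obtain ⟨h1, h2⟩ := h (p - 1 - s) η (residue_eq_of_teich hs hη)
    ((a + 2 * s) % (p - 1) + (p - 1) * c)
  rw [kEps, add_assoc, add_comm 2, h1, h2]
  exact ⟨fun n => hP.lt_finrank_iff hp ha ha' hs, hP.finrank_borel_weight_eq hp ha ha' hs⟩

end Teichmuller

/-! ### Distances between the weight points -/

section WeightPoints

variable {p : ℕ} [Fact p.Prime]

lemma norm_factorial_inv (n : ℕ) :
    ‖((n.factorial : ℕ) : ℚ_[p])‖⁻¹ = (p : ℝ) ^ padicValNat p n.factorial := by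
  rw [Padic.norm_eq_zpow_neg_valuation (by exact_mod_cast n.factorial_ne_zero),
    Padic.valuation_natCast, zpow_neg, inv_inv, zpow_natCast]

lemma padicValNat_factorial_add_two_le (hp : 5 ≤ p) {n : ℕ} (hn : 2 ≤ n) :
    padicValNat p n.factorial + 2 ≤ n := by
  have h1 := sub_one_mul_padicValNat_factorial_lt_of_ne_zero p (n := n) (by omega)
  have h2 : 4 * padicValNat p n.factorial ≤ (p - 1) * padicValNat p n.factorial :=
    Nat.mul_le_mul_right _ (by omega)
  omega

/-- The terms of degree at least `2` of the exponential series contract on the disc of radius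
`1/p`. -/
lemma norm_exp_term_sub_le (hp : 5 ≤ p) {x y : ℚ_[p]} (hx : ‖x‖ ≤ (p : ℝ)⁻¹)
    (hy : ‖y‖ ≤ (p : ℝ)⁻¹) {n : ℕ} (hn : 2 ≤ n) :
    ‖x ^ n / (n.factorial : ℚ_[p]) - y ^ n / (n.factorial : ℚ_[p])‖ ≤ (p : ℝ)⁻¹ * ‖x - y‖ := by
  have hp0 : (0 : ℝ) < p := by exact_mod_cast (by omega : 0 < p)
  have hp1 : (1 : ℝ) ≤ p := by exact_mod_cast (by omega : 1 ≤ p)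
  have hgeom : ‖∑ i ∈ Finset.range n, x ^ i * y ^ (n - 1 - i)‖ ≤ (p : ℝ)⁻¹ ^ (n - 1) := by
    refine IsUltrametricDist.norm_sum_le_of_forall_le_of_nonneg (by positivity) fun i hi => ?_
    have hi := Finset.mem_range.1 hi
    rw [norm_mul, norm_pow, norm_pow]
    calc ‖x‖ ^ i * ‖y‖ ^ (n - 1 - i) ≤ (p : ℝ)⁻¹ ^ i * (p : ℝ)⁻¹ ^ (n - 1 - i) := by gcongr
      _ = (p : ℝ)⁻¹ ^ (n - 1) := by rw [← pow_add]; congr 1; omega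
  rw [← sub_div, ← (Commute.all x y).geom_sum₂_mul n, norm_div, norm_mul, div_eq_mul_inv,
    norm_factorial_inv, mul_right_comm]
  refine mul_le_mul_of_nonneg_right ?_ (norm_nonneg _)
  have hv := padicValNat_factorial_add_two_le hp hn
  calc _ ≤ (p : ℝ)⁻¹ ^ (n - 1) * (p : ℝ) ^ (n - 2) := by gcongr; omega
    _ = (p : ℝ)⁻¹ := by
      rw [show n - 1 = n - 2 + 1 by omega, pow_succ, mul_right_comm, ← mul_pow,
        inv_mul_cancel₀ hp0.ne', one_pow, one_mul]

lemma summable_exp (hp : 5 ≤ p) {x : ℚ_[p]} (hx : ‖x‖ ≤ (p : ℝ)⁻¹) :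
    Summable fun n : ℕ => x ^ n / (n.factorial : ℚ_[p]) := by
  have hp0 : (0 : ℝ) < p := by exact_mod_cast (by omega : 0 < p)
  have hp1 : (1 : ℝ) ≤ p := by exact_mod_cast (by omega : 1 ≤ p)
  refine NonarchimedeanAddGroup.summable_of_tendsto_cofinite_zero ?_
  rw [Nat.cofinite_eq_atTop, tendsto_zero_iff_norm_tendsto_zero]
  have hlim : Filter.Tendsto (fun n : ℕ => (p : ℝ)⁻¹ ^ (n / 2)) Filter.atTop (𝓝 0) :=
    (tendsto_pow_atTop_nhds_zero_of_lt_one (by positivity)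
      (inv_lt_one_of_one_lt₀ (by exact_mod_cast (by omega : 1 < p)))).comp
      (Nat.tendsto_div_const_atTop two_ne_zero)
  refine squeeze_zero' (Filter.Eventually.of_forall fun n => norm_nonneg _) ?_ hlim
  filter_upwards [Filter.eventually_ge_atTop 2] with n hn
  have h1 := sub_one_mul_padicValNat_factorial_lt_of_ne_zero p (n := n) (by omega)
  have h2 : 4 * padicValNat p n.factorial ≤ (p - 1) * padicValNat p n.factorial :=
    Nat.mul_le_mul_right _ (by omega)
  rw [norm_div, norm_pow, div_eq_mul_inv, norm_factorial_inv]
  calc ‖x‖ ^ n * (p : ℝ) ^ padicValNat p n.factorial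
      ≤ (p : ℝ)⁻¹ ^ n * (p : ℝ) ^ (n - n / 2) := by gcongr; omega
    _ = (p : ℝ)⁻¹ ^ (n / 2) := by
      conv_lhs => rw [← Nat.add_sub_cancel' (Nat.div_le_self n 2), pow_add, mul_assoc]
      rw [Nat.add_sub_cancel' (Nat.div_le_self n 2), ← mul_pow, inv_mul_cancel₀ hp0.ne', one_pow,
        mul_one]

/-- The exponential is an isometry on the disc of radius `1/p`. -/
lemma norm_exp_sub (hp : 5 ≤ p) {x y : ℚ_[p]} (hx : ‖x‖ ≤ (p : ℝ)⁻¹) (hy : ‖y‖ ≤ (p : ℝ)⁻¹) :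
    ‖NormedSpace.exp x - NormedSpace.exp y‖ = ‖x - y‖ := by
  rcases eq_or_ne x y with rfl | hne
  · simp
  have hpos : 0 < ‖x - y‖ := norm_pos_iff.2 (sub_ne_zero.2 hne)
  let f : ℕ → ℚ_[p] := fun n => x ^ n / (n.factorial : ℚ_[p]) - y ^ n / (n.factorial : ℚ_[p])
  have hf : HasSum f (NormedSpace.exp x - NormedSpace.exp y) := by
    rw [NormedSpace.exp_eq_tsum_div]
    exact (summable_exp hp hx).hasSum.sub (summable_exp hp hy).hasSum
  have htail : ‖NormedSpace.exp x - NormedSpace.exp y - (x - y)‖ ≤ (p : ℝ)⁻¹ * ‖x - y‖ := by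
    have h1 := (hasSum_nat_add_iff' 2).2 hf
    have h2 : ∑ i ∈ Finset.range 2, f i = x - y := by simp [f, Finset.sum_range_succ]
    rw [h2] at h1
    refine le_of_tendsto h1.tendsto_sum_nat.norm (Filter.Eventually.of_forall fun N => ?_)
    exact IsUltrametricDist.norm_sum_le_of_forall_le_of_nonneg (by positivity)
      fun i _ => norm_exp_term_sub_le hp hx hy (by omega)
  have hlt : ‖NormedSpace.exp x - NormedSpace.exp y - (x - y)‖ < ‖x - y‖ :=
    htail.trans_lt (mul_lt_of_lt_one_left hpos
      (inv_lt_one_of_one_lt₀ (by exact_mod_cast (by omega : 1 < p))))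
  exact Padic.norm_eq_of_norm_sub_lt_right hlt

/-- The `p`-adic distance of the weight points `w_k` and `w_l`. -/
lemma valuation_weightPt_sub (hp : 5 ≤ p) {k l : ℕ} (h : k ≠ l) :
    weightPt p k - weightPt p l ≠ 0 ∧
      (weightPt p k - weightPt p l).valuation = 1 + padicValInt p ((k : ℤ) - l) := by
  have hp0 : (p : ℚ_[p]) ≠ 0 := by exact_mod_cast (Fact.out : p.Prime).ne_zero
  have hsmall : ∀ k : ℕ, ‖(p : ℚ_[p]) * ((k : ℚ_[p]) - 2)‖ ≤ (p : ℝ)⁻¹ := by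
    intro k
    rw [norm_mul, Padic.norm_p]
    refine mul_le_of_le_one_right (by positivity) ?_
    have := Padic.norm_int_le_one (p := p) ((k : ℤ) - 2)
    exact_mod_cast this
  have hdiff : weightPt p k - weightPt p l = NormedSpace.exp ((p : ℚ_[p]) * ((k : ℚ_[p]) - 2)) -
      NormedSpace.exp ((p : ℚ_[p]) * ((l : ℚ_[p]) - 2)) := by
    rw [weightPt, weightPt]; ring
  have hkl : (((k : ℤ) - l : ℤ) : ℚ_[p]) ≠ 0 := by
    exact_mod_cast sub_ne_zero.2 (by exact_mod_cast h : (k : ℤ) ≠ l)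
  have hnorm : ‖weightPt p k - weightPt p l‖ = ‖(p : ℚ_[p]) * (((k : ℤ) - l : ℤ) : ℚ_[p])‖ := by
    rw [hdiff, norm_exp_sub hp (hsmall k) (hsmall l)]
    congr 1
    push_cast
    ring
  have hne : weightPt p k - weightPt p l ≠ 0 := by
    rw [← norm_ne_zero_iff, hnorm, norm_ne_zero_iff]
    exact mul_ne_zero hp0 hkl
  refine ⟨hne, ?_⟩
  rw [Padic.norm_eq_zpow_neg_valuation hne,
    Padic.norm_eq_zpow_neg_valuation (mul_ne_zero hp0 hkl),
    zpow_right_inj₀ (by exact_mod_cast (by omega : 0 < p)) (by exact_mod_cast (by omega : p ≠ 1)),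
    neg_inj, Padic.valuation_mul hp0 hkl, Padic.valuation_p, Padic.valuation_intCast] at hnorm
  exact hnorm

end WeightPoints

/-! ### Jump sequences and ghost multiplicities -/

section Jumps

/-- The properties of the sequence of jumps `K` of the unramified dimension that matter for the
comparison of slopes; `δ` stands for `δ_ε`. -/
structure IsJumpSeq (p δ : ℕ) (K : ℕ → ℕ) : Prop where
  five_le : 5 ≤ p
  le_one : δ ≤ 1
  add_two : ∀ n, K (n + 2) = K n + (p + 1)
  gap : ∀ n, K n + 3 ≤ K (n + 1)
  zero : δ ≤ K 0
  one : K 1 ≤ p + δ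

lemma isJumpSeq_jump {p a s : ℕ} (hp : 5 ≤ p) (ha : 1 ≤ a) (ha' : a ≤ p - 4) (hs : s ≤ p - 2) :
    IsJumpSeq p (deltaEps p a s) (jump p a s) := by
  obtain ⟨_, _, _, _, _, _, _, hδ, _⟩ := weight_relations hp ha' hs
  obtain ⟨h1, h2, h3, h4⟩ := tOne_add_three_le hp ha ha' hs
  refine ⟨hp, hδ, fun n => ?_, fun n => ?_, h3, ?_⟩
  · have h : (n + 2) / 2 = n / 2 + 1 := by omega
    have he : Even (n + 2) ↔ Even n := by simp [Nat.even_add]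
    simp only [jump, h, he]
    ring
  · rcases Nat.even_or_odd' n with ⟨m, rfl | rfl⟩
    · simp only [jump, even_two_mul, if_true, show (2 * m + 1) / 2 = 2 * m / 2 by omega]
      rw [if_neg (by simp)]
      omega
    · have h : (2 * m + 1 + 1) / 2 = (2 * m + 1) / 2 + 1 := by omega
      have he : Even (2 * m + 1 + 1) := by rw [show 2 * m + 1 + 1 = 2 * (m + 1) by ring]; simp
      simp only [jump, h, he, if_true]
      rw [if_neg (by simp), mul_add]
      omega
  · simp only [jump]
    rw [if_neg (by simp)]
    omega

namespace IsJumpSeq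

variable {p δ : ℕ} {K : ℕ → ℕ}

lemma add_two_mul (hK : IsJumpSeq p δ K) (n l : ℕ) : K (n + 2 * l) = K n + (p + 1) * l := by
  induction l with
  | zero => simp
  | succ l ih =>
    rw [show n + 2 * (l + 1) = n + 2 * l + 2 by ring, hK.add_two, ih]; ring

lemma add_three_mul_le (hK : IsJumpSeq p δ K) (n l : ℕ) : K n + 3 * l ≤ K (n + l) := by
  induction l with
  | zero => simp
  | succ l ih => have := hK.gap (n + l); rw [← add_assoc]; omega

lemma strictMono (hK : IsJumpSeq p δ K) : StrictMono K :=
  strictMono_nat_of_lt_succ fun n => by have := hK.gap n; omega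

lemma add_le (hK : IsJumpSeq p δ K) (n : ℕ) : n + δ ≤ K n := by
  have h1 := hK.add_three_mul_le 0 n
  have h2 := hK.zero
  rw [zero_add] at h1
  omega

/-- A jump exceeds the previous one by less than `p - 1`. -/
lemma succ_add_two_le (hK : IsJumpSeq p δ K) (n : ℕ) : K (n + 1) + 2 ≤ K n + p := by
  have h1 : K (n + 1) + 3 ≤ K (n + 2) := hK.gap (n + 1)
  have h2 := hK.add_two n
  omega

/-- `K` grows by `p + 1` in two steps, so it stays below the line `p l + n + δ` once `n < 2 l`. -/
lemma lt_of_two_mul_gt (hK : IsJumpSeq p δ K) {n l : ℕ} (h : n + 1 ≤ 2 * l) :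
    K n < p * l + n + δ := by
  have h0 : K 0 + 3 ≤ K 1 := hK.gap 0
  have h1 := hK.one
  rcases Nat.even_or_odd' n with ⟨e, rfl | rfl⟩
  · have h2 := hK.add_two_mul 0 e
    have h3 : p * (e + 1) ≤ p * l := Nat.mul_le_mul_left p (by omega)
    rw [zero_add] at h2
    rw [mul_add] at h3
    rw [add_mul] at h2
    omega
  · have h2 := hK.add_two_mul 1 e
    have h3 : p * (e + 1) ≤ p * l := Nat.mul_le_mul_left p (by omega)
    rw [mul_add] at h3
    rw [add_mul, add_comm 1] at h2
    omega

/-- The upper end of the range where the ghost multiplicities decrease. -/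
lemma mult_range_iff (hK : IsJumpSeq p δ K) {c n k D : ℕ} (hD : ∀ i, i < D ↔ K i ≤ k)
    (hkn : k < n + δ) :
    n + D + 2 * δ ≤ 2 * k + 1 ↔ (p : ℤ) * ((c : ℤ) - k) ≤
      ((p : ℤ) + 1) * ((c : ℤ) - n - δ) - ((c : ℤ) - K (n + 1)) - 1 := by
  obtain ⟨l, hl⟩ : ∃ l, n + δ = k + l := ⟨n + δ - k, by omega⟩
  have h1 : (p : ℤ) * ((c : ℤ) - k) ≤
      ((p : ℤ) + 1) * ((c : ℤ) - n - δ) - ((c : ℤ) - K (n + 1)) - 1 ↔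
      p * l + (n + δ + 1) ≤ K (n + 1) := by
    have hl' : (k : ℤ) = n + δ - l := by omega
    zify
    rw [hl']
    constructor <;> intro h <;> linarith
  rw [h1]
  constructor
  · intro h
    obtain ⟨j, hj⟩ : ∃ j, n + 1 = j + 2 * l := ⟨n + 1 - 2 * l, by omega⟩
    have h2 : ¬ K j ≤ k := by rw [← hD]; omega
    rw [hj, hK.add_two_mul, add_mul]
    omega
  · intro h
    have h2 : 2 * l ≤ n + 1 := by
      by_contra! h3
      have := hK.lt_of_two_mul_gt (n := n + 1) (l := l) (by omega)
      omega
    obtain ⟨j, hj⟩ : ∃ j, n + 1 = j + 2 * l := ⟨n + 1 - 2 * l, by omega⟩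
    rw [hj, hK.add_two_mul, add_mul] at h
    have h3 : ¬ j < D := by rw [hD]; omega
    omega

/-- From `n` to `n + 1` the ghost multiplicity at the index `k` rises by `1` if `n + δ ≤ k < K n`,
drops by `1` on a range of indices below `n + δ`, and is constant otherwise. The range is written in terms
of the distance `c - k`. -/
lemma mult_succ_sub (hK : IsJumpSeq p δ K) {c n k D I : ℕ} (hD : ∀ i, i < D ↔ K i ≤ k)
    (hI : I + 2 * δ = 2 * k + 2) :
    ((if D < n + 1 ∧ n + 1 < I - D then min (n + 1 - D) (I - D - (n + 1)) else 0 : ℕ) : ℤ) -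
      ((if D < n ∧ n < I - D then min (n - D) (I - D - n) else 0 : ℕ) : ℤ) =
    (if n + δ ≤ k ∧ k < K n then 1 else 0) -
      if k < n + δ ∧ (p : ℤ) * ((c : ℤ) - k) ≤
        ((p : ℤ) + 1) * ((c : ℤ) - n - δ) - ((c : ℤ) - K (n + 1)) - 1 then 1 else 0 := by
  have hDle : D + δ ≤ k + 1 := by
    rcases Nat.eq_zero_or_pos D with h | h
    · have := hK.le_one; omega
    · have h1 := (hD (D - 1)).1 (by omega)
      have h2 := hK.add_le (D - 1)
      omega
  have h1 : k < K n ↔ D ≤ n := by rw [← not_lt, ← not_le, not_iff_not, hD]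
  by_cases hkn : k < n + δ
  · simp only [hkn, true_and, ← hK.mult_range_iff (c := c) hD hkn, h1]
    split_ifs <;> omega
  · simp only [hkn, false_and, if_false, h1]
    split_ifs <;> omega

end IsJumpSeq

end Jumps

/-! ### The increments of the ghost valuations -/

/-- Legendre's formula for `x + v(x!) = v((p x)!)`. -/
lemma sum_range_one_add_padicValNat {p : ℕ} [hp : Fact p.Prime] {b x : ℕ} (hx : x < p ^ b) :
    ∑ j ∈ Finset.range x, (1 + padicValNat p (j + 1) : ℤ) =
      ∑ j ∈ Finset.range b, (x : ℤ) / (p : ℤ) ^ j := by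
  induction x with
  | zero => simp
  | succ x ih =>
    rw [Finset.sum_range_succ, ih (by omega)]
    have h1 : padicValNat p (x + 1) < b := by
      by_contra! h
      exact absurd (Nat.le_of_dvd (by omega) ((padicValNat_dvd_iff_le (by omega)).2 h)) (by omega)
    have h2 : ∀ j, ((x + 1 : ℕ) : ℤ) / (p : ℤ) ^ j =
        (x : ℤ) / (p : ℤ) ^ j + if j ≤ padicValNat p (x + 1) then 1 else 0 := fun j => by
      have h3 := Nat.succ_div (a := x) (b := p ^ j)
      simp only [padicValNat_dvd_iff_le (p := p) (show x + 1 ≠ 0 by omega)] at h3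
      exact_mod_cast h3
    simp only [h2, Finset.sum_add_distrib, add_right_inj]
    rw [Finset.sum_boole, show (Finset.range b).filter (fun j => j ≤ padicValNat p (x + 1)) =
      Finset.range (1 + padicValNat p (x + 1)) by ext j; simp; omega]
    simp

lemma sum_range_ite_lt {c x : ℕ} (hx : x ≤ c) (f : ℕ → ℤ) :
    ∑ j ∈ Finset.range c, (if j < x then f j else 0) = ∑ j ∈ Finset.range x, f j := by
  rw [← Finset.sum_filter]
  congr 1
  ext j
  simp
  omega

namespace IsJumpSeq

variable {p δ : ℕ} {K : ℕ → ℕ}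

/-- The valuation of the `n`-th ghost coefficient at the weight point with index `c`, in terms of
the dimensions `D k` and `I k` of the spaces of forms of unramified and Iwahori level. Only the
indices `k < c` are taken into account. -/
def ghostVal (p c : ℕ) (D I : ℕ → ℕ) (n : ℕ) : ℤ :=
  ∑ k ∈ Finset.range c,
    ((if D k < n ∧ n < I k - D k then min (n - D k) (I k - D k - n) else 0 : ℕ) : ℤ)
    * (1 + padicValNat p (c - k))

/-- The contribution of the power `q` of `p` to the increment of `ghostVal`. -/
def incr (p δ c : ℕ) (K : ℕ → ℕ) (q : ℤ) (n : ℕ) : ℤ :=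
  ((c : ℤ) - n - δ) / q + (p * ((c : ℤ) - n - δ)) / q - ((c : ℤ) - K n) / q -
    (((p : ℤ) + 1) * ((c : ℤ) - n - δ) - ((c : ℤ) - K (n + 1)) - 1) / q

lemma le_add_mul (hK : IsJumpSeq p δ K) (n l : ℕ) : K (n + l) + 2 * l ≤ K n + p * l := by
  induction l with
  | zero => simp
  | succ l ih =>
    have := hK.succ_add_two_le (n + l)
    have h : p * (l + 1) = p * l + p := by ring
    rw [← add_assoc]
    omega

/-- The increment of `ghostVal`, with the contributions of the powers of `p` separated. The
multiplicity rises by `1` at the distances `c - k` in `(u, y]` and drops by `1` at those in `(y,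
z]`. -/
lemma ghostVal_succ_sub [Fact p.Prime] (hK : IsJumpSeq p δ K) {c n b : ℕ} {D I : ℕ → ℕ}
    (hD : ∀ k i, i < D k ↔ K i ≤ k) (hI : ∀ k, I k + 2 * δ = 2 * k + 2) (hn : K n ≤ c)
    (hb : c < p ^ b) :
    ghostVal p c D I (n + 1) - ghostVal p c D I n =
      ((K n : ℤ) - n - δ) + ∑ j ∈ Finset.range b, incr p δ c K ((p : ℤ) ^ (j + 1)) n := by
  have h1 := hK.add_le n
  have h2 := hK.add_le (n + 1)
  have h3 : K (n + 1) ≤ (p + 1) * (n + δ) + p := by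
    have h4 := hK.le_add_mul 1 n
    have h5 := hK.one
    rw [add_comm 1 n] at h4
    nlinarith
  have hp0 : (0 : ℤ) < p := by have := hK.five_le; omega
  obtain ⟨y, hy⟩ : ∃ y, y = c - n - δ := ⟨_, rfl⟩
  obtain ⟨u, hu⟩ : ∃ u, u = c - K n := ⟨_, rfl⟩
  have hyZ : (c : ℤ) - n - δ = y := by omega
  have huZ : (c : ℤ) - K n = u := by omega
  obtain ⟨N, hN⟩ : ∃ N : ℤ, N = ((p : ℤ) + 1) * ((c : ℤ) - n - δ) - ((c : ℤ) - K (n + 1)) - 1 :=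
    ⟨_, rfl⟩
  have hNy : (y : ℤ) ≤ N / p := by
    rw [Int.le_ediv_iff_mul_le hp0, hN, hyZ]
    linarith
  have hNc : N / p ≤ c := by
    rw [← Int.lt_add_one_iff, Int.ediv_lt_iff_lt_mul hp0, hN]
    zify at h3
    linarith
  obtain ⟨z, hz⟩ : ∃ z : ℕ, N / p = z := ⟨(N / p).toNat, by omega⟩
  have key : ghostVal p c D I (n + 1) - ghostVal p c D I n =
      ∑ j ∈ Finset.range c, ((2 * if j < y then (1 + padicValNat p (j + 1) : ℤ) else 0) -
        (if j < u then (1 + padicValNat p (j + 1) : ℤ) else 0) -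
        if j < z then (1 + padicValNat p (j + 1) : ℤ) else 0) := by
    rw [ghostVal, ghostVal, ← Finset.sum_sub_distrib, ← Finset.sum_range_reflect]
    refine Finset.sum_congr rfl fun j hj => ?_
    rw [Finset.mem_range] at hj
    have h4 : (p : ℤ) * ((c : ℤ) - (c - 1 - j : ℕ)) ≤ N ↔ j < z := by
      rw [mul_comm, ← Int.le_ediv_iff_mul_le hp0, hz]
      omega
    rw [← sub_mul, hK.mult_succ_sub (c := c) (hD _) (hI _), ← hN,
      show c - (c - 1 - j) = j + 1 by omega]
    simp only [h4, show n + δ ≤ c - 1 - j ↔ j < y by omega, show c - 1 - j < K n ↔ ¬ j < u by omega,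
      show c - 1 - j < n + δ ↔ ¬ j < y by omega]
    have h5 : j < u → j < y := by omega
    have h6 : j < y → j < z := by omega
    by_cases h7 : j < u
    · simp [h7, h5 h7, h6 (h5 h7)]
      ring
    by_cases h8 : j < y
    · simp [h7, h8, h6 h8]
      ring
    simp [h7, h8]
  rw [key]
  simp only [Finset.sum_sub_distrib, ← Finset.mul_sum]
  rw [sum_range_ite_lt (by omega), sum_range_ite_lt (by omega), sum_range_ite_lt (by omega),
    sum_range_one_add_padicValNat (b := b) (by omega),
    sum_range_one_add_padicValNat (b := b) (by omega),
    sum_range_one_add_padicValNat (b := b) (by omega)]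
  have h0 : ∀ x : ℕ, x ≤ c → ∑ j ∈ Finset.range b, (x : ℤ) / (p : ℤ) ^ j =
      x + ∑ j ∈ Finset.range b, (x : ℤ) / (p : ℤ) ^ (j + 1) := fun x hx => by
    have h5 : (x : ℤ) / (p : ℤ) ^ b = 0 :=
      Int.ediv_eq_zero_of_lt (by omega) (by exact_mod_cast lt_of_le_of_lt hx hb)
    have h6 := Finset.sum_range_succ (fun j => (x : ℤ) / (p : ℤ) ^ j) b
    rw [Finset.sum_range_succ', h5, pow_zero, Int.ediv_one] at h6
    linarith
  have hz' : ∀ j, (z : ℤ) / (p : ℤ) ^ j = N / (p : ℤ) ^ (j + 1) := fun j => by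
    rw [← hz, Int.ediv_ediv_of_nonneg hp0.le, pow_succ']
  have hy' : ∀ j, (y : ℤ) / (p : ℤ) ^ j = (p * (y : ℤ)) / (p : ℤ) ^ (j + 1) := fun j => by
    rw [pow_succ', Int.mul_ediv_mul_of_pos _ _ hp0]
  rw [hyZ] at hN
  simp only [incr, hyZ, huZ, Finset.sum_sub_distrib, Finset.sum_add_distrib, ← hy', ← hN, hz']
  rw [h0 y (by omega), h0 u (by omega), show (K n : ℤ) - n - δ = y - u by omega]
  have h7 := h0 y (by omega)
  linarith

section Bounds

variable {c n d : ℕ}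

/-- A contribution is at most `1` plus a telescoping term, by superadditivity of the floor. -/
lemma incr_le {q : ℤ} (hq : 0 < q) (i : ℕ) :
    incr p δ c K q i ≤ 1 + ((c : ℤ) - K (i + 1)) / q - ((c : ℤ) - K i) / q := by
  have hadd : ∀ x y : ℤ, x / q + y / q ≤ (x + y) / q := fun x y => by
    rw [Int.le_ediv_iff_mul_le hq]
    have h1 := Int.ediv_mul_le x hq.ne'
    have h2 := Int.ediv_mul_le y hq.ne'
    linarith
  have hadd' : ∀ x y : ℤ, (x + y + 1) / q ≤ x / q + y / q + 1 := fun x y => by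
    rw [← Int.lt_add_one_iff, Int.ediv_lt_iff_lt_mul hq]
    have h1 := Int.lt_ediv_add_one_mul_self x hq
    have h2 := Int.lt_ediv_add_one_mul_self y hq
    linarith
  rw [incr]
  have h1 := hadd ((c : ℤ) - i - δ) (p * ((c : ℤ) - i - δ))
  have h2 := hadd' (((p : ℤ) + 1) * ((c : ℤ) - i - δ) - ((c : ℤ) - K (i + 1)) - 1)
    ((c : ℤ) - K (i + 1))
  rw [show ((p : ℤ) + 1) * ((c : ℤ) - i - δ) - ((c : ℤ) - K (i + 1)) - 1 + ((c : ℤ) - K (i + 1)) + 1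
    = (c : ℤ) - i - δ + p * ((c : ℤ) - i - δ) by ring] at h2
  linarith

/-- Each power of `p` contributes less than the number of steps. -/
lemma sum_incr_le {q : ℤ} (hq : 0 < q) (hd : ∀ i, i < d ↔ K i ≤ c)
    (hn : n < d) : ∑ i ∈ Finset.Ico n d, incr p δ c K q i ≤ (d : ℤ) - n - 1 := by
  have h1 : ∑ i ∈ Finset.Ico n d, incr p δ c K q i ≤
      ∑ i ∈ Finset.Ico n d, (1 + (((c : ℤ) - K (i + 1)) / q - ((c : ℤ) - K i) / q)) :=
    Finset.sum_le_sum fun i _ => by have := incr_le (p := p) (δ := δ) (c := c) (K := K) hq i; linarith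
  rw [Finset.sum_add_distrib, Finset.sum_Ico_sub (fun i => ((c : ℤ) - K i) / q) hn.le] at h1
  have h2 : ((c : ℤ) - K d) / q < 0 :=
    Int.ediv_lt_of_lt_mul hq (by have := mt (hd d).2 (lt_irrefl _); simp; omega)
  have h3 : 0 ≤ ((c : ℤ) - K n) / q :=
    Int.ediv_nonneg (by have := (hd n).1 hn; omega) hq.le
  simp [Nat.cast_sub hn.le] at h1
  linarith

/-- Large powers of `p` contribute nothing positive: a step of contribution `1`, at a residue `r` of
`c - i - δ` with `(p + 1) r ≤ c - K (i + 1)`, is followed by at most `r` such steps, and then by more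
than `r` steps of contribution at most `-1`, because `K` grows by `p + 1` in two steps. -/
lemma sum_incr_nonpos (hK : IsJumpSeq p δ K) {q : ℤ} (hd : ∀ i, i < d ↔ K i ≤ c) (hn : n < d)
    (hq : p * ((c : ℤ) - K n) < q)
    (hq' : ((p : ℤ) + 1) * ((d : ℤ) - n) + ((c : ℤ) - K n) + 1 ≤ q) :
    ∑ i ∈ Finset.Ico n d, incr p δ c K q i ≤ 0 := by
  have hp5 : (5 : ℤ) ≤ p := by have := hK.five_le; omega
  have hun : (0 : ℤ) ≤ (c : ℤ) - K n := by have := (hd n).1 hn; omega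
  have hnd : (1 : ℤ) ≤ (d : ℤ) - n := by omega
  have hq0 : 0 < q := by nlinarith
  -- the contribution in terms of the residue of `c - i - δ`
  have hT : ∀ i ∈ Finset.Ico n d, ∀ r Y : ℤ, (c : ℤ) - i - δ = q * Y + r →
      incr p δ c K q i = r / q + (p * r) / q -
        (((p : ℤ) + 1) * r - ((c : ℤ) - K (i + 1)) - 1) / q := by
    intro i hi r Y h
    rw [Finset.mem_Ico] at hi
    have h1 : ((c : ℤ) - K i) / q = 0 := by
      have := (hd i).1 hi.2
      have := hK.strictMono.monotone hi.1
      refine Int.ediv_eq_zero_of_lt (by omega) ?_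
      nlinarith
    have h2 : (q * Y + r) / q = Y + r / q := by
      rw [add_comm, Int.add_mul_ediv_left _ _ hq0.ne', add_comm]
    have h3 : (p * (q * Y + r)) / q = p * Y + p * r / q := by
      rw [show p * (q * Y + r) = p * r + q * (p * Y) by ring, Int.add_mul_ediv_left _ _ hq0.ne',
        add_comm]
    have h4 : (((p : ℤ) + 1) * (q * Y + r) - ((c : ℤ) - K (i + 1)) - 1) / q =
        (p + 1) * Y + (((p : ℤ) + 1) * r - ((c : ℤ) - K (i + 1)) - 1) / q := by
      rw [show ((p : ℤ) + 1) * (q * Y + r) - ((c : ℤ) - K (i + 1)) - 1 =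
        (((p : ℤ) + 1) * r - ((c : ℤ) - K (i + 1)) - 1) + q * ((p + 1) * Y) by ring,
        Int.add_mul_ediv_left _ _ hq0.ne', add_comm]
    rw [incr, h, h1, h2, h3, h4]
    ring
  have hu : ∀ i, n ≤ i → (c : ℤ) - K (i + 1) ≤ (c : ℤ) - K n := fun i hi => by
    have := hK.strictMono.monotone (show n ≤ i + 1 by omega)
    omega
  have hone : ∀ i ∈ Finset.Ico n d, incr p δ c K q i ≤ 1 ∧ (0 < incr p δ c K q i →
      ((p : ℤ) + 1) * (((c : ℤ) - i - δ) % q) ≤ (c : ℤ) - K (i + 1)) := by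
    intro i hi
    have hui := hu i (Finset.mem_Ico.1 hi).1
    obtain ⟨r, hr⟩ : ∃ r, r = ((c : ℤ) - i - δ) % q := ⟨_, rfl⟩
    have hr0 : 0 ≤ r := hr ▸ Int.emod_nonneg _ hq0.ne'
    have hrq : r < q := hr ▸ Int.emod_lt_of_pos _ hq0
    rw [hT i hi r (((c : ℤ) - i - δ) / q) (by rw [hr, Int.mul_ediv_add_emod]), ← hr,
      Int.ediv_eq_zero_of_lt hr0 hrq]
    rcases lt_or_ge (p * r) q with h | h
    · rw [Int.ediv_eq_zero_of_lt (by positivity) h]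
      have h1 : -1 ≤ (((p : ℤ) + 1) * r - ((c : ℤ) - K (i + 1)) - 1) / q := by
        rw [Int.le_ediv_iff_mul_le hq0]
        nlinarith
      refine ⟨by linarith, fun h2 => ?_⟩
      by_contra! h3
      have : 0 ≤ (((p : ℤ) + 1) * r - ((c : ℤ) - K (i + 1)) - 1) / q :=
        Int.ediv_nonneg (by linarith) hq0.le
      linarith
    · have h1 : (c : ℤ) - K n < r := by
        by_contra! h2
        nlinarith
      have h2 : p * r / q ≤ (((p : ℤ) + 1) * r - ((c : ℤ) - K (i + 1)) - 1) / q :=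
        Int.ediv_le_ediv hq0 (by linarith)
      exact ⟨by linarith, fun h3 => by linarith⟩
  by_cases hex : ∃ i, i ∈ Finset.Ico n d ∧ 0 < incr p δ c K q i
  swap
  · push Not at hex
    exact Finset.sum_nonpos hex
  classical
  obtain ⟨i₁, ⟨hi₁, hpos⟩, hmin⟩ : ∃ i, (i ∈ Finset.Ico n d ∧ 0 < incr p δ c K q i) ∧
      ∀ j < i, ¬ (j ∈ Finset.Ico n d ∧ 0 < incr p δ c K q j) :=
    ⟨Nat.find hex, Nat.find_spec hex, fun j hj => Nat.find_min hex hj⟩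
  have hi₁' := Finset.mem_Ico.1 hi₁
  obtain ⟨r, hr⟩ : ∃ r : ℕ, ((c : ℤ) - i₁ - δ) % q = r :=
    ⟨_, (Int.toNat_of_nonneg (Int.emod_nonneg _ hq0.ne')).symm⟩
  have h1 := (hone i₁ hi₁).2 hpos
  rw [hr] at h1
  have h2 : i₁ + 1 + 2 * r < d := by
    rw [hd, hK.add_two_mul]
    zify
    linarith
  rw [← Finset.sum_Ico_consecutive _ hi₁'.1 hi₁'.2.le,
    ← Finset.sum_Ico_consecutive _ (show i₁ ≤ i₁ + r + 1 by omega) (show i₁ + r + 1 ≤ d by omega)]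
  have hA : ∑ i ∈ Finset.Ico n i₁, incr p δ c K q i ≤ 0 := Finset.sum_nonpos fun i hi => by
    by_contra! h
    rw [Finset.mem_Ico] at hi
    exact hmin i hi.2 ⟨Finset.mem_Ico.2 (by omega), h⟩
  have hB : ∑ i ∈ Finset.Ico i₁ (i₁ + r + 1), incr p δ c K q i ≤ r + 1 := by
    refine (Finset.sum_le_card_nsmul _ _ 1 fun i hi => (hone i ?_).1).trans ?_
    · rw [Finset.mem_Ico] at hi ⊢
      omega
    · simp [add_assoc]
  have hC : ∑ i ∈ Finset.Ico (i₁ + r + 1) d, incr p δ c K q i ≤ -((d : ℤ) - (i₁ + r + 1)) := by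
    refine (Finset.sum_le_card_nsmul _ _ (-1) fun i hi => ?_).trans ?_
    · rw [Finset.mem_Ico] at hi
      have hi' : i ∈ Finset.Ico n d := Finset.mem_Ico.2 (by omega)
      have hui := hu i (Finset.mem_Ico.1 hi').1
      obtain ⟨t, rfl⟩ : ∃ t, i = i₁ + r + t := ⟨i - i₁ - r, by omega⟩
      have ht : (1 : ℤ) ≤ t := by omega
      have htm : (t : ℤ) + 1 ≤ (d : ℤ) - n := by omega
      have hpt : ((p : ℤ) + 1) * t ≤ (p + 1) * ((d : ℤ) - n) := by nlinarith
      have hptn : 0 < (p : ℤ) * t := by positivity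
      rw [hT _ hi' (-t) (((c : ℤ) - i₁ - δ) / q) (by
        have := Int.mul_ediv_add_emod ((c : ℤ) - i₁ - δ) q
        push_cast
        linarith)]
      have h3 : -(t : ℤ) / q < 0 := Int.ediv_lt_of_lt_mul hq0 (by linarith)
      have h4 : p * -(t : ℤ) / q < 0 := Int.ediv_lt_of_lt_mul hq0 (by linarith)
      have h5 : -1 ≤ (((p : ℤ) + 1) * -t - ((c : ℤ) - K (i₁ + r + t + 1)) - 1) / q := by
        rw [Int.le_ediv_iff_mul_le hq0]
        linarith
      linarith
    · simp [Nat.cast_sub (show i₁ + r + 1 ≤ d by omega)]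
  have h2' : (i₁ : ℤ) + 1 + 2 * r + 1 ≤ d := by exact_mod_cast h2
  linarith

/-- As `K i - i` grows by at least `2` in each step, its partial sums lag behind the multiple of
the last term. -/
lemma sum_slack (hK : IsJumpSeq p δ K) (n m : ℕ) :
    ∑ i ∈ Finset.range m, ((K (n + i) : ℤ) - (n + i : ℕ) - δ) + m * ((m : ℤ) - 1) ≤
      m * ((K (n + m - 1) : ℤ) - ((n : ℤ) + m - 1) - δ) := by
  induction m with
  | zero => simp
  | succ m ih =>
    rw [Finset.sum_range_succ, show n + (m + 1) - 1 = n + m by omega]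
    rcases Nat.eq_zero_or_pos m with rfl | hm
    · simp
    have h1 := hK.gap (n + m - 1)
    rw [show n + m - 1 + 1 = n + m by omega] at h1
    have h2 : (m : ℤ) * ((K (n + m - 1) : ℤ) + 3) ≤ m * K (n + m) := by
      exact_mod_cast Nat.mul_le_mul_left m h1
    push_cast at ih ⊢
    linarith

/-- The slope of `ghostVal` over `[n, d]` is at most `K (d - 1) - (d - 1) - δ`. -/
theorem ghostVal_sub_le [Fact p.Prime] (hK : IsJumpSeq p δ K) {D I : ℕ → ℕ}
    (hD : ∀ k i, i < D k ↔ K i ≤ k) (hI : ∀ k, I k + 2 * δ = 2 * k + 2) (hn : n < D c) :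
    ghostVal p c D I (D c) - ghostVal p c D I n ≤
      ((D c : ℤ) - n) * ((K (D c - 1) : ℤ) - ((D c : ℤ) - 1) - δ) := by
  have hp5 := hK.five_le
  obtain ⟨m, hm⟩ : ∃ m, D c = n + m := ⟨D c - n, by omega⟩
  have hm1 : 1 ≤ m := by omega
  have hb : c < p ^ c := Nat.lt_pow_self (by omega)
  have h1 : ghostVal p c D I (D c) - ghostVal p c D I n =
      ∑ i ∈ Finset.Ico n (D c), ((K i : ℤ) - i - δ) +
        ∑ j ∈ Finset.range c, ∑ i ∈ Finset.Ico n (D c), incr p δ c K ((p : ℤ) ^ (j + 1)) i := by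
    rw [← Finset.sum_Ico_sub _ hn.le, Finset.sum_comm, ← Finset.sum_add_distrib]
    refine Finset.sum_congr rfl fun i hi => ?_
    exact hK.ghostVal_succ_sub hD hI ((hD _ _).1 (Finset.mem_Ico.1 hi).2) hb
  have hlarge : ∀ j, m ≤ j →
      ∑ i ∈ Finset.Ico n (D c), incr p δ c K ((p : ℤ) ^ (j + 1)) i ≤ 0 := by
    intro j hj
    have h2 : c < K (D c) := by have := mt (hD c (D c)).2 (lt_irrefl _); omega
    have h3 := hK.le_add_mul n m
    rw [← hm] at h3
    have h4 : p ^ 2 * m ≤ p ^ (j + 1) :=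
      calc p ^ 2 * m ≤ p ^ 2 * p ^ (m - 1) := Nat.mul_le_mul_left _ (by
              have := Nat.lt_pow_self (n := m - 1) (show 1 < p by omega); omega)
        _ = p ^ (m + 1) := by rw [← pow_add]; congr 1; omega
        _ ≤ p ^ (j + 1) := Nat.pow_le_pow_right (by omega) (by omega)
    have h5 : (K (D c) : ℤ) + 2 * m ≤ K n + p * m := by exact_mod_cast h3
    have h6 : (p : ℤ) ^ 2 * m ≤ (p : ℤ) ^ (j + 1) := by exact_mod_cast h4
    have h7 : (c : ℤ) + 1 ≤ K (D c) := by exact_mod_cast h2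
    have h8 : (5 : ℤ) ≤ p := by exact_mod_cast hp5
    have h9 : (1 : ℤ) ≤ m := by exact_mod_cast hm1
    have h10 : (c : ℤ) - K n ≤ (p - 2) * m - 1 := by linarith
    refine hK.sum_incr_nonpos (hD c) hn (lt_of_lt_of_le ?_ h6) (le_trans ?_ h6)
    · nlinarith
    · have h11 : 0 ≤ ((p : ℤ) - 1) ^ 2 * m := by positivity
      rw [hm]
      push_cast
      linarith
  have h2 : ∑ j ∈ Finset.range c, ∑ i ∈ Finset.Ico n (D c), incr p δ c K ((p : ℤ) ^ (j + 1)) i ≤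
      m * ((m : ℤ) - 1) := by
    calc _ ≤ ∑ j ∈ Finset.range c, if j < m then (m : ℤ) - 1 else 0 := by
          refine Finset.sum_le_sum fun j _ => ?_
          split_ifs with h
          · have := sum_incr_le (p := p) (δ := δ) (q := (p : ℤ) ^ (j + 1)) (by positivity) (hD c) hn
            rw [hm] at this ⊢
            push_cast at this
            linarith
          · exact hlarge j (by omega)
      _ ≤ ∑ j ∈ Finset.range (max c m), if j < m then (m : ℤ) - 1 else 0 := by
          refine Finset.sum_le_sum_of_subset_of_nonneg (by simp) fun j _ _ => ?_
          split_ifs <;> omega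
      _ = _ := by rw [sum_range_ite_lt (by simp)]; simp; ring
  have h3 := hK.sum_slack n m
  rw [h1, Finset.sum_Ico_eq_sum_range, hm, show n + m - n = m by omega]
  rw [hm] at h2
  push_cast at h3 ⊢
  linarith

end Bounds

end IsJumpSeq

/-! ### Slopes of Newton polygons -/

section NewtonPolygon

variable {p : ℕ} [Fact p.Prime]

/-- If the points of index at most `d` lie on or above the line of slope `M` through the `d`-th one,
then the first `d` slopes are at most `M`, wherever the points of larger index are. -/
theorem newtonSlope_le {F : PowerSeries ℚ_[p]} {d : ℕ} {M : ℝ}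
    (h1 : ∀ n, ‖PowerSeries.coeff n F‖ ≤ 1) (h0 : ∀ n ≤ d, PowerSeries.coeff n F ≠ 0)
    (hM : ∀ n ≤ d, ((PowerSeries.coeff d F).valuation : ℝ) - (PowerSeries.coeff n F).valuation ≤
      M * ((d : ℝ) - n)) {i : ℕ} (hi : 1 ≤ i) (hid : i ≤ d) : newtonSlope F i ≤ M := by
  set S : Set (ℝ × ℝ) := {P | ∃ n : ℕ, PowerSeries.coeff n F ≠ 0 ∧
    P = ((n : ℝ), ((PowerSeries.coeff n F).valuation : ℝ))} with hS
  have hmem : ∀ n ≤ d, ((n : ℝ), ((PowerSeries.coeff n F).valuation : ℝ)) ∈ newtonHull F :=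
    fun n hn => subset_convexHull ℝ _ ⟨n, h0 n hn, rfl⟩
  have hbdd : BddBelow {y | ((i : ℝ), y) ∈ newtonHull F} := by
    refine ⟨0, fun y hy => ?_⟩
    have hsub : newtonHull F ⊆ {P : ℝ × ℝ | (0 : ℝ) ≤ P.2} := by
      refine convexHull_min ?_ (convex_halfSpace_ge (LinearMap.snd ℝ ℝ ℝ).isLinear 0)
      rintro P ⟨n, hn, rfl⟩
      have := (Padic.norm_le_one_iff_val_nonneg _).1 (h1 n)
      simpa using this
    exact hsub hy
  rw [newtonSlope, sub_le_comm]
  refine le_csInf ⟨_, by simpa [Nat.cast_sub hi] using hmem (i - 1) (by omega)⟩ fun y hy => ?_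
  rw [sub_le_iff_le_add]
  have hy : (((i : ℝ) - 1, y) : ℝ × ℝ) ∈ newtonHull F := hy
  -- a point of the hull beyond `i`, not above the line of slope `M` through the given one
  obtain ⟨R, hR, hRx, hRy⟩ : ∃ R ∈ newtonHull F, (i : ℝ) ≤ R.1 ∧
      R.2 - M * R.1 ≤ y - M * ((i : ℝ) - 1) := by
    rcases le_or_gt ((PowerSeries.coeff d F).valuation - M * (d : ℝ)) (y - M * ((i : ℝ) - 1))
      with h | h
    · exact ⟨_, hmem d le_rfl, by simpa using hid, h⟩
    · obtain ⟨R, hRS, hR⟩ : ∃ R ∈ S, R.2 - M * R.1 ≤ y - M * ((i : ℝ) - 1) := by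
        by_contra! hall
        have hsub : newtonHull F ⊆ {P : ℝ × ℝ | y - M * ((i : ℝ) - 1) < P.2 - M * P.1} :=
          convexHull_min hall (convex_halfSpace_gt
            (LinearMap.snd ℝ ℝ ℝ - M • LinearMap.fst ℝ ℝ ℝ).isLinear _)
        exact lt_irrefl (y - M * ((i : ℝ) - 1)) (hsub hy)
      refine ⟨R, subset_convexHull ℝ _ hRS, ?_, hR⟩
      obtain ⟨n, hn, rfl⟩ := hRS
      have hdn : d ≤ n := by
        by_contra! hnd
        have := hM n hnd.le
        simp only at hR
        linarith
      simpa using hid.trans hdn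
  have hpos : 0 < R.1 - ((i : ℝ) - 1) := by linarith
  obtain ⟨t, ht⟩ : ∃ t : ℝ, t = (R.1 - ((i : ℝ) - 1))⁻¹ := ⟨_, rfl⟩
  have ht0 : 0 ≤ t := ht ▸ inv_nonneg.2 hpos.le
  have ht1 : t ≤ 1 := ht ▸ inv_le_one_of_one_le₀ (by linarith)
  have htR : t * (R.1 - ((i : ℝ) - 1)) = 1 := ht ▸ inv_mul_cancel₀ hpos.ne'
  have hQ := (convex_convexHull ℝ S) hy hR (sub_nonneg.2 ht1) ht0 (by ring)
  have hQx : ((1 - t) • (((i : ℝ) - 1, y) : ℝ × ℝ) + t • R) = ((i : ℝ), (1 - t) * y + t * R.2) := by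
    ext
    · simp
      linarith
    · simp
  rw [hQx] at hQ
  refine (csInf_le hbdd hQ).trans ?_
  have hMt : M * (t * (R.1 - ((i : ℝ) - 1))) = M := by rw [htR, mul_one]
  linarith [mul_le_mul_of_nonneg_left hRy ht0]

end NewtonPolygon

/-! ### Ghost coefficients at classical weights -/

section GhostCoeff

lemma setOf_weight_eq_range {p : ℕ} (hp : 5 ≤ p) {κ : ℕ} (h2 : 2 ≤ κ) (hκ : κ ≤ p) :
    {k : ℕ | 2 ≤ k ∧ k ≡ κ [MOD p - 1]} = Set.range fun c => κ + (p - 1) * c := by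
  ext k
  simp only [Set.mem_ofPred_eq, Set.mem_range]
  constructor
  · rintro ⟨hk, h⟩
    obtain ⟨k, rfl⟩ : ∃ j, k = 2 + j := ⟨k - 2, by omega⟩
    obtain ⟨κ, rfl⟩ : ∃ j, κ = 2 + j := ⟨κ - 2, by omega⟩
    have h := h.add_left_cancel' 2
    rw [Nat.ModEq, Nat.mod_eq_of_lt (show κ < p - 1 by omega)] at h
    exact ⟨k / (p - 1), by have := Nat.mod_add_div k (p - 1); omega⟩
  · rintro ⟨c, rfl⟩
    exact ⟨by omega, by simp [Nat.ModEq]⟩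

variable {p : ℕ} [Fact p.Prime]

lemma norm_weightPt_sub_le (hp : 5 ≤ p) (k l : ℕ) : ‖weightPt p k - weightPt p l‖ ≤ 1 := by
  rcases eq_or_ne k l with rfl | h
  · simp
  · rw [Padic.norm_le_one_iff_val_nonneg, (valuation_weightPt_sub hp h).2]
    positivity

lemma padicValInt_weight_sub (hp : 5 ≤ p) (κ : ℕ) {k c : ℕ} (h : k < c) :
    padicValInt p (((κ + (p - 1) * c : ℕ) : ℤ) - (κ + (p - 1) * k : ℕ)) = padicValNat p (c - k) := by
  rw [← Nat.cast_sub (by gcongr), padicValInt.of_nat,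
    show κ + (p - 1) * c - (κ + (p - 1) * k) = (p - 1) * (c - k) by
      rw [Nat.mul_sub]; omega, padicValNat.mul (by omega) (by omega),
    padicValNat.eq_zero_of_not_dvd fun h => absurd (Nat.le_of_dvd (by omega) h) (by omega), zero_add]

lemma valuation_prod_ne_zero {ι : Type*} (s : Finset ι) (f : ι → ℚ_[p]) (hf : ∀ i ∈ s, f i ≠ 0) :
    (∏ i ∈ s, f i).valuation = ∑ i ∈ s, (f i).valuation := by
  classical
  induction s using Finset.induction_on with
  | empty => simp
  | insert i s hi ih =>
    rw [Finset.prod_insert hi, Finset.sum_insert hi, Padic.valuation_mul (hf i (by simp))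
      (Finset.prod_ne_zero_iff.2 fun j hj => hf j (by simp [hj])), ih fun j hj => hf j (by simp [hj])]

variable {O : Type*} [CommRing O] [Algebra ℤ_[p] O]
  {H : Type*} [AddCommGroup H] [Module O H] [Module (iwasawaAlgebra p O)ᵐᵒᵖ H]

lemma norm_eval_ghostCoeff_le (hp : 5 ≤ p) (κ : ℕ) (η : (ZMod p)ˣ →* Oˣ) (n k : ℕ) :
    ‖(ghostCoeff p O H κ η n).eval (weightPt p k)‖ ≤ 1 := by
  refine finprod_mem_induction (fun f : ℚ_[p][X] => ‖f.eval (weightPt p k)‖ ≤ 1) (by simp)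
    (fun f g hf hg => ?_) fun l _ => ?_
  · rw [eval_mul, norm_mul]
    exact mul_le_one₀ hf (norm_nonneg _) hg
  · rw [eval_pow, norm_pow]
    exact pow_le_one₀ (norm_nonneg _) (by simpa using norm_weightPt_sub_le hp k l)

/-- The ghost coefficients of index at most the unramified dimension of a weight do not vanish at
that weight, and only smaller weights contribute to their valuations. -/
lemma eval_ghostCoeff (hp : 5 ≤ p) {κ : ℕ} (h2 : 2 ≤ κ) (hκ : κ ≤ p) {η : (ZMod p)ˣ →* Oˣ}
    (hmono : Monotone fun c => dUr p O H (κ + (p - 1) * c) η) {n c : ℕ}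
    (hn : n ≤ dUr p O H (κ + (p - 1) * c) η) :
    (ghostCoeff p O H κ η n).eval (weightPt p (κ + (p - 1) * c)) ≠ 0 ∧
      ((ghostCoeff p O H κ η n).eval (weightPt p (κ + (p - 1) * c))).valuation =
        IsJumpSeq.ghostVal p c (fun c => dUr p O H (κ + (p - 1) * c) η)
          (fun c => dIw p O H (κ + (p - 1) * c) (doubled η)) n := by
  have hinj : Function.Injective fun c => κ + (p - 1) * c := fun c c' h => by
    have h : κ + (p - 1) * c = κ + (p - 1) * c' := h
    exact Nat.eq_of_mul_eq_mul_left (show 0 < p - 1 by omega) (by omega)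
  rw [ghostCoeff, setOf_weight_eq_range hp h2 hκ, finprod_mem_range hinj,
    finprod_eq_prod_of_mulSupport_subset (s := Finset.range c), eval_prod]
  swap
  · intro k hk
    by_contra hck
    refine hk ?_
    have h : dUr p O H (κ + (p - 1) * c) η ≤ dUr p O H (κ + (p - 1) * k) η :=
      hmono (by simpa using hck)
    have h0 : ghostMult p O H η n (κ + (p - 1) * k) = 0 := if_neg (by omega)
    simp [h0]
  have hne : ∀ k ∈ Finset.range c,
      weightPt p (κ + (p - 1) * c) - weightPt p (κ + (p - 1) * k) ≠ 0 := fun k hk =>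
    (valuation_weightPt_sub hp (hinj.ne (Finset.mem_range.1 hk).ne')).1
  have hne' : ∀ k ∈ Finset.range c, eval (weightPt p (κ + (p - 1) * c))
      ((X - C (weightPt p (κ + (p - 1) * k))) ^ ghostMult p O H η n (κ + (p - 1) * k)) ≠ 0 :=
    fun k hk => by simpa using fun h => absurd h (hne k hk)
  refine ⟨Finset.prod_ne_zero_iff.2 hne', ?_⟩
  rw [valuation_prod_ne_zero _ _ hne', IsJumpSeq.ghostVal]
  refine Finset.sum_congr rfl fun k hk => ?_
  rw [Finset.mem_range] at hk
  rw [eval_pow, Padic.valuation_pow, eval_sub, eval_X, eval_C,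
    (valuation_weightPt_sub hp (hinj.ne hk.ne')).2, padicValInt_weight_sub hp κ hk, ghostMult]

end GhostCoeff

/-! ### Comparison of the two bounds -/

section Bound

variable {p a s : ℕ}

/-- The bound on the slopes, in terms of the jumps. -/
lemma bound_eq {d : ℕ} (hd : 1 ≤ d) :
    ((p : ℝ) - 1) / 2 * ((d : ℝ) - 1) - deltaEps p a s + betaEps p a s ((d : ℤ) - 1) =
      (jump p a s (d - 1) : ℝ) - ((d : ℝ) - 1) - deltaEps p a s := by
  obtain ⟨n, rfl⟩ : ∃ n, d = n + 1 := ⟨d - 1, by omega⟩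
  rw [show ((n + 1 : ℕ) : ℤ) - 1 = n by push_cast; ring, Nat.add_sub_cancel, betaEps, jump]
  simp only [Int.even_coe_nat]
  rcases Nat.even_or_odd' n with ⟨m, rfl | rfl⟩
  · rw [if_pos (by simp), if_pos (by simp), show 2 * m / 2 = m by omega]
    push_cast
    ring
  · rw [if_neg (by simp), if_neg (by simp), show (2 * m + 1) / 2 = m by omega]
    push_cast
    ring

/-- The two bounds on the slopes are comparable. -/
lemma bound_le (hp : 5 ≤ p) (ha : 1 ≤ a) (ha' : a ≤ p - 4) (hs : s ≤ p - 2) {c d : ℕ}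
    (hd : ∀ n, n < d → jump p a s n ≤ c) :
    ((p : ℝ) - 1) / 2 * ((d : ℝ) - 1) - deltaEps p a s + betaEps p a s ((d : ℤ) - 1) ≤
      (⌊(((kEps p a s + (p - 1) * c : ℕ) : ℝ) - 1 - min ((a : ℝ) + 1) ((p : ℝ) - 2 - a)) /
        ((p : ℝ) + 1)⌋ : ℤ) := by
  obtain ⟨m, hm, hm'⟩ : ∃ m : ℕ, m = min (a + 1) (p - 2 - a) ∧
      min ((a : ℝ) + 1) ((p : ℝ) - 2 - a) = m := by
    refine ⟨_, rfl, ?_⟩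
    rw [Nat.cast_min, Nat.cast_sub (by omega), Nat.cast_sub (by omega)]
    push_cast
    rfl
  obtain ⟨s', κ, h1, h2, h3, h4, h5, h6, h7⟩ := weight_relations hp ha' hs
  obtain ⟨h8, h9, h10, h11⟩ := tOne_add_three_le hp ha ha' hs
  obtain ⟨P, rfl⟩ : ∃ P, p = P + 1 := ⟨p - 1, by omega⟩
  have hk : ((kEps (P + 1) a s + (P + 1 - 1) * c : ℕ) : ℝ) = 2 + κ + P * c := by
    rw [kEps, h4, Nat.add_sub_cancel]
    push_cast
    ring
  rw [hm', hk]
  suffices h : ∃ B : ℤ, ((P + 1 : ℕ) - 1 : ℝ) / 2 * ((d : ℝ) - 1) - deltaEps (P + 1) a s +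
      betaEps (P + 1) a s ((d : ℤ) - 1) = B ∧ ((P : ℤ) + 2) * B ≤ 2 + κ + P * c - 1 - m by
    obtain ⟨B, hB, hB'⟩ := h
    rw [hB, Int.cast_le, Int.le_floor, le_div_iff₀ (by positivity)]
    have : ((P : ℝ) + 2) * B ≤ 2 + κ + P * c - 1 - m := by exact_mod_cast hB'
    push_cast
    linarith
  rcases Nat.eq_zero_or_pos d with rfl | hd0
  · refine ⟨(tTwo (P + 1) a s : ℤ) - (P + 1) - deltaEps (P + 1) a s, ?_, ?_⟩
    · rw [betaEps, if_neg (by decide)]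
      push_cast
      ring
    · have hc : (0 : ℤ) ≤ P * c := by positivity
      rcases lt_or_ge (tTwo (P + 1) a s) (P + 1 + deltaEps (P + 1) a s) with h | h
      · have h12 : ((P : ℤ) + 2) * ((tTwo (P + 1) a s : ℤ) - (P + 1) - deltaEps (P + 1) a s) ≤
            (P + 2) * (-1) := mul_le_mul_of_nonneg_left (by omega) (by positivity)
        omega
      · rw [show (tTwo (P + 1) a s : ℤ) - (P + 1) - deltaEps (P + 1) a s = 0 by omega, mul_zero]
        obtain h12 | h12 : deltaEps (P + 1) a s = 0 ∨ deltaEps (P + 1) a s = 1 := by omega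
        all_goals rw [h12] at h5 h7 h
        all_goals omega
  · refine ⟨(jump (P + 1) a s (d - 1) : ℤ) - ((d : ℤ) - 1) - deltaEps (P + 1) a s, ?_, ?_⟩
    · rw [bound_eq hd0]
      push_cast
      ring
    · have h := hd (d - 1) (by omega)
      obtain ⟨n, rfl⟩ : ∃ n, d = n + 1 := ⟨d - 1, by omega⟩
      rw [Nat.add_sub_cancel] at h ⊢
      have hc : (P : ℤ) * jump (P + 1) a s n ≤ P * c := by exact_mod_cast Nat.mul_le_mul_left P h
      suffices h' : 2 * (jump (P + 1) a s n : ℤ) - (P + 2) * (n + deltaEps (P + 1) a s) ≤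
          1 + κ - m by
        push_cast
        linarith
      rcases Nat.even_or_odd' n with ⟨e, rfl | rfl⟩
      · rw [jump, if_pos (by simp), show 2 * e / 2 = e by omega]
        suffices h' : 2 * (tOne (P + 1) a s : ℤ) - (P + 2) * deltaEps (P + 1) a s ≤ 1 + κ - m by
          push_cast
          linarith
        obtain h12 | h12 : deltaEps (P + 1) a s = 0 ∨ deltaEps (P + 1) a s = 1 := by omega
        all_goals rw [h12] at h5 h7 ⊢
        all_goals omega
      · rw [jump, if_neg (by simp), show (2 * e + 1) / 2 = e by omega]
        suffices h' : 2 * (tTwo (P + 1) a s : ℤ) - (P + 2) * (1 + deltaEps (P + 1) a s) ≤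
            1 + κ - m by
          push_cast
          linarith
        obtain h12 | h12 : deltaEps (P + 1) a s = 0 ∨ deltaEps (P + 1) a s = 1 := by omega
        all_goals rw [h12] at h5 h7 ⊢
        all_goals omega

end Bound

end Ghost

end

theorem propositionP
    (p : ℕ) [Fact p.Prime] (hp : 5 ≤ p)
    {O : Type*} [CommRing O] [IsDomain O] [IsDiscreteValuationRing O] [Algebra ℤ_[p] O]
    [Module.Finite ℤ_[p] O] [FaithfulSMul ℤ_[p] O]
    (a : ℕ) (ha : 1 ≤ a) (ha' : a ≤ p - 4)
    {H : Type*} [AddCommGroup H] [Module O H] [Module (Ghost.iwasawaAlgebra p O)ᵐᵒᵖ H]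
    [IsScalarTower O (Ghost.iwasawaAlgebra p O)ᵐᵒᵖ H]
    (hH : Ghost.IsPrimitive p O a H)
    (ε : (ZMod p)ˣ × (ZMod p)ˣ →* Oˣ) (hε : Ghost.IsRelevant p O a ε)
    (s : ℕ) (hs : s ≤ p - 2) (hsε : ∀ x, Ghost.fstChar ε x = Ghost.teich p O x ^ (-(s : ℤ)))
    (k₀ : ℕ) (hk₀ : 2 ≤ k₀) (hk₀ε : k₀ ≡ Ghost.kEps p a s [MOD p - 1]) :
    let d : ℕ := Ghost.dUr p O H k₀ (Ghost.fstChar ε)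
    let F : PowerSeries ℚ_[p] :=
      Ghost.specialize (Ghost.ghostSeries p O H a s ε) (Ghost.weightPt p k₀)
    let B : ℤ := ⌊((k₀ : ℝ) - 1 - min ((a : ℝ) + 1) ((p : ℝ) - 2 - a)) / ((p : ℝ) + 1)⌋
    let M : ℝ := ((p : ℝ) - 1) / 2 * ((d : ℝ) - 1) - Ghost.deltaEps p a s
      + Ghost.betaEps p a s ((d : ℤ) - 1)
    (∀ i : ℕ, 1 ≤ i → i ≤ d → Ghost.newtonSlope F i ≤ B) ∧
    (∀ i : ℕ, 1 ≤ i → i ≤ d → Ghost.newtonSlope F i ≤ M) ∧ M ≤ B := by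
  intro d F B M
  have hκ : Ghost.kEps p a s ≤ p := by
    have := Nat.mod_lt (a + 2 * s) (show 0 < p - 1 by omega)
    rw [Ghost.kEps]
    omega
  have hκ2 : 2 ≤ Ghost.kEps p a s := by
    rw [Ghost.kEps]
    omega
  obtain ⟨c, rfl⟩ : ∃ c, Ghost.kEps p a s + (p - 1) * c = k₀ := by
    have h : k₀ ∈ {k : ℕ | 2 ≤ k ∧ k ≡ Ghost.kEps p a s [MOD p - 1]} := ⟨hk₀, hk₀ε⟩
    rwa [Ghost.setOf_weight_eq_range hp hκ2 hκ] at h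
  have hrank := fun c => hH.rank_formulas hp ha ha' hs hsε c
  have hmono : Monotone fun c =>
      Ghost.dUr p O H (Ghost.kEps p a s + (p - 1) * c) (Ghost.fstChar ε) := fun c c' h => by
    by_contra! hlt
    exact lt_irrefl _ (((hrank c').1 _).2 ((((hrank c).1 _).1 hlt).trans h))
  have hF : ∀ n, PowerSeries.coeff n F =
      (Ghost.ghostCoeff p O H (Ghost.kEps p a s) (Ghost.fstChar ε) n).eval
        (Ghost.weightPt p (Ghost.kEps p a s + (p - 1) * c)) := fun n => by
    simp [F, Ghost.specialize, Ghost.ghostSeries]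
  have hMB : M ≤ B := Ghost.bound_le hp ha ha' hs fun n hn => ((hrank c).1 n).1 hn
  have hslope : ∀ i : ℕ, 1 ≤ i → i ≤ d → Ghost.newtonSlope F i ≤ M := by
    intro i hi hid
    refine Ghost.newtonSlope_le (fun n => ?_) (fun n hn => ?_) (fun n hn => ?_) hi hid
    · rw [hF]
      exact Ghost.norm_eval_ghostCoeff_le hp _ _ _ _
    · rw [hF]
      exact (Ghost.eval_ghostCoeff hp hκ2 hκ hmono hn).1
    · rw [hF, hF, (Ghost.eval_ghostCoeff hp hκ2 hκ hmono hn).2,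
        (Ghost.eval_ghostCoeff hp hκ2 hκ hmono le_rfl).2]
      rcases hn.lt_or_eq with hn | rfl
      · have h := (Ghost.isJumpSeq_jump hp ha ha' hs).ghostVal_sub_le (c := c)
          (fun k i => (hrank k).1 i) (fun k => (hrank k).2) hn
        have hM : M = _ := Ghost.bound_eq (hi.trans hid)
        rw [hM, mul_comm _ ((d : ℝ) - n)]
        exact_mod_cast h
      · simp [d]
  exact ⟨fun i hi hid => (hslope i hi hid).trans hMB, hslope, hMB⟩
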